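/- Let $a,b,c,d,e$ be real numbers with $b\neq 0$ and let $T>0$. Put $a_0 = 2|a|+3|b|+\tfrac{|d+e|}{2}$. There is a continuous function $\hbar_0:\mathbb R^3\to\mathbb R$, depending only on $a,b,c,d,e$ and $T$, with $\hbar_0(0,0,0)=0$, such that the following holds for every real $s\ge 3$. Let $u$ be a complex-valued solution on $[-T,T]$ of the initial value problem $$\partial_t u + i a\,\partial_x^2 u + b\,\partial_x^3 u + i c\,|u|^2u + d\,|u|^2\partial_x u + e\,u^2\partial_x\bar u = 0,\quad x\in\mathbb R,\qquad u(0)=u_0,$$ that is, $u\in C([-T,T];H^2(\mathbb R))$, $u(0)=u_0$, and the equation holds in the sense of distributions in $x$ at every $t\in[-T,T]$ (for each $\psi\in C_c^\infty(\mathbb R)$ the function $t\mapsto\int u(t)\psi\,dx$ is differentiable on $[-T,T]$, with one-sided derivatives at the end points, and its derivative is the one given by the equation tested against $\psi$). If $$u(t)\in\mathcal X^{s,1} := H^s(\mathbb R)\cap L^2\big((1+|x|^2)\,dx\big)\quad\text{for every } t\in[-T,T],$$ then for every $t\in[-T,T]$ $$\|u(t)\|^2_{L^2(x^2dx)} \le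 e^{a_0T}\Big(\|u_0\|^2_{L^2(x^2dx)} + a_0\,\hbar_0\big(\|u_0\|_{L^2},\|\partial_xu_0\|_{L^2},\|\partial_x^2u_0\|_{L^2}\big)\,T\Big).$$ -/

import Mathlib

open MeasureTheory Set Filter Topology
open scoped FourierTransform ContDiff

noncomputable section

namespace AirySchrodinger

/-- The complex Hilbert space `L²(ℝ, dx)`. -/
abbrev L2 : Type := Lp ℂ 2 (volume : Measure ℝ)

/-- Test functions: smooth, compactly supported, complex valued. -/
def IsTest (ψ : ℝ → ℂ) : Prop := ContDiff ℝ ∞ ψ ∧ HasCompactSupport ψ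

/-- `g` is the weak (distributional) derivative of `f`. -/
def HasWeakDeriv (f g : L2) : Prop :=
  ∀ ψ : ℝ → ℂ, IsTest ψ → ∫ x, f x * deriv ψ x = -∫ x, g x * ψ x

open Classical in
/-- The weak derivative `∂ₓ f ∈ L²` of `f`; it is `0` by convention if `f` has no weak derivative
in `L²`, that is, if `f ∉ H¹`. -/
def wderiv (f : L2) : L2 := if h : ∃ g : L2, HasWeakDeriv f g then h.choose else 0

/-- Density of the Sobolev norm on the Fourier side. Mathlib's Fourier transform is
`∫ exp(-2πixξ) f(x) dx`, so the angular frequency is `2πξ`. -/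
def sobolevDensity (s : ℝ) (f : L2) (ξ : ℝ) : ℝ :=
  (1 + (2 * Real.pi * ξ) ^ 2) ^ s * ‖(𝓕 f : L2) ξ‖ ^ 2

/-- `f ∈ Hˢ(ℝ)`, for `s ≥ 0`. -/
def MemH (s : ℝ) (f : L2) : Prop := Integrable (sobolevDensity s f) volume

/-- The norm of `Hˢ(ℝ)` (meaningful for `f ∈ Hˢ`). -/
def sobolevNorm (s : ℝ) (f : L2) : ℝ := Real.sqrt (∫ ξ, sobolevDensity s f ξ)

/-- `f ∈ L²((1+|x|²)^θ dx)`. -/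
def MemWeighted (θ : ℝ) (f : L2) : Prop :=
  Integrable (fun x : ℝ => (1 + |x| ^ 2) ^ θ * ‖f x‖ ^ 2) volume

/-- The weighted Sobolev space `𝒳^{s,θ} = Hˢ ∩ L²((1+|x|²)^θ dx)`. -/
def MemX (s θ : ℝ) (f : L2) : Prop := MemH s f ∧ MemWeighted θ f

/-- `‖f‖²` in `L²(|x|² dx)` (meaningful for `f` in that space). -/
def weightedNormSq (f : L2) : ℝ := ∫ x : ℝ, |x| ^ 2 * ‖f x‖ ^ 2

/-- The nonlinear part `F(v) = i c |v|² v + d |v|² vₓ + e v² conj(vₓ)`. -/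
def nonlin (c d e : ℝ) (v : L2) (x : ℝ) : ℂ :=
  Complex.I * c * ((‖v x‖ ^ 2 : ℝ) : ℂ) * v x
    + d * ((‖v x‖ ^ 2 : ℝ) : ℂ) * (wderiv v) x
    + e * (v x) ^ 2 * (starRingEnd ℂ) ((wderiv v) x)

/-- `u` is a solution on `[-T,T]` of the initial value problem
`uₜ + i a uₓₓ + b uₓₓₓ + i c |u|² u + d |u|² uₓ + e u² conj(uₓ) = 0`, `u(0) = u₀`:
a continuous curve in `H²(ℝ)` for which the equation holds in the sense of distributions
(tested against smooth compactly supported functions of `x`, for every time `t`; the time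
derivative is one sided at the end points). -/
structure IsSolution (a b c d e T : ℝ) (u₀ : L2) (u : ℝ → L2) : Prop where
  mem : ∀ t ∈ Icc (-T) T, MemH 2 (u t)
  cont : ∀ t₀ ∈ Icc (-T) T,
    Tendsto (fun t => sobolevNorm 2 (u t - u t₀)) (𝓝[Icc (-T) T] t₀) (𝓝 0)
  init : u 0 = u₀
  eqn : ∀ ψ : ℝ → ℂ, IsTest ψ → ∀ t ∈ Icc (-T) T,
    HasDerivWithinAt (fun τ => ∫ x, u τ x * ψ x)
      (-(Complex.I * a * (∫ x, u t x * iteratedDeriv 2 ψ x)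
        - b * (∫ x, u t x * iteratedDeriv 3 ψ x)
        + ∫ x, nonlin c d e (u t) x * ψ x))
      (Icc (-T) T) t

end AirySchrodinger

end

/-!
Up to constants, the time derivative of the weighted mass `∫ x² |u|²` is made of the integrals of
`x ū u_x`, `x ū u_xx` and `x |u|⁴`, hence it is at most `a₀ (∫ x² |u|² + K)` as soon as `K` dominates
`∫ |u_x|²`, `∫ |u_xx|²` and `∫ |u|⁶`, and Grönwall's inequality gives the claim. What has to be proved
is that `K` can be chosen in terms of the initial datum, that is, an a priori bound in `H²`; and the
formal computations have to be justified at the regularity `u ∈ C([-T, T]; H²)`.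

*Mass and weight.* The mass is conserved (`Flow.hasDerivAt_mass`). The weight is first replaced by
the bounded function `χ = R² sin² (x / R) ≤ x²`, which satisfies `|χ'| ≤ 2 √χ`, so that the constants
do not depend on `R` (`re_pairing_weight`, `Flow.weighted_le`); then `R → ∞` (`tendsto_weight`).

*First derivative.* The derivative of `∫ |u_x|²` contains two terms which `∫ |u_x|²` does not
control, multiples of `∫ (|u|²)_x |u_x|²` and of `Im ∫ u² ū_x²`. As `b ≠ 0`, the third order
dispersion produces the same terms in the derivatives of two quartic correctors. For the first this
is `∫ |u|⁴`. For the second it is `Im ∫ γ ū²` with `γ = (1 + ∂ₓ)⁻¹ u²`, a form of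
`Im ∫ (∂ₓ⁻¹ u²) ū²` which is defined on `H¹` and whose evolution differs from a multiple of
`Im ∫ u² ū_x²` by terms without loss of derivatives (`im_pairing_resolvent`). The corrected energy
then satisfies a linear differential inequality (`Flow.hasDerivAt_energy₁`, `Flow.bound₁`).

*Second derivative.* In the derivative of `∫ |u_xx|²` the bad terms are quadratic in `u_xx` and have a
factor `u u_x`, with coefficients `d` and `e`. They are cancelled by the corrector
`Re ∫ (α |ū u_x|² + β (ū u_x)²)` with `3bα = 4d + 2e` and `3bβ = d + 3e` (`re_integral_leadK`,
`Flow.hasDerivAt_energy₂`, `Flow.bound₂`). Both bounds are explicit continuous functions of the norms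
of the initial datum which vanish at zero, and `ħ₀ = Y + Z + Y³` where `Y` bounds the square of the
`H¹` norm and `Z` bounds `∫ |u_xx|²`.

*Regularity.* A solution is differentiable in time as a curve in `H⁻¹`, with derivative `p + ∂ₓ q`
where `p` and `q` are square integrable and `q = -b u_xx` (`WD`, `Flow`, `IsSolution.exists_flow`).
Such curves have a product rule and can be paired with curves in `H¹` (`WD.mul`,
`WD.hasDerivAt_of_eq`). This suffices for the mass, for the weighted mass and for the quartic
correctors which involve only `u²`. The quantities involving `u_x` and `u_xx`, which are not
differentiable in `H⁻¹`, are limits of the same quantities for difference quotients, whose time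
derivatives converge locally uniformly in time (`hasDerivAt_of_tendsto_joint`).
-/

open scoped ContDiff ComplexConjugate

namespace AirySchrodinger

section

/-! ### Absolutely continuous functions on the line -/

/-- `f` is locally absolutely continuous with derivative `g`: it is a primitive of the locally
integrable function `g`. -/
structure IsAC (f g : ℝ → ℂ) : Prop where
  intg : LocallyIntegrable g volume
  ftc : ∀ a b : ℝ, ∫ x in a..b, g x = f b - f a

namespace IsAC

variable {f f' g g' : ℝ → ℂ}

lemma intervalIntegrable (h : IsAC f f') (a b : ℝ) : IntervalIntegrable f' volume a b :=
  (h.intg.integrableOn_isCompact isCompact_uIcc).intervalIntegrable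

lemma eq_add (h : IsAC f f') (a : ℝ) : f = fun x => f a + ∫ t in a..x, f' t := by
  funext x; rw [h.ftc]; ring

lemma continuous (h : IsAC f f') : Continuous f := by
  rw [h.eq_add 0]
  exact continuous_const.add
    (intervalIntegral.continuous_primitive (fun a b => h.intervalIntegrable a b) 0)

lemma ae_hasDerivAt (h : IsAC f f') : ∀ᵐ x, HasDerivAt f (f' x) x := by
  filter_upwards [LocallyIntegrable.ae_hasDerivAt_integral h.intg] with x hx
  rw [h.eq_add 0]
  exact (hx 0).const_add _

lemma absolutelyContinuousOnInterval (h : IsAC f f') (a b : ℝ) :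
    AbsolutelyContinuousOnInterval f a b := by
  have hI : IntervalIntegrable (fun x => ‖f' x‖) volume a b := (h.intervalIntegrable a b).norm
  have hH := hI.absolutelyContinuousOnInterval_intervalIntegral (c := a) left_mem_uIcc
  refine squeeze_zero (fun E => Finset.sum_nonneg fun _ _ => dist_nonneg) (fun E => ?_) hH
  refine Finset.sum_le_sum fun i _ => ?_
  have e1 := h.ftc (E.2 i).2 (E.2 i).1
  have e2 := intervalIntegral.integral_interval_sub_left
    (f := fun x => ‖f' x‖) (μ := volume) (a := a) (b := (E.2 i).1) (c := (E.2 i).2)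
    (h.intervalIntegrable _ _).norm (h.intervalIntegrable _ _).norm
  rw [dist_eq_norm, ← e1, Real.dist_eq, e2]
  exact intervalIntegral.norm_integral_le_abs_integral_norm

/-- A primitive of a locally integrable function. -/
lemma primitive (hi : LocallyIntegrable f' volume) (a : ℝ) :
    IsAC (fun x => ∫ t in a..x, f' t) f' :=
  ⟨hi, fun _ _ => (intervalIntegral.integral_interval_sub_left
    (hi.integrableOn_isCompact isCompact_uIcc).intervalIntegrable
    (hi.integrableOn_isCompact isCompact_uIcc).intervalIntegrable).symm⟩

/-- An absolutely continuous function is a primitive of its almost everywhere derivative. -/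
lemma of_absolutelyContinuous (hi : LocallyIntegrable f' volume)
    (hac : ∀ a b, AbsolutelyContinuousOnInterval f a b)
    (hd : ∀ᵐ x, HasDerivAt f (f' x) x) : IsAC f f' := by
  refine ⟨hi, fun a b => ?_⟩
  have hP := primitive hi a
  obtain ⟨C, hC⟩ := ((hac a b).sub (hP.absolutelyContinuousOnInterval a
      b)).const_of_ae_hasDerivAt_zero (by
    filter_upwards [hd, hP.ae_hasDerivAt] with x h2 h3 _
    simpa using h2.sub h3)
  have ha := hC a left_mem_uIcc
  have hb := hC b right_mem_uIcc
  simp only [Pi.sub_apply, intervalIntegral.integral_same] at ha hb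
  linear_combination ha - hb

/-- Product rule for locally absolutely continuous functions. -/
lemma mul (hf : IsAC f f') (hg : IsAC g g') :
    IsAC (fun x => f x * g x) (fun x => f' x * g x + f x * g' x) := by
  refine of_absolutelyContinuous ?_ (fun a b => ?_) ?_
  · exact (hf.intg.mul_continuous hg.continuous).add (hg.intg.continuous_mul hf.continuous)
  · exact (hf.absolutelyContinuousOnInterval a b).smul (hg.absolutelyContinuousOnInterval a b)
  · filter_upwards [hf.ae_hasDerivAt, hg.ae_hasDerivAt] with x h1 h2
    exact h1.mul h2

lemma add (hf : IsAC f f') (hg : IsAC g g') :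
    IsAC (fun x => f x + g x) (fun x => f' x + g' x) :=
  ⟨hf.intg.add hg.intg, fun a b => by
    rw [intervalIntegral.integral_add (hf.intervalIntegrable a b) (hg.intervalIntegrable a b),
      hf.ftc, hg.ftc]; ring⟩

lemma const_mul (c : ℂ) (hf : IsAC f f') : IsAC (fun x => c * f x) (fun x => c * f' x) :=
  ⟨hf.intg.smul c, fun a b => by
    rw [intervalIntegral.integral_const_mul, hf.ftc]; ring⟩

lemma star (hf : IsAC f f') : IsAC (fun x => conj (f x)) (fun x => conj (f' x)) := by
  refine of_absolutelyContinuous ?_ (fun a b => ?_) ?_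
  · intro x
    obtain ⟨s, hs, h⟩ := hf.intg x
    refine ⟨s, hs, ?_⟩
    rw [IntegrableOn, ← integrable_norm_iff]
    · simpa using h.norm
    · exact Complex.continuous_conj.comp_aestronglyMeasurable h.aestronglyMeasurable
  · have := hf.absolutelyContinuousOnInterval a b
    unfold AbsolutelyContinuousOnInterval at this ⊢
    simpa only [Complex.dist_conj_conj] using this
  · filter_upwards [hf.ae_hasDerivAt] with x h1
    exact h1.star

lemma comp_add (hf : IsAC f f') (h : ℝ) : IsAC (fun x => f (x + h)) (fun x => f' (x + h)) := by
  refine ⟨fun x => ?_, fun a b => ?_⟩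
  · obtain ⟨s, hs, hi⟩ := hf.intg (x + h)
    refine ⟨(fun y => y + h) ⁻¹' s, (continuous_add_const h).continuousAt hs, ?_⟩
    exact (measurePreserving_add_right volume h).integrableOn_comp_preimage
      (measurableEmbedding_addRight h) |>.2 hi
  · rw [intervalIntegral.integral_comp_add_right, hf.ftc]

lemma of_hasDerivAt (hd : ∀ x, HasDerivAt f (f' x) x) (hc : Continuous f') : IsAC f f' :=
  ⟨hc.locallyIntegrable, fun a b =>
    intervalIntegral.integral_eq_sub_of_hasDerivAt (fun x _ => hd x) (hc.intervalIntegrable a b)⟩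

lemma tendsto_atTop (hf : IsAC f f') (h : Integrable f volume) (h' : Integrable f' volume) :
    Tendsto f atTop (𝓝 0) := by
  have h1 : Tendsto f atTop (𝓝 (f 0 + ∫ t in Ioi 0, f' t)) := by
    rw [hf.eq_add 0]
    simpa using (intervalIntegral_tendsto_integral_Ioi 0 h'.integrableOn tendsto_id).const_add (f 0)
  have := IntegrableAtFilter.eq_zero_of_tendsto (l := atTop) (μ := (volume : Measure ℝ))
    (h.integrableAtFilter _) (fun s hs => ?_) h1
  · rwa [this] at h1
  · obtain ⟨a, ha⟩ := mem_atTop_sets.1 hs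
    exact measure_mono_top (fun x hx => ha x hx) (Real.volume_Ici (a := a))

lemma tendsto_atBot (hf : IsAC f f') (h : Integrable f volume) (h' : Integrable f' volume) :
    Tendsto f atBot (𝓝 0) := by
  have h1 : Tendsto f atBot (𝓝 (f 0 - ∫ t in Iic 0, f' t)) := by
    have : f = fun x => f 0 - ∫ t in x..0, f' t := by funext x; rw [hf.ftc]; ring
    rw [this]
    simpa using (intervalIntegral_tendsto_integral_Iic 0 h'.integrableOn tendsto_id).const_sub (f 0)
  have := IntegrableAtFilter.eq_zero_of_tendsto (l := atBot) (μ := (volume : Measure ℝ))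
    (h.integrableAtFilter _) (fun s hs => ?_) h1
  · rwa [this] at h1
  · obtain ⟨a, ha⟩ := mem_atBot_sets.1 hs
    exact measure_mono_top (fun x hx => ha x hx) (Real.volume_Iic (a := a))

lemma eq_integral_Iic (hf : IsAC f f') (h : Integrable f volume) (h' : Integrable f' volume)
    (x : ℝ) : f x = ∫ t in Iic x, f' t := by
  have h1 := intervalIntegral_tendsto_integral_Iic x h'.integrableOn tendsto_id
  have h2 : Tendsto (fun i => ∫ t in (id i)..x, f' t) atBot (𝓝 (f x - 0)) := by
    simp only [hf.ftc, id]
    exact (hf.tendsto_atBot h h').const_sub _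
  simpa using tendsto_nhds_unique h2 h1

/-- The integral of a total derivative vanishes. -/
lemma integral_eq_zero (hf : IsAC f f') (h : Integrable f volume) (h' : Integrable f' volume) :
    ∫ x, f' x = 0 := by
  have h1 := intervalIntegral_tendsto_integral h' tendsto_neg_atTop_atBot tendsto_id
  have h2 : Tendsto (fun i : ℝ => ∫ t in (-i)..(id i), f' t) atTop (𝓝 (0 - 0)) := by
    simp only [hf.ftc, id]
    exact (hf.tendsto_atTop h h').sub ((hf.tendsto_atBot h h').comp tendsto_neg_atTop_atBot)
  simpa using tendsto_nhds_unique h1 h2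

lemma norm_le (hf : IsAC f f') (h : Integrable f volume) (h' : Integrable f' volume)
    (x : ℝ) : ‖f x‖ ≤ ∫ t, ‖f' t‖ := by
  rw [hf.eq_integral_Iic h h' x]
  exact (norm_integral_le_integral_norm _).trans
    (setIntegral_le_integral h'.norm (ae_of_all _ fun _ => norm_nonneg _))

end IsAC

/-! ### The `L²` norm of functions -/

/-- The `L²(ℝ)` norm of a function (meaningful for `MemLp f 2`). -/
noncomputable def nrm (f : ℝ → ℂ) : ℝ := (eLpNorm f 2 (volume : Measure ℝ)).toReal

/-- Square integrability on the line. -/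
abbrev L2fun (f : ℝ → ℂ) : Prop := MemLp f 2 (volume : Measure ℝ)

variable {f f' g g' k : ℝ → ℂ}

lemma nrm_nonneg : 0 ≤ nrm f := ENNReal.toReal_nonneg

@[simp] lemma nrm_zero : nrm (fun _ => 0) = 0 := by simp [nrm]

lemma nrm_add_le (hf : L2fun f) (hg : L2fun g) : nrm (fun x => f x + g x) ≤ nrm f + nrm g := by
  unfold nrm
  rw [← ENNReal.toReal_add hf.eLpNorm_ne_top hg.eLpNorm_ne_top]
  exact ENNReal.toReal_mono (by simp [hf.eLpNorm_ne_top, hg.eLpNorm_ne_top])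
    (eLpNorm_add_le hf.aestronglyMeasurable hg.aestronglyMeasurable (by norm_num))

lemma nrm_sub_le (hf : L2fun f) (hg : L2fun g) : nrm (fun x => f x - g x) ≤ nrm f + nrm g := by
  unfold nrm
  rw [← ENNReal.toReal_add hf.eLpNorm_ne_top hg.eLpNorm_ne_top]
  exact ENNReal.toReal_mono (by simp [hf.eLpNorm_ne_top, hg.eLpNorm_ne_top])
    (eLpNorm_sub_le hf.aestronglyMeasurable hg.aestronglyMeasurable (by norm_num))

lemma nrm_congr (h : ∀ x, ‖f x‖ = ‖g x‖) : nrm f = nrm g := by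
  unfold nrm; rw [eLpNorm_congr_norm_ae (ae_of_all _ h)]

lemma nrm_congr_ae (h : f =ᵐ[volume] g) : nrm f = nrm g := by
  unfold nrm; rw [eLpNorm_congr_ae h]

@[simp] lemma nrm_conj : nrm (fun x => conj (f x)) = nrm f := nrm_congr fun x => by simp

lemma nrm_sub_comm : nrm (fun x => f x - g x) = nrm (fun x => g x - f x) :=
  nrm_congr fun _ => norm_sub_rev _ _

lemma nrm_const_mul (c : ℂ) : nrm (fun x => c * f x) = ‖c‖ * nrm f := by
  unfold nrm
  have := eLpNorm_const_smul c f 2 (volume : Measure ℝ)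
  have h2 : (c • f) = fun x => c * f x := rfl
  rw [h2] at this
  rw [this]; simp

lemma nrm_mul_le {C : ℝ} (hC : 0 ≤ C) (hg : L2fun g) (hb : ∀ x, ‖f x‖ ≤ C) :
    nrm (fun x => f x * g x) ≤ C * nrm g := by
  unfold nrm
  have h := eLpNorm_le_mul_eLpNorm_of_ae_le_mul (f := fun x => f x * g x) (g := g) (c := C)
    (μ := (volume : Measure ℝ))
    (ae_of_all _ fun x => by rw [norm_mul]; exact mul_le_mul_of_nonneg_right (hb x) (norm_nonneg _)) 2
  have := ENNReal.toReal_mono (by finiteness [hg.eLpNorm_ne_top]) h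
  rwa [ENNReal.toReal_mul, ENNReal.toReal_ofReal hC] at this

lemma nrm_sq (hf : L2fun f) : nrm f ^ 2 = ∫ x, ‖f x‖ ^ 2 := by
  have := hf.eLpNorm_eq_integral_rpow_norm (by norm_num) (by norm_num)
  unfold nrm
  rw [this, ENNReal.toReal_ofReal (by positivity)]
  simp only [ENNReal.toReal_ofNat, Real.rpow_ofNat]
  rw [← one_div, ← Real.sqrt_eq_rpow, Real.sq_sqrt (by positivity)]

lemma L2fun.integrable_mul (hf : L2fun f) (hg : L2fun g) :
    Integrable (fun x => f x * g x) volume := MemLp.integrable_mul hf hg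

lemma integral_norm_mul_le (hf : L2fun f) (hg : L2fun g) :
    ∫ x, ‖f x * g x‖ ≤ nrm f * nrm g := by
  have h := integral_mul_le_Lp_mul_Lq_of_nonneg (μ := (volume : Measure ℝ)) (p := 2) (q := 2)
    (f := fun x => ‖f x‖) (g := fun x => ‖g x‖) (by constructor <;> norm_num)
    (ae_of_all _ fun _ => norm_nonneg _) (ae_of_all _ fun _ => norm_nonneg _)
    (by simpa using hf.norm) (by simpa using hg.norm)
  simp only [norm_mul]
  refine h.trans (le_of_eq ?_)
  simp only [Real.rpow_ofNat]
  rw [← nrm_sq hf, ← nrm_sq hg, ← Real.sqrt_eq_rpow, ← Real.sqrt_eq_rpow,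
    Real.sqrt_sq nrm_nonneg, Real.sqrt_sq nrm_nonneg]

lemma norm_integral_mul_le (hf : L2fun f) (hg : L2fun g) :
    ‖∫ x, f x * g x‖ ≤ nrm f * nrm g :=
  (norm_integral_le_integral_norm _).trans (integral_norm_mul_le hf hg)

lemma L2fun.mul_bdd {C : ℝ} (hg : L2fun g) (hf : AEStronglyMeasurable f volume)
    (hb : ∀ x, ‖f x‖ ≤ C) : L2fun (fun x => f x * g x) :=
  hg.of_le_mul (c := C) (hf.mul hg.aestronglyMeasurable)
    (ae_of_all _ fun x => by rw [norm_mul]; exact mul_le_mul_of_nonneg_right (hb x) (norm_nonneg _))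

lemma L2fun.star (hf : L2fun f) : L2fun (fun x => conj (f x)) :=
  hf.of_le (Complex.continuous_conj.comp_aestronglyMeasurable hf.aestronglyMeasurable)
    (ae_of_all _ fun x => by simp)

lemma L2fun.cmul (c : ℂ) (hf : L2fun f) : L2fun (fun x => c * f x) := hf.const_mul c

lemma L2fun.locallyIntegrable (hf : L2fun f) : LocallyIntegrable f volume :=
  MemLp.locallyIntegrable hf (by norm_num)

lemma L2fun.comp_add (hf : L2fun f) (h : ℝ) : L2fun (fun x => f (x + h)) :=
  hf.comp_measurePreserving (measurePreserving_add_right volume h)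

lemma nrm_comp_add (hf : L2fun f) (h : ℝ) : nrm (fun x => f (x + h)) = nrm f := by
  unfold nrm
  have := eLpNorm_comp_measurePreserving (p := 2) hf.aestronglyMeasurable
    (measurePreserving_add_right (volume : Measure ℝ) h)
  rw [← this]; rfl

/-! ### The Sobolev space `H¹` of functions -/

/-- `f` is (the continuous representative of) an element of `H¹(ℝ)`, with derivative `f'`. -/
structure IsH1 (f f' : ℝ → ℂ) : Prop where
  ac : IsAC f f'
  mem : L2fun f
  mem' : L2fun f'

namespace IsH1

lemma continuous (hf : IsH1 f f') : Continuous f := hf.ac.continuous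

/-- Integration by parts on the line. -/
lemma integral_add (hf : IsH1 f f') (hg : IsH1 g g') :
    ∫ x, (f' x * g x + f x * g' x) = 0 :=
  (hf.ac.mul hg.ac).integral_eq_zero (hf.mem.integrable_mul hg.mem)
    ((hf.mem'.integrable_mul hg.mem).add (hf.mem.integrable_mul hg.mem'))

lemma star (hf : IsH1 f f') : IsH1 (fun x => conj (f x)) (fun x => conj (f' x)) :=
  ⟨hf.ac.star, hf.mem.star, hf.mem'.star⟩

/-- The one-dimensional Sobolev inequality. -/
lemma sq_norm_le (hf : IsH1 f f') (x : ℝ) : ‖f x‖ ^ 2 ≤ 2 * (nrm f * nrm f') := by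
  have h := (hf.ac.mul hf.star.ac).norm_le (hf.mem.integrable_mul hf.star.mem)
    ((hf.mem'.integrable_mul hf.star.mem).add (hf.mem.integrable_mul hf.star.mem')) x
  have h1 := integral_norm_mul_le hf.mem' hf.star.mem
  have h2 := integral_norm_mul_le hf.mem hf.star.mem'
  have h3 : ∫ t, ‖f' t * conj (f t) + f t * conj (f' t)‖ ≤
      (∫ t, ‖f' t * conj (f t)‖) + ∫ t, ‖f t * conj (f' t)‖ := by
    rw [← MeasureTheory.integral_add (hf.mem'.integrable_mul hf.star.mem).norm
      (hf.mem.integrable_mul hf.star.mem').norm]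
    exact integral_mono ((hf.mem'.integrable_mul hf.star.mem).add
      (hf.mem.integrable_mul hf.star.mem')).norm ((hf.mem'.integrable_mul hf.star.mem).norm.add
      (hf.mem.integrable_mul hf.star.mem').norm) fun t => norm_add_le _ _
  simp only [nrm_conj] at h1 h2
  have h4 : ‖f x‖ ^ 2 = ‖f x * conj (f x)‖ := by rw [norm_mul, Complex.norm_conj, sq]
  rw [h4]
  nlinarith

lemma norm_le (hf : IsH1 f f') (x : ℝ) : ‖f x‖ ≤ nrm f + nrm f' := by
  have h := hf.sq_norm_le x
  have h1 : 0 ≤ nrm f := nrm_nonneg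
  have h2 : 0 ≤ nrm f' := nrm_nonneg
  exact le_of_sq_le_sq (by nlinarith) (by positivity)

lemma add (hf : IsH1 f f') (hg : IsH1 g g') :
    IsH1 (fun x => f x + g x) (fun x => f' x + g' x) :=
  ⟨hf.ac.add hg.ac, hf.mem.add hg.mem, hf.mem'.add hg.mem'⟩

lemma const_mul (c : ℂ) (hf : IsH1 f f') : IsH1 (fun x => c * f x) (fun x => c * f' x) :=
  ⟨hf.ac.const_mul c, hf.mem.cmul c, hf.mem'.cmul c⟩

lemma sub (hf : IsH1 f f') (hg : IsH1 g g') :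
    IsH1 (fun x => f x - g x) (fun x => f' x - g' x) := by
  simpa [sub_eq_add_neg] using hf.add (hg.const_mul (-1))

lemma comp_add (hf : IsH1 f f') (h : ℝ) : IsH1 (fun x => f (x + h)) (fun x => f' (x + h)) :=
  ⟨hf.ac.comp_add h, hf.mem.comp_add h, hf.mem'.comp_add h⟩

lemma mul_mem (hf : IsH1 f f') (hg : L2fun g) : L2fun (fun x => f x * g x) :=
  hg.mul_bdd hf.continuous.aestronglyMeasurable hf.norm_le

lemma mem_mul (hg : IsH1 g g') (hf : L2fun f) : L2fun (fun x => f x * g x) := by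
  simpa [mul_comm] using hg.mul_mem hf

/-- `H¹(ℝ)` is an algebra. -/
lemma mul (hf : IsH1 f f') (hg : IsH1 g g') :
    IsH1 (fun x => f x * g x) (fun x => f' x * g x + f x * g' x) :=
  ⟨hf.ac.mul hg.ac, hf.mul_mem hg.mem, (hg.mem_mul hf.mem').add (hf.mul_mem hg.mem')⟩

end IsH1

end

section

/-! ### Weak derivatives -/

lemma IsTest.deriv {ψ : ℝ → ℂ} (h : IsTest ψ) : IsTest (deriv ψ) :=
  ⟨(contDiff_infty_iff_deriv.1 h.1).2, h.2.deriv⟩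

lemma IsTest.hasDerivAt {ψ : ℝ → ℂ} (h : IsTest ψ) (x : ℝ) : HasDerivAt ψ (_root_.deriv ψ x) x :=
  ((contDiff_infty_iff_deriv.1 h.1).1 x).hasDerivAt

lemma IsTest.mem {ψ : ℝ → ℂ} (h : IsTest ψ) : L2fun ψ :=
  h.1.continuous.memLp_of_hasCompactSupport h.2

lemma IsTest.isH1 {ψ : ℝ → ℂ} (h : IsTest ψ) : IsH1 ψ (_root_.deriv ψ) :=
  ⟨IsAC.of_hasDerivAt h.hasDerivAt h.deriv.1.continuous, h.mem, h.deriv.mem⟩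

lemma IsTest.star {ψ : ℝ → ℂ} (h : IsTest ψ) : IsTest (fun x => conj (ψ x)) :=
  ⟨Complex.conjCLE.contDiff.comp h.1, h.2.comp_left (g := fun z => conj z) (by simp)⟩

/-- A smooth compactly supported function with vanishing integral has a compactly supported
primitive. -/
lemma exists_primitive {g : ℝ → ℝ} (hg : ContDiff ℝ ∞ g) (hc : HasCompactSupport g)
    (h0 : ∫ x, g x = 0) :
    ∃ θ : ℝ → ℂ, IsTest θ ∧ deriv θ = fun x => ((g x : ℝ) : ℂ) := by
  obtain ⟨R, hR⟩ := hc.isCompact.isBounded.subset_closedBall 0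
  have hsupp : ∀ x, R < |x| → g x = 0 := fun x hx => by
    by_contra h
    have := hR (subset_tsupport _ (Function.mem_support.2 h))
    simp at this; linarith
  have hR0 : ∀ x, x ∉ Ioc (-R) R → x ≠ -R → g x = 0 := fun x hx hx2 => by
    apply hsupp
    rw [mem_Ioc, not_and_or] at hx
    rcases hx with h | h
    · have : x < -R := lt_of_le_of_ne (not_lt.1 h) hx2
      exact lt_of_lt_of_le (by linarith) (neg_le_abs x)
    · exact lt_of_lt_of_le (not_le.1 h) (le_abs_self x)
  set G : ℝ → ℝ := fun x => ∫ t in (-R)..x, g t with hG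
  have hd : ∀ x, HasDerivAt G (g x) x := fun x =>
    intervalIntegral.integral_hasDerivAt_right (hg.continuous.intervalIntegrable _ _)
      (hg.continuous.stronglyMeasurableAtFilter _ _) hg.continuous.continuousAt
  have hdG : deriv G = g := funext fun x => (hd x).deriv
  have hGs : ContDiff ℝ ∞ G := contDiff_infty_iff_deriv.2
    ⟨fun x => (hd x).differentiableAt, hdG ▸ hg⟩
  have hGc : HasCompactSupport G := by
    refine HasCompactSupport.of_support_subset_isCompact (isCompact_closedBall (0 : ℝ) |R|) ?_
    intro x hx
    by_contra hx2
    simp only [Metric.mem_closedBall, dist_zero_right, Real.norm_eq_abs, not_le] at hx2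
    apply hx
    simp only [hG]
    rcases le_or_gt x 0 with h | h
    · rw [intervalIntegral.integral_symm, intervalIntegral.integral_of_le
        (by rw [abs_of_nonpos h] at hx2; linarith [neg_abs_le R, neg_le_abs R, le_abs_self R])]
      rw [setIntegral_congr_ae (g := fun _ => (0 : ℝ)) measurableSet_Ioc, integral_zero, neg_zero]
      have hne : ∀ᵐ t : ℝ, t ≠ -R := by simp [ae_iff]
      filter_upwards [hne] with t ht htm
      refine hR0 t (fun h' => ?_) ht
      have := htm.2
      exact ht (le_antisymm this h'.1.le)
    · have hxR : R < x := by rw [abs_of_pos h] at hx2; exact (le_abs_self R).trans_lt hx2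
      have hxR' : -R ≤ x := by rw [abs_of_pos h] at hx2; linarith [neg_le_abs R]
      rw [intervalIntegral.integral_of_le hxR', setIntegral_eq_integral_of_ae_compl_eq_zero, h0]
      have hne : ∀ᵐ t : ℝ, t ≠ -R := by simp [ae_iff]
      filter_upwards [hne] with t ht htm
      exact hR0 t (fun h' => htm ⟨h'.1, h'.2.trans hxR.le⟩) ht
  refine ⟨fun x => (G x : ℂ), ⟨Complex.ofRealCLM.contDiff.comp hGs,
    hGc.comp_left (g := fun z : ℝ => (z : ℂ)) (by simp)⟩, funext fun x => ?_⟩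
  exact ((hd x).ofReal_comp).deriv

/-- The lemma of du Bois-Reymond: a locally integrable function whose weak derivative vanishes is
constant. -/
lemma ae_const_of_integral_deriv {w : ℝ → ℂ} (hw : LocallyIntegrable w volume)
    (h : ∀ θ : ℝ → ℂ, IsTest θ → ∫ x, w x * deriv θ x = 0) :
    ∃ c : ℂ, w =ᵐ[volume] fun _ => c := by
  let η := (default : ContDiffBump (0 : ℝ)).normed volume
  have hη : ContDiff ℝ ∞ η := ContDiffBump.contDiff_normed _
  have hηc : HasCompactSupport η := ContDiffBump.hasCompactSupport_normed _
  have hη1 : ∫ x, η x = 1 := ContDiffBump.integral_normed _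
  refine ⟨∫ x, η x • w x, ?_⟩
  have := ae_eq_zero_of_integral_contDiff_smul_eq_zero (μ := volume)
    (hw.sub (locallyIntegrable_const (∫ x, η x • w x))) (fun g hg hgc => ?_)
  · filter_upwards [this] with x hx
    exact sub_eq_zero.1 hx
  have ig : Integrable g volume := hg.continuous.integrable_of_hasCompactSupport hgc
  have iη : Integrable η volume := hη.continuous.integrable_of_hasCompactSupport hηc
  obtain ⟨θ, hθ, hθd⟩ := exists_primitive (g := fun x => g x - (∫ y, g y) * η x)
    (hg.sub (contDiff_const.mul hη)) (hgc.sub (hηc.mul_left))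
    (by rw [integral_sub ig (iη.const_mul _), integral_const_mul, hη1]; ring)
  have h1 := h θ hθ
  rw [hθd] at h1
  have i1 : Integrable (fun x => g x • w x) volume :=
    hw.integrable_smul_left_of_hasCompactSupport hg.continuous hgc
  have i2 : Integrable (fun x => η x • w x) volume :=
    hw.integrable_smul_left_of_hasCompactSupport hη.continuous hηc
  have h2 : ∫ x, (g x • w x - (∫ y, g y) • (η x • w x)) = 0 := by
    rw [← h1]
    congr 1; funext x
    simp only [Complex.real_smul]; push_cast; ring
  rw [integral_sub i1 (g := fun x => (∫ y, g y) • (η x • w x)) (i2.smul (∫ y, g y)),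
    integral_smul] at h2
  simp only [Pi.sub_apply, smul_sub]
  rw [integral_sub i1 (ig.smul_const _), integral_smul_const]
  exact h2

/-- A square integrable function with square integrable weak derivative has an absolutely
continuous representative. -/
lemma exists_isH1 {f g : ℝ → ℂ} (hf : L2fun f) (hg : L2fun g)
    (h : ∀ ψ : ℝ → ℂ, IsTest ψ → ∫ x, f x * deriv ψ x = -∫ x, g x * ψ x) :
    ∃ F : ℝ → ℂ, IsH1 F g ∧ F =ᵐ[volume] f := by
  have hP := IsAC.primitive hg.locallyIntegrable 0
  set P : ℝ → ℂ := fun x => ∫ t in (0 : ℝ)..x, g t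
  obtain ⟨c, hc⟩ := ae_const_of_integral_deriv (w := fun x => f x - P x)
    (hf.locallyIntegrable.sub hP.continuous.locallyIntegrable) (fun θ hθ => by
      have h1 := h θ hθ
      have hm := hP.mul hθ.isH1.ac
      have j1 : Integrable (fun x => P x * θ x) volume :=
        (hP.continuous.mul hθ.1.continuous).integrable_of_hasCompactSupport hθ.2.mul_left
      have j2 : Integrable (fun x => P x * deriv θ x) volume :=
        (hP.continuous.mul hθ.deriv.1.continuous).integrable_of_hasCompactSupport
          hθ.deriv.2.mul_left
      have j3 := hg.integrable_mul hθ.mem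
      have h2 := hm.integral_eq_zero j1 (j3.add j2)
      rw [integral_add j3 j2] at h2
      simp only [sub_mul]
      rw [integral_sub (hf.integrable_mul hθ.deriv.mem) j2, h1]
      linear_combination -h2)
  have hF : (fun x => P x + c) =ᵐ[volume] f := by
    filter_upwards [hc] with x hx
    rw [← hx]; ring
  refine ⟨fun x => P x + c, ⟨⟨hP.intg, fun a b => ?_⟩, hf.ae_eq hF.symm, hg⟩, hF⟩
  rw [hP.ftc]; ring

/-- Test functions are dense in `H¹(ℝ)`: in the Hilbert space of pairs of `L²` functions, a pair
`(α, β)` orthogonal to all `(φ, φ')` has `β' = α` weakly, so that it is orthogonal to `H¹`. -/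
lemma IsH1.exists_test {ψ ψ' : ℝ → ℂ} (h : IsH1 ψ ψ') {ε : ℝ} (hε : 0 < ε) :
    ∃ φ : ℝ → ℂ, IsTest φ ∧ nrm (fun x => ψ x - φ x) ≤ ε ∧
      nrm (fun x => ψ' x - deriv φ x) ≤ ε := by
  let K : Submodule ℂ (WithLp 2 (L2 × L2)) :=
    { carrier := {p | ∃ φ, IsTest φ ∧ p.ofLp.1 =ᵐ[volume] φ ∧ p.ofLp.2 =ᵐ[volume] deriv φ}
      add_mem' := by
        rintro p q ⟨φ, hφ, hp1, hp2⟩ ⟨χ, hχ, hq1, hq2⟩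
        refine ⟨fun x => φ x + χ x, ⟨hφ.1.add hχ.1, hφ.2.add hχ.2⟩, ?_, ?_⟩
        · filter_upwards [Lp.coeFn_add p.ofLp.1 q.ofLp.1, hp1, hq1] with x h1 h2 h3
          rw [← h2, ← h3]; exact h1
        · filter_upwards [Lp.coeFn_add p.ofLp.2 q.ofLp.2, hp2, hq2] with x h1 h2 h3
          rw [((hφ.hasDerivAt x).fun_add (hχ.hasDerivAt x)).deriv, ← h2, ← h3]; exact h1
      zero_mem' := by
        refine ⟨fun _ => 0, ⟨contDiff_const, HasCompactSupport.zero⟩, ?_, ?_⟩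
        · exact Lp.coeFn_zero ..
        · rw [show deriv (fun _ : ℝ => (0 : ℂ)) = fun _ => 0 from funext fun x => deriv_const x _]
          exact Lp.coeFn_zero ..
      smul_mem' := by
        rintro c p ⟨φ, hφ, hp1, hp2⟩
        refine ⟨fun x => c * φ x, ⟨contDiff_const.mul hφ.1, hφ.2.mul_left⟩, ?_, ?_⟩
        · filter_upwards [Lp.coeFn_smul c p.ofLp.1, hp1] with x h1 h2
          rw [← h2]; exact h1
        · filter_upwards [Lp.coeFn_smul c p.ofLp.2, hp2] with x h1 h2
          rw [((hφ.hasDerivAt x).const_mul c).deriv, ← h2]; exact h1 }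
  have hmem : WithLp.toLp 2 (h.mem.toLp ψ, h.mem'.toLp ψ') ∈ K.topologicalClosure := by
    rw [← Submodule.orthogonal_orthogonal_eq_closure, Submodule.mem_orthogonal]
    intro p hp
    rw [Submodule.mem_orthogonal] at hp
    set α : L2 := p.ofLp.1
    set β : L2 := p.ofLp.2
    have hα : L2fun (fun x => conj (α x)) := (Lp.memLp α).star
    have hβ : L2fun (fun x => conj (β x)) := (Lp.memLp β).star
    have hw : ∀ φ : ℝ → ℂ, IsTest φ →
        ∫ x, conj (β x) * deriv φ x = -∫ x, conj (α x) * φ x := by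
      intro φ hφ
      have h1 := hp (WithLp.toLp 2 (hφ.mem.toLp φ, hφ.deriv.mem.toLp (deriv φ)))
        ⟨φ, hφ, hφ.mem.coeFn_toLp, hφ.deriv.mem.coeFn_toLp⟩
      rw [← inner_conj_symm, map_eq_zero, WithLp.prod_inner_apply, L2.inner_def, L2.inner_def] at h1
      rw [eq_neg_iff_add_eq_zero, add_comm, ← h1]
      congr 1
      · refine integral_congr_ae ?_
        filter_upwards [hφ.mem.coeFn_toLp] with x hx
        simp only [hx, RCLike.inner_apply']; rfl
      · refine integral_congr_ae ?_
        filter_upwards [hφ.deriv.mem.coeFn_toLp] with x hx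
        simp only [hx, RCLike.inner_apply']; rfl
    obtain ⟨b, hb, hbe⟩ := exists_isH1 hβ hα hw
    rw [WithLp.prod_inner_apply, L2.inner_def, L2.inner_def, ← h.integral_add hb,
      MeasureTheory.integral_add (h.mem'.integrable_mul hb.mem)
        (h.mem.integrable_mul hb.mem'), add_comm]
    congr 1
    · refine integral_congr_ae ?_
      filter_upwards [h.mem'.coeFn_toLp, hbe] with x hx hy
      simp only [hx, hy, RCLike.inner_apply]; rfl
    · refine integral_congr_ae ?_
      filter_upwards [h.mem.coeFn_toLp] with x hx
      simp only [hx, RCLike.inner_apply]; rfl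
  obtain ⟨q, ⟨φ, hφ, hq1, hq2⟩, hd⟩ := Metric.mem_closure_iff.1 hmem ε hε
  have key : ∀ {f g : ℝ → ℂ} (hf : L2fun f) (r : L2), r =ᵐ[volume] g →
      nrm (fun x => f x - g x) = ‖hf.toLp f - r‖ := by
    intro f g hf r hr
    rw [Lp.norm_def]
    refine nrm_congr_ae ?_
    filter_upwards [hr, Lp.coeFn_sub (hf.toLp f) r, hf.coeFn_toLp] with x h1 h2 h3
    rw [h2, Pi.sub_apply, h1, h3]
  rw [dist_eq_norm] at hd
  have h1 := WithLp.prod_norm_sq_eq_of_L2 (WithLp.toLp 2 (h.mem.toLp ψ, h.mem'.toLp ψ') - q)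
  refine ⟨φ, hφ, ?_, ?_⟩
  · rw [key h.mem _ hq1]
    refine le_trans ?_ hd.le
    refine le_of_sq_le_sq ?_ (norm_nonneg _)
    rw [h1]
    exact le_add_of_nonneg_right (sq_nonneg _)
  · rw [key h.mem' _ hq2]
    refine le_trans ?_ hd.le
    refine le_of_sq_le_sq ?_ (norm_nonneg _)
    rw [h1]
    exact le_add_of_nonneg_left (sq_nonneg _)

end

section

/-! ### Sobolev regularity through the Fourier transform -/

lemma wderiv_eq {f g : L2} (h : HasWeakDeriv f g) : wderiv f = g := by
  have hex : ∃ g : L2, HasWeakDeriv f g := ⟨g, h⟩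
  have hw : HasWeakDeriv f (wderiv f) := by
    rw [wderiv, dif_pos hex]; exact hex.choose_spec
  have hg := Lp.memLp g
  have hf := Lp.memLp (wderiv f)
  have hl : LocallyIntegrable (fun x => (wderiv f) x - g x) volume :=
    (L2fun.locallyIntegrable hf).sub (L2fun.locallyIntegrable hg)
  have := ae_eq_zero_of_integral_contDiff_smul_eq_zero (μ := volume) hl (fun φ hφ hc => ?_)
  · refine Lp.ext ?_
    filter_upwards [this] with x hx using sub_eq_zero.1 hx
  · have ht : IsTest (fun x => (φ x : ℂ)) := ⟨Complex.ofRealCLM.contDiff.comp hφ,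
      hc.comp_left (g := fun z : ℝ => (z : ℂ)) (by simp)⟩
    have h1 := h _ ht
    have h2 := hw _ ht
    rw [h1, neg_inj] at h2
    have : ∫ x, φ x • ((wderiv f) x - g x) =
        ∫ x, ((wderiv f) x * (φ x : ℂ) - g x * (φ x : ℂ)) := by
      congr 1; funext x; rw [Complex.real_smul]; ring
    rw [this, integral_sub (L2fun.integrable_mul hf ht.mem) (L2fun.integrable_mul hg ht.mem), h2,
      sub_self]

lemma HasWeakDeriv.sub {f g f' g' : L2} (h : HasWeakDeriv f f') (h' : HasWeakDeriv g g') :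
    HasWeakDeriv (f - g) (f' - g') := by
  intro ψ hψ
  have e : ∀ (p q : L2) (χ : ℝ → ℂ), L2fun χ →
      ∫ x, (p - q : L2) x * χ x = (∫ x, p x * χ x) - ∫ x, q x * χ x := by
    intro p q χ hχ
    rw [← integral_sub (L2fun.integrable_mul (Lp.memLp p) hχ)
      (L2fun.integrable_mul (Lp.memLp q) hχ)]
    refine integral_congr_ae ?_
    filter_upwards [Lp.coeFn_sub p q] with x hx
    rw [hx, Pi.sub_apply, sub_mul]
  rw [e _ _ _ hψ.deriv.mem, e _ _ _ hψ.mem, h ψ hψ, h' ψ hψ]; ring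

/-- If `ξ f̂(ξ)` is square integrable, then `f` has a weak derivative in `L²`, with Fourier
transform `2πiξ f̂(ξ)`. -/
lemma exists_hasWeakDeriv {f : L2}
    (h : L2fun (fun ξ : ℝ => (2 * Real.pi * Complex.I * ξ) * (𝓕 f : L2) ξ)) :
    ∃ g : L2, HasWeakDeriv f g ∧
      (𝓕 g : L2) =ᵐ[volume] fun ξ : ℝ => (2 * Real.pi * Complex.I * ξ) * (𝓕 f : L2) ξ := by
  refine ⟨(𝓕⁻ (h.toLp _ : L2) : L2), fun ψ hψ => ?_, ?_⟩
  · set g : L2 := (𝓕⁻ (h.toLp _ : L2) : L2)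
    have hφ := hψ.star
    let φ : SchwartzMap ℝ ℂ := hφ.2.toSchwartzMap hφ.1
    let φ' : SchwartzMap ℝ ℂ := hφ.deriv.2.toSchwartzMap hφ.deriv.1
    have hφe : ∀ x, φ x = conj (ψ x) := fun x => HasCompactSupport.toSchwartzMap_toFun ..
    have hφe' : ∀ x, φ' x = conj (deriv ψ x) := fun x => by
      have : φ' x = deriv (fun x => conj (ψ x)) x := HasCompactSupport.toSchwartzMap_toFun ..
      rw [this]
      exact ((hψ.hasDerivAt x).star).deriv
    have hF : ∀ ξ, (𝓕 φ' : SchwartzMap ℝ ℂ) ξ =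
        (2 * Real.pi * Complex.I * ξ) * (𝓕 φ : SchwartzMap ℝ ℂ) ξ := by
      intro ξ
      have h1 : (φ : ℝ → ℂ) = fun x => conj (ψ x) := funext hφe
      have h2 : (φ' : ℝ → ℂ) = deriv (φ : ℝ → ℂ) := by
        rw [h1]; funext x
        exact HasCompactSupport.toSchwartzMap_toFun ..
      rw [SchwartzMap.fourier_coe, SchwartzMap.fourier_coe, h2,
        Real.fourier_deriv φ.integrable φ.differentiable (by rw [← h2]; exact φ'.integrable)]
      rfl
    have hg : (𝓕 g : L2) = h.toLp _ := FourierTransform.fourier_fourierInv_eq _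
    have e1 : ∫ x, f x * deriv ψ x = inner ℂ (φ'.toLp 2) f := by
      rw [L2.inner_def]
      refine integral_congr_ae ?_
      filter_upwards [φ'.coeFn_toLp 2] with x hx
      rw [hx, hφe', RCLike.inner_apply]; simp
    have e2 : ∫ x, g x * ψ x = inner ℂ (φ.toLp 2) g := by
      rw [L2.inner_def]
      refine integral_congr_ae ?_
      filter_upwards [φ.coeFn_toLp 2] with x hx
      rw [hx, hφe, RCLike.inner_apply]; simp
    have e3 : inner ℂ (φ.toLp 2) g = inner ℂ (𝓕 (φ.toLp 2) : L2) (𝓕 g : L2) :=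
      (Lp.inner_fourier_eq _ _).symm
    rw [e1, e2, ← Lp.inner_fourier_eq, e3, hg,
      SchwartzMap.toLp_fourier_eq, SchwartzMap.toLp_fourier_eq, L2.inner_def, L2.inner_def,
      ← integral_neg]
    refine integral_congr_ae ?_
    filter_upwards [(𝓕 φ').coeFn_toLp 2, (𝓕 φ).coeFn_toLp 2, h.coeFn_toLp] with ξ h1 h2 h3
    have h4 : (starRingEnd ℂ) (2 : ℂ) = 2 := Complex.conj_ofNat 2
    rw [h1, h2, h3, hF, RCLike.inner_apply, RCLike.inner_apply]
    simp [h4]; ring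
  · rw [FourierTransform.fourier_fourierInv_eq]
    exact h.coeFn_toLp

lemma norm_sq_eq_integral (f : L2) : ‖f‖ ^ 2 = ∫ x, ‖f x‖ ^ 2 := by
  rw [← nrm_sq (Lp.memLp f)]; rfl

/-- Fourier multipliers of order at most two map `H²` to `L²`. -/
lemma l2_of_sobolev {f : L2} (hf : MemH 2 f) {w : ℝ → ℂ} (hw : Measurable w)
    (h : ∀ ξ, ‖w ξ‖ ^ 2 ≤ (1 + (2 * Real.pi * ξ) ^ 2) ^ 2) :
    L2fun (fun ξ => w ξ * (𝓕 f : L2) ξ) ∧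
      ∫ ξ, ‖w ξ * (𝓕 f : L2) ξ‖ ^ 2 ≤ sobolevNorm 2 f ^ 2 := by
  have hm : AEStronglyMeasurable (fun ξ => w ξ * (𝓕 f : L2) ξ) volume :=
    hw.aestronglyMeasurable.mul (Lp.aestronglyMeasurable _)
  have hle : ∀ ξ, ‖w ξ * (𝓕 f : L2) ξ‖ ^ 2 ≤ sobolevDensity 2 f ξ := by
    intro ξ
    rw [norm_mul, mul_pow, sobolevDensity]
    refine mul_le_mul_of_nonneg_right ?_ (sq_nonneg _)
    have := h ξ
    rwa [← Real.rpow_two (1 + _)] at this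
  have hi : Integrable (fun ξ => ‖w ξ * (𝓕 f : L2) ξ‖ ^ 2) volume :=
    Integrable.mono' hf (hm.norm.pow 2) (ae_of_all _ fun ξ => by
      rw [Real.norm_of_nonneg (sq_nonneg _)]; exact hle ξ)
  refine ⟨(memLp_two_iff_integrable_sq_norm hm).2 hi, ?_⟩
  rw [sobolevNorm, Real.sq_sqrt]
  · exact integral_mono hi hf hle
  · exact integral_nonneg fun ξ => (sq_nonneg _).trans (hle ξ)

/-- A function in `H²` has two weak derivatives, bounded by its Sobolev norm. -/
lemma MemH.weakDerivs {f : L2} (hf : MemH 2 f) :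
    HasWeakDeriv f (wderiv f) ∧ HasWeakDeriv (wderiv f) (wderiv (wderiv f)) ∧
      ‖f‖ ≤ sobolevNorm 2 f ∧ ‖wderiv f‖ ≤ sobolevNorm 2 f ∧
      ‖wderiv (wderiv f)‖ ≤ sobolevNorm 2 f := by
  have hn : ∀ ξ : ℝ, ‖(2 * Real.pi * Complex.I * ξ : ℂ)‖ ^ 2 = (2 * Real.pi * ξ) ^ 2 := by
    intro ξ; simp [mul_pow, abs_of_pos Real.pi_pos]
  have h1 := l2_of_sobolev hf (w := fun ξ : ℝ => 2 * Real.pi * Complex.I * ξ) (by fun_prop)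
    (fun ξ => by rw [hn]; nlinarith [sq_nonneg (2 * Real.pi * ξ)])
  have h0 := l2_of_sobolev hf (w := fun _ => 1) (by fun_prop)
    (fun ξ => by simp only [norm_one]; nlinarith [sq_nonneg (2 * Real.pi * ξ)])
  have h2 := l2_of_sobolev hf
    (w := fun ξ : ℝ => (2 * Real.pi * Complex.I * ξ) * (2 * Real.pi * Complex.I * ξ)) (by fun_prop)
    (fun ξ => by rw [norm_mul, mul_pow, hn]; nlinarith [sq_nonneg (2 * Real.pi * ξ)])
  obtain ⟨g, hg, hgF⟩ := exists_hasWeakDeriv h1.1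
  have hk : L2fun (fun ξ : ℝ => (2 * Real.pi * Complex.I * ξ) * (𝓕 g : L2) ξ) := by
    refine h2.1.ae_eq ?_
    filter_upwards [hgF] with ξ hξ
    rw [hξ]; ring
  obtain ⟨k, hk, hkF⟩ := exists_hasWeakDeriv hk
  have hs : 0 ≤ sobolevNorm 2 f := Real.sqrt_nonneg _
  rw [wderiv_eq hg, wderiv_eq hk]
  refine ⟨hg, hk, ?_, ?_, ?_⟩
  · refine le_of_sq_le_sq ?_ hs
    rw [← Lp.norm_fourier_eq, norm_sq_eq_integral]
    simpa using h0.2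
  · refine le_of_sq_le_sq ?_ hs
    rw [← Lp.norm_fourier_eq, norm_sq_eq_integral]
    refine (integral_congr_ae ?_).trans_le h1.2
    filter_upwards [hgF] with ξ hξ
    rw [hξ]
  · refine le_of_sq_le_sq ?_ hs
    rw [← Lp.norm_fourier_eq, norm_sq_eq_integral]
    refine (integral_congr_ae ?_).trans_le h2.2
    filter_upwards [hgF, hkF] with ξ hξ hξ2
    rw [hξ2, hξ]; congr 2; ring

lemma MemH.sub {f g : L2} (hf : MemH 2 f) (hg : MemH 2 g) : MemH 2 (f - g) := by
  unfold MemH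
  have hF : (𝓕 (f - g) : L2) = (𝓕 f : L2) - (𝓕 g : L2) :=
    (Lp.fourierTransformₗᵢ ℝ ℂ).map_sub f g
  refine Integrable.mono' ((Integrable.add hf hg).const_mul 2) ?_ ?_
  · refine Measurable.aestronglyMeasurable (by fun_prop) |>.mul ?_
    exact (Lp.aestronglyMeasurable _).norm.pow 2
  · have := Lp.coeFn_sub (𝓕 f : L2) (𝓕 g : L2)
    filter_upwards [this] with ξ hξ
    have h1 : 0 ≤ (1 + (2 * Real.pi * ξ) ^ 2) ^ (2 : ℝ) := by positivity
    rw [Real.norm_of_nonneg (by unfold sobolevDensity; positivity)]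
    simp only [sobolevDensity, Pi.add_apply, hF, hξ, Pi.sub_apply]
    have h2 := norm_sub_le ((𝓕 f : L2) ξ) ((𝓕 g : L2) ξ)
    have h3 : ‖(𝓕 f : L2) ξ - (𝓕 g : L2) ξ‖ ^ 2 ≤
        2 * (‖(𝓕 f : L2) ξ‖ ^ 2 + ‖(𝓕 g : L2) ξ‖ ^ 2) := by
      nlinarith [sq_nonneg (‖(𝓕 f : L2) ξ‖ - ‖(𝓕 g : L2) ξ‖),
        norm_nonneg ((𝓕 f : L2) ξ - (𝓕 g : L2) ξ)]
    nlinarith [mul_le_mul_of_nonneg_left h3 h1]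

end

section

/-! ### Difference quotients -/

variable {f f' g g' : ℝ → ℂ}

/-- The difference quotient `(f(x + h) - f(x)) / h`. -/
noncomputable def dq (h : ℝ) (f : ℝ → ℂ) (x : ℝ) : ℂ := (h : ℂ)⁻¹ * (f (x + h) - f x)

/-- The `L²` norm of an average is at most the largest `L²` norm of the averaged functions. -/
lemma nrm_average_le {k : ℝ → ℝ → ℂ} (hk : StronglyMeasurable (Function.uncurry k)) {C : ℝ}
    (hC : 0 ≤ C) (hm : ∀ s, L2fun (k s)) (hb : ∀ s ∈ Ioc (0 : ℝ) 1, nrm (k s) ≤ C) :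
    nrm (fun x => ∫ s in (0 : ℝ)..1, k s x) ≤ C := by
  unfold nrm
  refine ENNReal.toReal_le_of_le_ofReal hC ?_
  rw [eLpNorm_eq_lintegral_rpow_enorm_toReal (by norm_num) (by norm_num)]
  simp only [ENNReal.toReal_ofNat, ENNReal.rpow_ofNat]
  rw [one_div, ENNReal.rpow_inv_le_iff (by norm_num), ENNReal.rpow_ofNat]
  set μ : Measure ℝ := volume.restrict (Ioc (0 : ℝ) 1) with hμ
  have : IsProbabilityMeasure μ := ⟨by simp [hμ]⟩
  have hk' : Measurable (Function.uncurry k) := hk.measurable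
  calc ∫⁻ x, ‖∫ s in (0 : ℝ)..1, k s x‖ₑ ^ 2
      ≤ ∫⁻ x, ∫⁻ s, ‖k s x‖ₑ ^ 2 ∂μ := by
        refine lintegral_mono fun x => ?_
        rw [intervalIntegral.integral_of_le zero_le_one]
        have hmx : AEStronglyMeasurable (fun s => k s x) μ :=
          (hk'.comp (measurable_id.prodMk measurable_const)).aestronglyMeasurable
        have h1 := eLpNorm_le_eLpNorm_of_exponent_le (μ := μ) (p := 1) (q := 2) (by norm_num) hmx
        rw [eLpNorm_one_eq_lintegral_enorm,
          eLpNorm_eq_lintegral_rpow_enorm_toReal (by norm_num) (by norm_num)] at h1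
        simp only [ENNReal.toReal_ofNat, ENNReal.rpow_ofNat] at h1
        rw [one_div, ENNReal.le_rpow_inv_iff (by norm_num), ENNReal.rpow_ofNat] at h1
        refine le_trans ?_ h1
        gcongr
        exact enorm_integral_le_lintegral_enorm _
    _ = ∫⁻ s, (∫⁻ x, ‖k s x‖ₑ ^ 2) ∂μ := by
        refine lintegral_lintegral_swap ?_
        exact ((hk'.comp measurable_swap).enorm.pow_const 2).aemeasurable (μ := volume.prod μ)
    _ ≤ ∫⁻ s, ENNReal.ofReal C ^ 2 ∂μ := by
        refine setLIntegral_mono measurable_const fun s hs => ?_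
        have h1 := hb s hs
        unfold nrm at h1
        rw [← ENNReal.le_ofReal_iff_toReal_le (hm s).eLpNorm_ne_top hC,
          eLpNorm_eq_lintegral_rpow_enorm_toReal (by norm_num) (by norm_num)] at h1
        simp only [ENNReal.toReal_ofNat, ENNReal.rpow_ofNat] at h1
        rwa [one_div, ENNReal.rpow_inv_le_iff (by norm_num), ENNReal.rpow_ofNat] at h1
    _ = ENNReal.ofReal C ^ 2 := by simp

lemma IsH1.dq_eq (hf : IsH1 f f') {h : ℝ} (hh : h ≠ 0) {m : ℝ → ℂ} (hm : f' =ᵐ[volume] m) (x : ℝ) :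
    dq h f x = ∫ s in (0 : ℝ)..1, m (x + s * h) := by
  have h1 := hf.ac.ftc x (x + h)
  rw [intervalIntegral.integral_congr_ae (g := m)
    (by filter_upwards [hm] with y hy _ using hy)] at h1
  rw [dq, ← h1]
  have := intervalIntegral.integral_comp_add_mul (a := 0) (b := 1) m hh x
  simp only [mul_zero, add_zero, mul_one] at this
  simp_rw [mul_comm _ h]
  rw [this, Complex.real_smul]; push_cast; rfl

lemma nrm_dq_le (hf : IsH1 f f') {h : ℝ} (hh : h ≠ 0) : nrm (dq h f) ≤ nrm f' := by
  obtain ⟨m, hm, hfm⟩ := hf.mem'.aestronglyMeasurable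
  have hmL : L2fun m := hf.mem'.ae_eq hfm
  have : dq h f = fun x => ∫ s in (0 : ℝ)..1, m (x + s * h) :=
    funext fun x => hf.dq_eq hh hfm x
  rw [this]
  refine nrm_average_le (k := fun s x => m (x + s * h)) ?_ nrm_nonneg
    (fun s => hmL.comp_add _) (fun s _ => ?_)
  · exact hm.comp_measurable (by fun_prop)
  · rw [nrm_comp_add hmL, nrm_congr_ae hfm]

lemma L2fun.sub' (hf : L2fun f) (hg : L2fun g) : L2fun (fun x => f x - g x) := MemLp.sub hf hg

lemma L2fun.add' (hf : L2fun f) (hg : L2fun g) : L2fun (fun x => f x + g x) := MemLp.add hf hg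

lemma nrm_sub_le_add {k : ℝ → ℂ} (hf : L2fun f) (hg : L2fun g) (hk : L2fun k) :
    nrm (fun x => f x - k x) ≤ nrm (fun x => f x - g x) + nrm (fun x => g x - k x) := by
  have := nrm_add_le (hf.sub' hg) (hg.sub' hk)
  simpa using this

lemma exists_test_nrm_le (hf : L2fun f) {ε : ℝ} (hε : 0 < ε) :
    ∃ φ, IsTest φ ∧ nrm (fun x => f x - φ x) ≤ ε := by
  obtain ⟨φ, h1, h2, h3⟩ := MemLp.exist_eLpNorm_sub_le (μ := (volume : Measure ℝ))
    (by norm_num) (by norm_num) hf hε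
  exact ⟨φ, ⟨h2, h1⟩, ENNReal.toReal_le_of_le_ofReal hε.le h3⟩

/-- Translations are continuous in `L²`. -/
lemma tendsto_translate (hf : L2fun f) :
    Tendsto (fun r : ℝ => nrm (fun x => f (x + r) - f x)) (𝓝 0) (𝓝 0) := by
  rw [Metric.tendsto_nhds_nhds]
  intro ε hε
  obtain ⟨φ, hφ, hfφ⟩ := exists_test_nrm_le hf (ε := ε / 4) (by positivity)
  have hN : 0 ≤ nrm (deriv φ) := nrm_nonneg
  refine ⟨ε / 4 / (nrm (deriv φ) + 1), by positivity, fun {r} hr => ?_⟩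
  rw [dist_zero_right, Real.norm_of_nonneg nrm_nonneg]
  rw [dist_zero_right, Real.norm_eq_abs, lt_div_iff₀ (by positivity)] at hr
  have h1 : nrm (fun x => φ (x + r) - φ x) ≤ ε / 4 := by
    rcases eq_or_ne r 0 with rfl | h0
    · simp; positivity
    · have h2 := nrm_dq_le hφ.isH1 h0
      have h3 : (fun x => φ (x + r) - φ x) = fun x => (r : ℂ) * dq r φ x := by
        funext x; rw [dq, mul_inv_cancel_left₀ (by exact_mod_cast h0)]
      rw [h3, nrm_const_mul, Complex.norm_real, Real.norm_eq_abs]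
      nlinarith [abs_nonneg r]
  have e1 := nrm_sub_le_add (hf.comp_add r) (hφ.mem.comp_add r) hf
  have e2 := nrm_sub_le_add (hφ.mem.comp_add r) hφ.mem hf
  have e3 := nrm_comp_add (hf.sub' hφ.mem) r
  have e4 : nrm (fun x => φ x - f x) = nrm (fun x => f x - φ x) := nrm_sub_comm
  linarith

/-- Difference quotients converge to the derivative in `L²`. -/
lemma tendsto_dq (hf : IsH1 f f') :
    Tendsto (fun h : ℝ => nrm (fun x => dq h f x - f' x)) (𝓝[≠] 0) (𝓝 0) := by
  obtain ⟨m, hm, hfm⟩ := hf.mem'.aestronglyMeasurable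
  have hmL : L2fun m := hf.mem'.ae_eq hfm
  rw [Metric.tendsto_nhdsWithin_nhds]
  intro ε hε
  obtain ⟨δ, hδ, h⟩ := Metric.tendsto_nhds_nhds.1 (tendsto_translate hmL) (ε / 2) (by positivity)
  refine ⟨δ, hδ, fun {r} hr0 hr => ?_⟩
  rw [dist_zero_right, Real.norm_of_nonneg nrm_nonneg]
  have hr0 : r ≠ 0 := hr0
  have e : (fun x => dq r f x - m x) = fun x => ∫ s in (0 : ℝ)..1, (m (x + s * r) - m x) := by
    funext x
    rw [intervalIntegral.integral_sub, ← hf.dq_eq hr0 hfm x]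
    · simp
    · have := hmL.locallyIntegrable.integrableOn_isCompact (isCompact_uIcc (a := x) (b := x + r))
        |>.intervalIntegrable
      have h2 := this.comp_add_left x |>.comp_mul_right (c := r)
      simpa [hr0] using h2
    · exact intervalIntegrable_const
  have e2 : nrm (fun x => dq r f x - f' x) = nrm (fun x => dq r f x - m x) := by
    refine nrm_congr_ae ?_
    filter_upwards [hfm] with x hx; rw [hx]
  rw [e2, e]
  refine lt_of_le_of_lt (nrm_average_le (k := fun s x => m (x + s * r) - m x) ?_
    (C := ε / 2) (by positivity) (fun s => (hmL.comp_add _).sub' hmL) (fun s hs => ?_)) (by linarith)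
  · exact (hm.comp_measurable (by fun_prop)).sub (hm.comp_measurable (by fun_prop))
  · have := h (x := s * r) (by
      rw [dist_zero_right] at hr ⊢
      rw [norm_mul, Real.norm_of_nonneg hs.1.le]
      exact (mul_le_of_le_one_left (norm_nonneg _) hs.2).trans_lt hr)
    rw [dist_zero_right, Real.norm_of_nonneg nrm_nonneg] at this
    exact this.le

lemma IsH1.dq (hf : IsH1 f f') (h : ℝ) : IsH1 (dq h f) (dq h f') :=
  ((hf.comp_add h).sub hf).const_mul _

lemma L2fun.dq (hf : L2fun f) (h : ℝ) : L2fun (dq h f) := ((hf.comp_add h).sub' hf).cmul _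

lemma dq_star (h : ℝ) (f : ℝ → ℂ) (x : ℝ) : dq h (fun x => conj (f x)) x = conj (dq h f x) := by
  simp [dq]

lemma dq_sub (h : ℝ) (f g : ℝ → ℂ) (x : ℝ) :
    dq h (fun x => f x - g x) x = dq h f x - dq h g x := by
  simp only [dq]; ring

/-! ### Convergence of families of functions in `L²`, uniformly, and in `H¹` -/

variable {ι : Type*} {l : Filter ι} {F F' G G' : ι → ℝ → ℂ}

/-- Convergence in `L²(ℝ)` of a family of functions along a filter. -/
structure L2T (l : Filter ι) (F : ι → ℝ → ℂ) (f : ℝ → ℂ) : Prop where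
  mem : ∀ᶠ i in l, L2fun (F i)
  lim : L2fun f
  tendsto : Tendsto (fun i => nrm (fun x => F i x - f x)) l (𝓝 0)

/-- Uniform convergence of a family of continuous functions to a bounded continuous function. -/
structure UT (l : Filter ι) (F : ι → ℝ → ℂ) (f : ℝ → ℂ) : Prop where
  cont : ∀ᶠ i in l, Continuous (F i)
  cont_lim : Continuous f
  bdd : ∃ C, ∀ x, ‖f x‖ ≤ C
  tendsto : TendstoUniformly F f l

/-- Convergence in `H¹(ℝ)` of a family of functions, with their derivatives, along a filter. -/
structure H1T (l : Filter ι) (F F' : ι → ℝ → ℂ) (f f' : ℝ → ℂ) : Prop where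
  isH1 : ∀ᶠ i in l, IsH1 (F i) (F' i)
  lim : IsH1 f f'
  fst : L2T l F f
  snd : L2T l F' f'

namespace L2T

lemma of_le (hm : ∀ᶠ i in l, L2fun (F i)) (hf : L2fun f) {b : ι → ℝ}
    (hb : Tendsto b l (𝓝 0)) (h : ∀ᶠ i in l, nrm (fun x => F i x - f x) ≤ b i) : L2T l F f :=
  ⟨hm, hf, squeeze_zero' (Eventually.of_forall fun _ => nrm_nonneg) h hb⟩

lemma const (hf : L2fun f) : L2T l (fun _ => f) f :=
  ⟨by simp [hf], hf, by simpa using tendsto_const_nhds⟩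

lemma add (hF : L2T l F f) (hG : L2T l G g) :
    L2T l (fun i x => F i x + G i x) (fun x => f x + g x) := by
  refine of_le ?_ (hF.lim.add' hG.lim) (b := fun i => nrm (fun x => F i x - f x) +
    nrm (fun x => G i x - g x)) (by simpa using hF.tendsto.add hG.tendsto) ?_
  · filter_upwards [hF.mem, hG.mem] with i h1 h2 using h1.add' h2
  · filter_upwards [hF.mem, hG.mem] with i h1 h2
    have := nrm_add_le (h1.sub' hF.lim) (h2.sub' hG.lim)
    simpa [add_sub_add_comm] using this

lemma const_mul (c : ℂ) (hF : L2T l F f) : L2T l (fun i x => c * F i x) (fun x => c * f x) := by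
  refine of_le ?_ (hF.lim.cmul c) (b := fun i => ‖c‖ * nrm (fun x => F i x - f x))
    (by simpa using hF.tendsto.const_mul ‖c‖) ?_
  · filter_upwards [hF.mem] with i h1 using h1.cmul c
  · filter_upwards [hF.mem] with i h1
    rw [← nrm_const_mul]; simp [mul_sub]

lemma sub (hF : L2T l F f) (hG : L2T l G g) :
    L2T l (fun i x => F i x - G i x) (fun x => f x - g x) := by
  simpa [sub_eq_add_neg] using hF.add (hG.const_mul (-1))

lemma star (hF : L2T l F f) : L2T l (fun i x => conj (F i x)) (fun x => conj (f x)) := by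
  refine of_le ?_ hF.lim.star hF.tendsto ?_
  · filter_upwards [hF.mem] with i h1 using h1.star
  · filter_upwards with i
    rw [← nrm_conj]; simp

lemma tendsto_nrm (hF : L2T l F f) : Tendsto (fun i => nrm (F i)) l (𝓝 (nrm f)) := by
  rw [tendsto_iff_norm_sub_tendsto_zero]
  refine squeeze_zero' (Eventually.of_forall fun _ => norm_nonneg _) ?_ hF.tendsto
  filter_upwards [hF.mem] with i h1
  rw [Real.norm_eq_abs, abs_le]
  have e1 := nrm_add_le (h1.sub' hF.lim) hF.lim
  have e2 := nrm_add_le (f := fun x => f x - F i x) (hF.lim.sub' h1) h1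
  rw [nrm_sub_comm] at e2
  simp only [sub_add_cancel] at e1 e2
  constructor <;> linarith

lemma integral_mul (hF : L2T l F f) (hG : L2T l G g) :
    Tendsto (fun i => ∫ x, F i x * G i x) l (𝓝 (∫ x, f x * g x)) := by
  rw [tendsto_iff_norm_sub_tendsto_zero]
  refine squeeze_zero' (Eventually.of_forall fun _ => norm_nonneg _) (g := fun i =>
    nrm (fun x => F i x - f x) * nrm (G i) + nrm f * nrm (fun x => G i x - g x)) ?_ ?_
  · filter_upwards [hF.mem, hG.mem] with i h1 h2
    have e : (∫ x, F i x * G i x) - ∫ x, f x * g x =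
        (∫ x, (F i x - f x) * G i x) + ∫ x, f x * (G i x - g x) := by
      rw [← integral_sub (h1.integrable_mul h2) (hF.lim.integrable_mul hG.lim),
        ← integral_add ((h1.sub' hF.lim).integrable_mul h2)
          (hF.lim.integrable_mul (h2.sub' hG.lim))]
      congr 1; funext x; ring
    rw [e]
    exact (norm_add_le _ _).trans (add_le_add (norm_integral_mul_le (h1.sub' hF.lim) h2)
      (norm_integral_mul_le hF.lim (h2.sub' hG.lim)))
  · simpa using (hF.tendsto.mul hG.tendsto_nrm).add (hG.tendsto.const_mul (nrm f))

lemma translate {k : ι → ℝ} (hF : L2T l F f) (hk : Tendsto k l (𝓝 0)) :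
    L2T l (fun i x => F i (x + k i)) f := by
  refine of_le ?_ hF.lim (b := fun i => nrm (fun x => F i x - f x) +
    nrm (fun x => f (x + k i) - f x))
    (by simpa using hF.tendsto.add ((tendsto_translate hF.lim).comp hk)) ?_
  · filter_upwards [hF.mem] with i h1 using h1.comp_add _
  · filter_upwards [hF.mem] with i h1
    have e1 := nrm_sub_le_add (h1.comp_add (k i)) (hF.lim.comp_add (k i)) hF.lim
    have e3 := nrm_comp_add (h1.sub' hF.lim) (k i)
    linarith

end L2T

namespace UT

lemma mul_L2 (hF : UT l F f) (hG : L2T l G g) :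
    L2T l (fun i x => F i x * G i x) (fun x => f x * g x) := by
  obtain ⟨C, hC⟩ := hF.bdd
  have hC0 : 0 ≤ C := (norm_nonneg _).trans (hC 0)
  have hgm : L2fun (fun x => f x * g x) :=
    hG.lim.mul_bdd hF.cont_lim.aestronglyMeasurable hC
  have hev : ∀ ε > 0, ∀ᶠ i in l, ∀ x, ‖F i x - f x‖ ≤ ε := by
    intro ε hε
    filter_upwards [Metric.tendstoUniformly_iff.1 hF.tendsto ε hε] with i hi x
    rw [← dist_eq_norm, dist_comm]; exact (hi x).le
  refine ⟨?_, hgm, ?_⟩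
  · filter_upwards [hev 1 one_pos, hF.cont, hG.mem] with i h1 h2 h3
    refine h3.mul_bdd (C := C + 1) h2.aestronglyMeasurable fun x => ?_
    have := norm_sub_norm_le (F i x) (f x)
    linarith [h1 x, hC x]
  · rw [Metric.tendsto_nhds]
    intro ε hε
    have hn : 0 ≤ nrm g := nrm_nonneg
    have hpos : 0 < ε / (2 * (nrm g + 1)) := by positivity
    have h4 := Metric.tendsto_nhds.1 hG.tendsto (ε / (2 * (C + ε / (2 * (nrm g + 1)) + 1)))
      (by positivity)
    filter_upwards [hev _ hpos, hF.cont, hG.mem, h4] with i h1 h2 h3 h4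
    rw [Real.dist_eq, sub_zero, abs_of_nonneg nrm_nonneg] at h4 ⊢
    have hb : ∀ x, ‖F i x‖ ≤ C + ε / (2 * (nrm g + 1)) := fun x => by
      have := norm_sub_norm_le (F i x) (f x)
      linarith [h1 x, hC x]
    have e : (fun x => F i x * G i x - f x * g x) =
        fun x => F i x * (G i x - g x) + (F i x - f x) * g x := by funext x; ring
    rw [e]
    have h3' := h3.sub' hG.lim
    have m1 := h3'.mul_bdd h2.aestronglyMeasurable hb
    have m2 : L2fun (fun x => (F i x - f x) * g x) :=
      hG.lim.mul_bdd (h2.sub hF.cont_lim).aestronglyMeasurable h1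
    refine (nrm_add_le m1 m2).trans_lt ?_
    have b1 := nrm_mul_le (by positivity) h3' hb
    have b2 := nrm_mul_le hpos.le hG.lim h1
    rw [lt_div_iff₀ (by positivity)] at h4
    have b3 : ε / (2 * (nrm g + 1)) * nrm g ≤ ε / 2 := by
      rw [div_mul_eq_mul_div, div_le_div_iff₀ (by positivity) (by positivity)]
      nlinarith
    have b0 : 0 ≤ nrm (fun x => G i x - g x) := nrm_nonneg
    nlinarith

lemma star (hF : UT l F f) : UT l (fun i x => conj (F i x)) (fun x => conj (f x)) := by
  obtain ⟨C, hC⟩ := hF.bdd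
  refine ⟨?_, Complex.continuous_conj.comp hF.cont_lim, ⟨C, by simpa using hC⟩, ?_⟩
  · filter_upwards [hF.cont] with i h1 using Complex.continuous_conj.comp h1
  · rw [Metric.tendstoUniformly_iff]
    intro ε hε
    filter_upwards [Metric.tendstoUniformly_iff.1 hF.tendsto ε hε] with i h1 x
    rw [Complex.dist_conj_conj]; exact h1 x

end UT

lemma L2T.mul_U (hG : L2T l G g) (hF : UT l F f) :
    L2T l (fun i x => G i x * F i x) (fun x => g x * f x) := by
  simpa [mul_comm] using hF.mul_L2 hG

namespace H1T

lemma ut (h : H1T l F F' f f') : UT l F f := by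
  refine ⟨?_, h.lim.continuous, ⟨_, h.lim.norm_le⟩, ?_⟩
  · filter_upwards [h.isH1] with i hi using hi.continuous
  · rw [Metric.tendstoUniformly_iff]
    intro ε hε
    have := h.fst.tendsto.add h.snd.tendsto
    rw [add_zero] at this
    filter_upwards [h.isH1, Metric.tendsto_nhds.1 this ε hε] with i hi h2 x
    rw [Real.dist_eq, sub_zero] at h2
    rw [dist_comm, dist_eq_norm]
    exact ((hi.sub h.lim).norm_le x).trans_lt (lt_of_abs_lt h2)

lemma const (hf : IsH1 f f') : H1T l (fun _ => f) (fun _ => f') f f' :=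
  ⟨by simp [hf], hf, L2T.const hf.mem, L2T.const hf.mem'⟩

lemma mul (hF : H1T l F F' f f') (hG : H1T l G G' g g') :
    H1T l (fun i x => F i x * G i x) (fun i x => F' i x * G i x + F i x * G' i x)
      (fun x => f x * g x) (fun x => f' x * g x + f x * g' x) := by
  refine ⟨?_, hF.lim.mul hG.lim, hF.ut.mul_L2 hG.fst,
    (hF.snd.mul_U hG.ut).add (hF.ut.mul_L2 hG.snd)⟩
  filter_upwards [hF.isH1, hG.isH1] with i h1 h2 using h1.mul h2

lemma star (hF : H1T l F F' f f') : H1T l (fun i x => conj (F i x)) (fun i x => conj (F' i x))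
    (fun x => conj (f x)) (fun x => conj (f' x)) :=
  ⟨by filter_upwards [hF.isH1] with i h1 using h1.star, hF.lim.star, hF.fst.star, hF.snd.star⟩

lemma add (hF : H1T l F F' f f') (hG : H1T l G G' g g') :
    H1T l (fun i x => F i x + G i x) (fun i x => F' i x + G' i x)
      (fun x => f x + g x) (fun x => f' x + g' x) :=
  ⟨by filter_upwards [hF.isH1, hG.isH1] with i h1 h2 using h1.add h2, hF.lim.add hG.lim,
    hF.fst.add hG.fst, hF.snd.add hG.snd⟩

lemma const_mul (c : ℂ) (hF : H1T l F F' f f') :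
    H1T l (fun i x => c * F i x) (fun i x => c * F' i x) (fun x => c * f x) (fun x => c * f' x) :=
  ⟨by filter_upwards [hF.isH1] with i h1 using h1.const_mul c, hF.lim.const_mul c,
    hF.fst.const_mul c, hF.snd.const_mul c⟩

lemma translate {k : ι → ℝ} (hF : H1T l F F' f f') (hk : Tendsto k l (𝓝 0)) :
    H1T l (fun i x => F i (x + k i)) (fun i x => F' i (x + k i)) f f' :=
  ⟨by filter_upwards [hF.isH1] with i h1 using h1.comp_add _, hF.lim,
    hF.fst.translate hk, hF.snd.translate hk⟩

/-- Difference quotients, with steps tending to zero, of a family converging in `H¹` converge to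
the derivative of the limit. -/
lemma dq {k : ι → ℝ} (hF : H1T l F F' f f') (hk : Tendsto k l (𝓝[≠] 0)) :
    L2T l (fun i => dq (k i) (F i)) f' := by
  have hne : ∀ᶠ i in l, k i ≠ 0 := hk.eventually self_mem_nhdsWithin
  refine L2T.of_le ?_ hF.lim.mem' (b := fun i => nrm (fun x => F' i x - f' x) +
    nrm (fun x => AirySchrodinger.dq (k i) f x - f' x))
    (by simpa using hF.snd.tendsto.add ((tendsto_dq hF.lim).comp hk)) ?_
  · filter_upwards [hF.isH1] with i h1 using h1.mem.dq _
  · filter_upwards [hF.isH1, hne] with i h1 h2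
    have e1 := nrm_sub_le_add (h1.mem.dq (k i)) (hF.lim.mem.dq (k i)) hF.lim.mem'
    have e2 := nrm_dq_le (h1.sub hF.lim) h2
    have e3 : AirySchrodinger.dq (k i) (fun x => F i x - f x) = fun x =>
      AirySchrodinger.dq (k i) (F i) x - AirySchrodinger.dq (k i) f x := funext (dq_sub _ _ _)
    rw [e3] at e2
    linarith

end H1T

end

section

/-! ### Weak differentiability in time -/

variable {f f' g g' p q : ℝ → ℂ} {ι : Type*} {l : Filter ι}

/-- The pairing of the functional `p + ∂ₓ q` of `H⁻¹`, where `p` and `q` are square integrable,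
with a function `f ∈ H¹` of derivative `f'`. -/
noncomputable def pairing (p q f f' : ℝ → ℂ) : ℂ := (∫ x, p x * f x) - ∫ x, q x * f' x

lemma norm_pairing_le (hp : L2fun p) (hq : L2fun q) (hf : L2fun f) (hf' : L2fun f') :
    ‖pairing p q f f'‖ ≤ nrm p * nrm f + nrm q * nrm f' :=
  (norm_sub_le _ _).trans (add_le_add (norm_integral_mul_le hp hf) (norm_integral_mul_le hq hf'))

lemma norm_pairing_le' (hp : L2fun p) (hq : L2fun q) (hf : L2fun f) (hf' : L2fun f') :
    ‖pairing p q f f'‖ ≤ (nrm p + nrm q) * (nrm f + nrm f') := by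
  refine (norm_pairing_le hp hq hf hf').trans ?_
  nlinarith [nrm_nonneg (f := p), nrm_nonneg (f := q), nrm_nonneg (f := f), nrm_nonneg (f := f')]

lemma pairing_sub (hp : L2fun p) (hq : L2fun q) (hf : L2fun f) (hf' : L2fun f')
    (hg : L2fun g) (hg' : L2fun g') :
    pairing p q (fun x => f x - g x) (fun x => f' x - g' x) =
      pairing p q f f' - pairing p q g g' := by
  unfold pairing
  simp only [mul_sub]
  rw [integral_sub (hp.integrable_mul hf) (hp.integrable_mul hg),
    integral_sub (hq.integrable_mul hf') (hq.integrable_mul hg')]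
  ring

lemma pairing_sub_left {P Q : ℝ → ℂ} (hp : L2fun p) (hq : L2fun q) (hP : L2fun P) (hQ : L2fun Q)
    (hf : L2fun f) (hf' : L2fun f') :
    pairing (fun x => P x - p x) (fun x => Q x - q x) f f' =
      pairing P Q f f' - pairing p q f f' := by
  unfold pairing
  simp only [sub_mul]
  rw [integral_sub (hP.integrable_mul hf) (hp.integrable_mul hf),
    integral_sub (hQ.integrable_mul hf') (hq.integrable_mul hf')]
  ring

lemma tendsto_pairing {P Q F F' : ι → ℝ → ℂ} (hp : L2T l P p) (hq : L2T l Q q)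
    (hf : L2T l F f) (hf' : L2T l F' f') :
    Tendsto (fun i => pairing (P i) (Q i) (F i) (F' i)) l (𝓝 (pairing p q f f')) :=
  (hp.integral_mul hf).sub (hq.integral_mul hf')

/-- Convergence in `H²(ℝ)` of a family of functions, with their derivatives, along a filter. -/
structure H2T (l : Filter ι) (F F₁ F₂ : ι → ℝ → ℂ) (f f₁ f₂ : ℝ → ℂ) : Prop where
  fst : H1T l F F₁ f f₁
  snd : H1T l F₁ F₂ f₁ f₂

lemma H2T.mul {F F₁ F₂ G G₁ G₂ : ι → ℝ → ℂ} {f₁ f₂ g₁ g₂ : ℝ → ℂ}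
    (hF : H2T l F F₁ F₂ f f₁ f₂) (hG : H2T l G G₁ G₂ g g₁ g₂) :
    H2T l (fun i x => F i x * G i x) (fun i x => F₁ i x * G i x + F i x * G₁ i x)
      (fun i x => (F₂ i x * G i x + F₁ i x * G₁ i x) + (F₁ i x * G₁ i x + F i x * G₂ i x))
      (fun x => f x * g x) (fun x => f₁ x * g x + f x * g₁ x)
      (fun x => (f₂ x * g x + f₁ x * g₁ x) + (f₁ x * g₁ x + f x * g₂ x)) :=
  ⟨hF.fst.mul hG.fst, (hF.snd.mul hG.fst).add (hF.fst.mul hG.snd)⟩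

lemma H2T.star {F F₁ F₂ : ι → ℝ → ℂ} {f₁ f₂ : ℝ → ℂ} (hF : H2T l F F₁ F₂ f f₁ f₂) :
    H2T l (fun i x => conj (F i x)) (fun i x => conj (F₁ i x)) (fun i x => conj (F₂ i x))
      (fun x => conj (f x)) (fun x => conj (f₁ x)) (fun x => conj (f₂ x)) :=
  ⟨hF.fst.star, hF.snd.star⟩

lemma L2T.dq_const {F : ι → ℝ → ℂ} (hF : L2T l F f) (h : ℝ) :
    L2T l (fun i => dq h (F i)) (dq h f) := by
  have h1 : L2T l (fun i x => F i (x + h)) (fun x => f (x + h)) := by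
    refine ⟨hF.mem.mono fun i hi => hi.comp_add h, hF.lim.comp_add h, ?_⟩
    refine Tendsto.congr' ?_ hF.tendsto
    filter_upwards [hF.mem] with i hi
    exact (nrm_comp_add (hi.sub' hF.lim) h).symm
  exact (h1.sub hF).const_mul (h : ℂ)⁻¹

lemma H1T.dq_const {F F' : ι → ℝ → ℂ} (hF : H1T l F F' f f') (h : ℝ) :
    H1T l (fun i => AirySchrodinger.dq h (F i)) (fun i => AirySchrodinger.dq h (F' i))
      (AirySchrodinger.dq h f) (AirySchrodinger.dq h f') :=
  ⟨hF.isH1.mono fun _ hi => hi.dq h, hF.lim.dq h, hF.fst.dq_const h, hF.snd.dq_const h⟩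

lemma H2T.dq_const {F F₁ F₂ : ι → ℝ → ℂ} {f₁ f₂ : ℝ → ℂ} (hF : H2T l F F₁ F₂ f f₁ f₂) (h : ℝ) :
    H2T l (fun i => dq h (F i)) (fun i => dq h (F₁ i)) (fun i => dq h (F₂ i))
      (dq h f) (dq h f₁) (dq h f₂) :=
  ⟨hF.fst.dq_const h, hF.snd.dq_const h⟩

variable {F F₁ F₂ G G₁ G₂ : ℝ → ℝ → ℂ} {pF qF pG qG : ℝ → ℂ} {s : ℝ}

/-- The curve `t ↦ F t` is differentiable at time `s` in the sense of `H⁻¹(ℝ)`, and its derivative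
is `p + ∂ₓ q`. -/
structure WD (F : ℝ → ℝ → ℂ) (p q : ℝ → ℂ) (s : ℝ) : Prop where
  memp : L2fun p
  memq : L2fun q
  deriv : ∀ ε > 0, ∀ᶠ t in 𝓝 s, ∀ ψ ψ' : ℝ → ℂ, IsH1 ψ ψ' →
    ‖(∫ x, (F t x - F s x) * ψ x) - ((t - s : ℝ) : ℂ) * pairing p q ψ ψ'‖
      ≤ ε * |t - s| * (nrm ψ + nrm ψ')

/-- The derivative of a function of time whose increments are given by the increments of two
weakly differentiable curves. One of the increments is tested against a function which depends on
the later time, as it happens in the splitting `f g - f₀ g₀ = (f - f₀) g + (g - g₀) f₀` of the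
increment of a product; for this it is enough that the function be continuous in `H¹`. -/
lemma WD.hasDerivAt_of_eq {X X₁ : ℝ → ℝ → ℂ} {Y Y₁ : ℝ → ℂ} {y : ℝ → ℂ}
    (hF : WD F pF qF s) (hG : WD G pG qG s) (cX : H1T (𝓝 s) X X₁ (X s) (X₁ s)) (hY : IsH1 Y Y₁)
    (hy : ∀ᶠ t in 𝓝 s, y t - y s =
      (∫ x, (F t x - F s x) * X t x) + ∫ x, (G t x - G s x) * Y x) :
    HasDerivAt y (pairing pF qF (X s) (X₁ s) + pairing pG qG Y Y₁) s := by
  rw [hasDerivAt_iff_isLittleO, Asymptotics.isLittleO_iff]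
  intro ε hε
  have hT : Tendsto (fun t => pairing pF qF (X t) (X₁ t)) (𝓝 s) (𝓝 (pairing pF qF (X s) (X₁ s))) :=
    tendsto_pairing (L2T.const hF.memp) (L2T.const hF.memq) cX.fst cX.snd
  have hn := cX.fst.tendsto_nrm.add cX.snd.tendsto_nrm
  set N := nrm (X s) + nrm (X₁ s) with hN
  have hN0 : 0 ≤ N := add_nonneg nrm_nonneg nrm_nonneg
  set M := nrm Y + nrm Y₁ with hM
  have hM0 : 0 ≤ M := add_nonneg nrm_nonneg nrm_nonneg
  filter_upwards [hF.deriv (ε / (3 * (N + 1))) (by positivity),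
    hG.deriv (ε / (3 * (M + 1))) (by positivity),
    Metric.tendsto_nhds.1 hT (ε / 3) (by positivity),
    hn.eventually (gt_mem_nhds (lt_add_one N)), cX.isH1, hy] with t h1 h2 h3 h4 h6 h7
  have k1 := h1 _ _ h6
  have k2 := h2 _ _ hY
  rw [dist_eq_norm] at h3
  have e : y t - y s - (t - s) • (pairing pF qF (X s) (X₁ s) + pairing pG qG Y Y₁) =
      ((∫ x, (F t x - F s x) * X t x) - ((t - s : ℝ) : ℂ) * pairing pF qF (X t) (X₁ t)) +
      ((∫ x, (G t x - G s x) * Y x) - ((t - s : ℝ) : ℂ) * pairing pG qG Y Y₁) +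
      ((t - s : ℝ) : ℂ) * (pairing pF qF (X t) (X₁ t) - pairing pF qF (X s) (X₁ s)) := by
    rw [h7, Complex.real_smul]; ring
  rw [e]
  refine (norm_add₃_le ..).trans ?_
  have k3 : ‖((t - s : ℝ) : ℂ) * (pairing pF qF (X t) (X₁ t) - pairing pF qF (X s) (X₁ s))‖ ≤
      |t - s| * (ε / 3) := by
    rw [norm_mul, Complex.norm_real, Real.norm_eq_abs]
    exact mul_le_mul_of_nonneg_left h3.le (abs_nonneg _)
  have k4 : ε / (3 * (N + 1)) * |t - s| * (nrm (X t) + nrm (X₁ t)) ≤ |t - s| * (ε / 3) := by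
    have : ε / (3 * (N + 1)) * (N + 1) = ε / 3 := by field_simp
    have h7 : ε / (3 * (N + 1)) * (nrm (X t) + nrm (X₁ t)) ≤ ε / 3 := by
      rw [← this]; gcongr
    nlinarith [abs_nonneg (t - s)]
  have k5 : ε / (3 * (M + 1)) * |t - s| * (nrm Y + nrm Y₁) ≤ |t - s| * (ε / 3) := by
    have : ε / (3 * (M + 1)) * (M + 1) = ε / 3 := by field_simp
    have h7 : ε / (3 * (M + 1)) * (nrm Y + nrm Y₁) ≤ ε / 3 := by
      rw [← this]
      exact mul_le_mul_of_nonneg_left (by linarith) (by positivity)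
    nlinarith [abs_nonneg (t - s)]
  rw [Real.norm_eq_abs]
  linarith

/-- The derivative of the bilinear pairing of two curves. -/
lemma WD.hasDerivAt_integral (hF : WD F pF qF s) (hG : WD G pG qG s)
    (cF : H1T (𝓝 s) F F₁ (F s) (F₁ s)) (cG : H1T (𝓝 s) G G₁ (G s) (G₁ s)) :
    HasDerivAt (fun t => ∫ x, F t x * G t x)
      (pairing pF qF (G s) (G₁ s) + pairing pG qG (F s) (F₁ s)) s := by
  refine hF.hasDerivAt_of_eq hG cG cF.lim ?_
  filter_upwards [cF.isH1, cG.isH1] with t h5 h6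
  rw [← integral_sub (h5.mem.integrable_mul h6.mem) (cF.lim.mem.integrable_mul cG.lim.mem),
    ← integral_add ((h5.mem.sub' cF.lim.mem).integrable_mul h6.mem)
      ((h6.mem.sub' cG.lim.mem).integrable_mul cF.lim.mem)]
  congr 1; funext x; ring

lemma nrm_mul_H1_le {C : ℝ} (hC : 0 ≤ C) {k k₁ ψ ψ' : ℝ → ℂ} (hk : Continuous k)
    (hk₁ : Continuous k₁) (hb : ∀ x, ‖k x‖ ≤ C) (hb₁ : ∀ x, ‖k₁ x‖ ≤ C) (hψ : L2fun ψ)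
    (hψ' : L2fun ψ') :
    nrm (fun x => k x * ψ x) + nrm (fun x => k₁ x * ψ x + k x * ψ' x) ≤
      2 * C * (nrm ψ + nrm ψ') := by
  have h1 := nrm_mul_le hC hψ hb
  have h2 := nrm_add_le (hψ.mul_bdd hk₁.aestronglyMeasurable hb₁)
    (hψ'.mul_bdd hk.aestronglyMeasurable hb)
  have h3 := nrm_mul_le hC hψ hb₁
  have h4 := nrm_mul_le hC hψ' hb
  nlinarith [nrm_nonneg (f := ψ'), nrm_nonneg (f := ψ)]

lemma pairing_mul {k k₁ k₂ ψ ψ' : ℝ → ℂ} (hp : L2fun p) (hq : L2fun q) (hk : IsH1 k k₁)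
    (hk₁ : IsH1 k₁ k₂) (hψ : IsH1 ψ ψ') :
    pairing (fun x => k x * p x - k₁ x * q x) (fun x => k x * q x) ψ ψ' =
      pairing p q (fun x => k x * ψ x) (fun x => k₁ x * ψ x + k x * ψ' x) := by
  unfold pairing
  have i1 := hp.integrable_mul (hk.mul hψ).mem
  have i2 : Integrable (fun x => q x * (k₁ x * ψ x)) volume :=
    hq.integrable_mul (hk₁.mul hψ).mem
  have i3 : Integrable (fun x => q x * (k x * ψ' x)) volume :=
    hq.integrable_mul (hk.mul_mem hψ.mem')
  have e1 : ∫ x, q x * (k₁ x * ψ x + k x * ψ' x) =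
      (∫ x, q x * (k₁ x * ψ x)) + ∫ x, q x * (k x * ψ' x) := by
    rw [← integral_add i2 i3]; congr 1; funext x; ring
  have e2 : ∫ x, (k x * p x - k₁ x * q x) * ψ x =
      (∫ x, p x * (k x * ψ x)) - ∫ x, q x * (k₁ x * ψ x) := by
    rw [← integral_sub i1 i2]; congr 1; funext x; ring
  have e3 : ∫ x, k x * q x * ψ' x = ∫ x, q x * (k x * ψ' x) := by
    congr 1; funext x; ring
  rw [e1, e2, e3]; ring

lemma pairing_add {P Q : ℝ → ℂ} (hp : L2fun p) (hq : L2fun q) (hP : L2fun P) (hQ : L2fun Q)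
    (hf : L2fun f) (hf' : L2fun f') :
    pairing (fun x => p x + P x) (fun x => q x + Q x) f f' =
      pairing p q f f' + pairing P Q f f' := by
  unfold pairing
  simp only [add_mul]
  rw [integral_add (hp.integrable_mul hf) (hP.integrable_mul hf),
    integral_add (hq.integrable_mul hf') (hQ.integrable_mul hf')]
  ring

/-- Product rule for the weak time derivative of curves in `H²`. The product of `F` with the
functional `pG + ∂ₓ qG` is `(F pG - F₁ qG) + ∂ₓ (F qG)`; the second derivatives of the curves are not
used, but `F₁` has to be bounded, uniformly in time. -/
lemma WD.mul (hF : WD F pF qF s) (hG : WD G pG qG s)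
    (cF : H2T (𝓝 s) F F₁ F₂ (F s) (F₁ s) (F₂ s)) (cG : H2T (𝓝 s) G G₁ G₂ (G s) (G₁ s) (G₂ s)) :
    WD (fun t x => F t x * G t x)
      (fun x => (F s x * pG x - F₁ s x * qG x) + (G s x * pF x - G₁ s x * qF x))
      (fun x => F s x * qG x + G s x * qF x) s := by
  have hFs := cF.fst.lim
  have hF₁s := cF.snd.lim
  have hGs := cG.fst.lim
  have hG₁s := cG.snd.lim
  have m1 := (hFs.mul_mem hG.memp).sub' (hF₁s.mul_mem hG.memq)
  have m2 := (hGs.mul_mem hF.memp).sub' (hG₁s.mul_mem hF.memq)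
  have m3 := hFs.mul_mem hG.memq
  have m4 := hGs.mul_mem hF.memq
  refine ⟨m1.add' m2, m3.add' m4, fun ε hε => ?_⟩
  obtain ⟨A, hA⟩ := cF.fst.ut.bdd
  obtain ⟨A₁, hA₁⟩ := cF.snd.ut.bdd
  obtain ⟨B, hB⟩ := cG.fst.ut.bdd
  obtain ⟨B₁, hB₁⟩ := cG.snd.ut.bdd
  -- `C` bounds `F t` and `F₁ t` for `t` near `s`, and `G s` and `G₁ s`
  set C := max (max A A₁) (max B B₁) + 1 with hC
  have hAC : A + 1 ≤ C := by simp [hC]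
  have hAC₁ : A₁ + 1 ≤ C := by simp [hC]
  have hBC : B ≤ C := by
    have : B ≤ max (max A A₁) (max B B₁) := by simp
    linarith
  have hBC₁ : B₁ ≤ C := by
    have : B₁ ≤ max (max A A₁) (max B B₁) := by simp
    linarith
  have hC0 : 0 < C := by linarith [(norm_nonneg _).trans (hA 0)]
  set N := nrm pG + nrm qG with hN
  have hN0 : 0 ≤ N := add_nonneg nrm_nonneg nrm_nonneg
  set η := ε / (6 * C) with hη
  have hη0 : 0 < η := by positivity
  set δ := min 1 (ε / (6 * (N + 1))) with hδ
  have hδ0 : 0 < δ := lt_min one_pos (by positivity)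
  filter_upwards [hF.deriv η hη0, hG.deriv η hη0,
    Metric.tendstoUniformly_iff.1 cF.fst.ut.tendsto δ hδ0,
    Metric.tendstoUniformly_iff.1 cF.snd.ut.tendsto δ hδ0, cF.fst.isH1, cF.snd.isH1,
    cG.fst.isH1] with t h1 h2 h3 h4 hFt hF₁t hGt ψ ψ' hψ
  have d0 : ∀ x, ‖F t x - F s x‖ ≤ δ := fun x => by
    rw [← dist_eq_norm, dist_comm]; exact (h3 x).le
  have d1 : ∀ x, ‖F₁ t x - F₁ s x‖ ≤ δ := fun x => by
    rw [← dist_eq_norm, dist_comm]; exact (h4 x).le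
  have b0 : ∀ x, ‖F t x‖ ≤ C := fun x => by
    have := norm_sub_norm_le (F t x) (F s x)
    linarith [d0 x, hA x, min_le_left 1 (ε / (6 * (N + 1)))]
  have b1 : ∀ x, ‖F₁ t x‖ ≤ C := fun x => by
    have := norm_sub_norm_le (F₁ t x) (F₁ s x)
    linarith [d1 x, hA₁ x, min_le_left 1 (ε / (6 * (N + 1)))]
  set n := nrm ψ + nrm ψ' with hn
  have hn0 : 0 ≤ n := add_nonneg nrm_nonneg nrm_nonneg
  have k1 := h1 _ _ (hGs.mul hψ)
  have k2 := h2 _ _ (hFt.mul hψ)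
  have n1 := nrm_mul_H1_le hC0.le hGs.continuous hG₁s.continuous
    (fun x => (hB x).trans hBC) (fun x => (hB₁ x).trans hBC₁) hψ.mem hψ.mem'
  have n2 := nrm_mul_H1_le hC0.le hFt.continuous hF₁t.continuous b0 b1 hψ.mem hψ.mem'
  have n3 := nrm_mul_H1_le (k := fun x => F t x - F s x) (k₁ := fun x => F₁ t x - F₁ s x) hδ0.le
    (hFt.sub hFs).continuous (hF₁t.sub hF₁s).continuous d0 d1 hψ.mem hψ.mem'
  rw [← hn] at n1 n2 n3
  rw [pairing_add m1 m3 m2 m4 hψ.mem hψ.mem', pairing_mul hG.memp hG.memq hFs hF₁s hψ,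
    pairing_mul hF.memp hF.memq hGs hG₁s hψ]
  have hd := (hFt.sub hFs).mul hψ
  have k3 := norm_pairing_le' hG.memp hG.memq hd.mem hd.mem'
  have e0 : pairing pG qG (fun x => (F t x - F s x) * ψ x)
      (fun x => (F₁ t x - F₁ s x) * ψ x + (F t x - F s x) * ψ' x) =
      pairing pG qG (fun x => F t x * ψ x) (fun x => F₁ t x * ψ x + F t x * ψ' x) -
      pairing pG qG (fun x => F s x * ψ x) (fun x => F₁ s x * ψ x + F s x * ψ' x) := by
    rw [← pairing_sub hG.memp hG.memq (hFt.mul hψ).mem (hFt.mul hψ).mem' (hFs.mul hψ).mem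
      (hFs.mul hψ).mem']
    congr 1
    · funext x; ring
    · funext x; ring
  rw [e0] at k3
  have e1 : ∫ x, (F t x * G t x - F s x * G s x) * ψ x =
      (∫ x, (F t x - F s x) * (G s x * ψ x)) + ∫ x, (G t x - G s x) * (F t x * ψ x) := by
    rw [← integral_add ((hFt.sub hFs).mem.integrable_mul (hGs.mul hψ).mem)
      ((hGt.sub hGs).mem.integrable_mul (hFt.mul hψ).mem)]
    congr 1; funext x; ring
  rw [e1]
  have e2 : ∀ a b x y z τ : ℂ, a + b - τ * (x + y) =
      (a - τ * y) + (b - τ * z) + τ * (z - x) := by intros; ring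
  rw [e2 _ _ _ _ (pairing pG qG (fun x => F t x * ψ x) (fun x => F₁ t x * ψ x + F t x * ψ' x))]
  refine (norm_add₃_le ..).trans ?_
  have ha := abs_nonneg (t - s)
  have q1 : η * |t - s| * (2 * C * n) = ε / 3 * |t - s| * n := by
    rw [hη]; field_simp; ring
  have q2 := k1.trans (mul_le_mul_of_nonneg_left n1 (by positivity))
  have q3 := k2.trans (mul_le_mul_of_nonneg_left n2 (by positivity))
  have q4 : N * (2 * δ * n) ≤ ε / 3 * n := by
    have : N * δ ≤ ε / 6 := by
      have h5 := min_le_right 1 (ε / (6 * (N + 1)))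
      rw [← hδ, le_div_iff₀ (by positivity)] at h5
      nlinarith
    nlinarith
  have q5 := k3.trans (mul_le_mul_of_nonneg_left n3 hN0)
  rw [norm_mul, Complex.norm_real, Real.norm_eq_abs]
  have q6 := mul_le_mul_of_nonneg_left (q5.trans q4) ha
  rw [q1] at q2 q3
  calc _ ≤ ε / 3 * |t - s| * n + ε / 3 * |t - s| * n + |t - s| * (ε / 3 * n) :=
        add_le_add (add_le_add q2 q3) q6
    _ = ε * |t - s| * n := by ring

lemma pairing_star (p q f f' : ℝ → ℂ) :
    pairing (fun x => conj (p x)) (fun x => conj (q x)) f f' =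
      conj (pairing p q (fun x => conj (f x)) (fun x => conj (f' x))) := by
  unfold pairing
  rw [map_sub, ← integral_conj, ← integral_conj]
  simp

lemma WD.star (hF : WD F pF qF s) :
    WD (fun t x => conj (F t x)) (fun x => conj (pF x)) (fun x => conj (qF x)) s := by
  refine ⟨hF.memp.star, hF.memq.star, fun ε hε => ?_⟩
  filter_upwards [hF.deriv ε hε] with t ht ψ ψ' hψ
  have := ht _ _ hψ.star
  rw [nrm_conj, nrm_conj] at this
  refine le_trans (le_of_eq ?_) this
  rw [pairing_star, ← Complex.norm_conj, map_sub, map_mul, ← integral_conj]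
  simp

lemma integral_dq_mul (hf : L2fun f) (hg : L2fun g) (h : ℝ) :
    ∫ x, dq h f x * g x = -∫ x, f x * dq (-h) g x := by
  have i1 := (hf.comp_add h).integrable_mul hg
  have i2 := hf.integrable_mul hg
  have i3 := hf.integrable_mul (hg.comp_add (-h))
  have e : ∫ x, f (x + h) * g x = ∫ x, f x * g (x + -h) := by
    rw [← integral_add_right_eq_self (fun x => f x * g (x + -h)) h]
    simp
  have e1 : ∫ x, dq h f x * g x = (h : ℂ)⁻¹ * ((∫ x, f (x + h) * g x) - ∫ x, f x * g x) := by
    rw [← integral_sub i1 i2, ← integral_const_mul]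
    congr 1; funext x; simp only [dq]; ring
  have e2 : ∫ x, f x * dq (-h) g x =
      -(h : ℂ)⁻¹ * ((∫ x, f x * g (x + -h)) - ∫ x, f x * g x) := by
    rw [← integral_sub i3 i2, ← integral_const_mul]
    congr 1; funext x; simp only [dq]; push_cast; rw [inv_neg]; ring
  rw [e1, e2, e]; ring

lemma nrm_dq_le_const (hf : L2fun f) (h : ℝ) : nrm (dq h f) ≤ |h|⁻¹ * 2 * nrm f := by
  have h1 := nrm_sub_le (hf.comp_add h) hf
  rw [nrm_comp_add hf] at h1
  have h2 : nrm (dq h f) = ‖(h : ℂ)⁻¹‖ * nrm (fun x => f (x + h) - f x) := nrm_const_mul _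
  rw [h2, norm_inv, Complex.norm_real, Real.norm_eq_abs]
  have := mul_le_mul_of_nonneg_left h1 (inv_nonneg.2 (abs_nonneg h))
  linarith

lemma WD.dq (hF : WD F pF qF s) (h : ℝ) (hm : ∀ᶠ t in 𝓝 s, L2fun (F t)) :
    WD (fun t => dq h (F t)) (dq h pF) (dq h qF) s := by
  refine ⟨hF.memp.dq h, hF.memq.dq h, fun ε hε => ?_⟩
  have hK : 0 < |h|⁻¹ * 2 + 1 := by positivity
  filter_upwards [hF.deriv (ε / (|h|⁻¹ * 2 + 1)) (by positivity), hm] with t ht hmt ψ ψ' hψ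
  have k := ht _ _ (hψ.dq (-h))
  have n1 := nrm_dq_le_const hψ.mem (-h)
  have n2 := nrm_dq_le_const hψ.mem' (-h)
  rw [abs_neg] at n1 n2
  have hms := hm.self_of_nhds
  have e1 : ∫ x, (AirySchrodinger.dq h (F t) x - AirySchrodinger.dq h (F s) x) * ψ x =
      -∫ x, (F t x - F s x) * AirySchrodinger.dq (-h) ψ x := by
    rw [← integral_dq_mul (hmt.sub' hms) hψ.mem]
    simp only [dq_sub]
  have e2 : pairing (AirySchrodinger.dq h pF) (AirySchrodinger.dq h qF) ψ ψ' =
      -pairing pF qF (AirySchrodinger.dq (-h) ψ) (AirySchrodinger.dq (-h) ψ') := by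
    unfold pairing
    rw [integral_dq_mul hF.memp hψ.mem, integral_dq_mul hF.memq hψ.mem']; ring
  rw [e1, e2, ← norm_neg]
  refine le_trans (le_of_eq ?_) (k.trans ?_)
  · congr 1; ring
  · rw [div_mul_eq_mul_div, div_mul_eq_mul_div, div_le_iff₀ hK]
    have : 0 ≤ ε * |t - s| := by positivity
    have h0 : 0 ≤ nrm ψ + nrm ψ' := add_nonneg nrm_nonneg nrm_nonneg
    exact (mul_le_mul_of_nonneg_left (show _ ≤ (nrm ψ + nrm ψ') * (|h|⁻¹ * 2 + 1) by nlinarith)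
      this).trans (le_of_eq (by ring))

end

section

/-! ### Solutions as curves of functions -/

/-- The nonlinearity `i c |f|² f + d |f|² f₁ + e f² conj(f₁)`, as a function of `f` and `f₁`. -/
noncomputable def nl (c d e : ℝ) (f f₁ : ℝ → ℂ) (x : ℝ) : ℂ :=
  Complex.I * c * (f x * conj (f x) * f x) + d * (f x * conj (f x) * f₁ x)
    + e * (f x * f x * conj (f₁ x))

/-- The derivative of the nonlinearity, in terms of `f` and of its derivatives `f₁` and `f₂`. -/
noncomputable def nl₁ (c d e : ℝ) (f f₁ f₂ : ℝ → ℂ) (x : ℝ) : ℂ :=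
  Complex.I * c * ((f₁ x * conj (f x) + f x * conj (f₁ x)) * f x + f x * conj (f x) * f₁ x)
    + d * ((f₁ x * conj (f x) + f x * conj (f₁ x)) * f₁ x + f x * conj (f x) * f₂ x)
    + e * ((f₁ x * f x + f x * f₁ x) * conj (f₁ x) + f x * f x * conj (f₂ x))

lemma H2T.nl {ι : Type*} {l : Filter ι} {F F₁ F₂ : ι → ℝ → ℂ} {f f₁ f₂ : ℝ → ℂ}
    (h : H2T l F F₁ F₂ f f₁ f₂) (c d e : ℝ) :
    H1T l (fun i => nl c d e (F i) (F₁ i)) (fun i => nl₁ c d e (F i) (F₁ i) (F₂ i))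
      (nl c d e f f₁) (nl₁ c d e f f₁ f₂) :=
  ((((h.fst.mul h.fst.star).mul h.fst).const_mul (Complex.I * c)).add
    (((h.fst.mul h.fst.star).mul h.snd).const_mul (d : ℂ))).add
    (((h.fst.mul h.fst).mul h.snd.star).const_mul (e : ℂ))

/-- A curve `u` in `H²(ℝ)`, with spatial derivatives `u₁` and `u₂`, continuous on `[-T, T]`, which
solves the equation in `H⁻¹(ℝ)` on `(-T, T)`. -/
structure Flow (a b c d e T : ℝ) (u u₁ u₂ : ℝ → ℝ → ℂ) : Prop where
  h2 : ∀ t ∈ Icc (-T) T, H2T (𝓝[Icc (-T) T] t) u u₁ u₂ (u t) (u₁ t) (u₂ t)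
  wd : ∀ t ∈ Ioo (-T) T, WD u (fun x => -(Complex.I * a * u₂ t x) - nl c d e (u t) (u₁ t) x)
    (fun x => -(b * u₂ t x)) t

lemma MemH.exists_rep {f : L2} (hf : MemH 2 f) :
    ∃ U U₁ : ℝ → ℂ, IsH1 U U₁ ∧ IsH1 U₁ (wderiv (wderiv f)) ∧ U =ᵐ[volume] f ∧
      U₁ =ᵐ[volume] wderiv f := by
  obtain ⟨h1, h2, -⟩ := hf.weakDerivs
  obtain ⟨U, hU, hUe⟩ := exists_isH1 (Lp.memLp f) (Lp.memLp (wderiv f)) h1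
  obtain ⟨V, hV, hVe⟩ := exists_isH1 (Lp.memLp (wderiv f)) (Lp.memLp (wderiv (wderiv f))) h2
  refine ⟨U, V, ⟨⟨hV.continuous.locallyIntegrable, fun a b => ?_⟩, hU.mem, hV.mem⟩, hV, hUe, hVe⟩
  rw [← hU.ac.ftc]
  refine intervalIntegral.integral_congr_ae ?_
  filter_upwards [hVe] with x hx _ using hx

/-- A curve whose pairings with test functions are differentiable, with a derivative depending
continuously on time in `H⁻¹`, is differentiable in `H⁻¹`. -/
lemma wd_of_test {F P Q : ℝ → ℝ → ℂ} {s : ℝ} {I : Set ℝ} (hI : I ∈ 𝓝 s)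
    (hF : ∀ t ∈ I, L2fun (F t)) (hP : L2T (𝓝 s) P (P s)) (hQ : L2T (𝓝 s) Q (Q s))
    (hd : ∀ ψ, IsTest ψ → ∀ t ∈ I, HasDerivWithinAt (fun r => ∫ x, F r x * ψ x)
      (pairing (P t) (Q t) ψ (deriv ψ)) I t) : WD F (P s) (Q s) s := by
  refine ⟨hP.lim, hQ.lim, fun ε hε => ?_⟩
  -- the estimate holds for test functions by the mean value inequality, near `s` where `P` and `Q`
  -- vary by less than `ε`
  have hn := hP.tendsto.add hQ.tendsto
  rw [add_zero] at hn
  have hev := (hn.eventually (gt_mem_nhds hε)).and (hP.mem.and (hQ.mem.and hI))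
  obtain ⟨δ, hδ, hball⟩ := Metric.eventually_nhds_iff_ball.1 hev
  filter_upwards [Metric.ball_mem_nhds s hδ] with t ht
  have hst : s ∈ Metric.ball s δ := Metric.mem_ball_self hδ
  have hFt := hF t (hball t ht).2.2.2
  have hFs := hF s (hball s hst).2.2.2
  have key : ∀ φ, IsTest φ →
      ‖(∫ x, (F t x - F s x) * φ x) - ((t - s : ℝ) : ℂ) * pairing (P s) (Q s) φ (deriv φ)‖ ≤
        ε * |t - s| * (nrm φ + nrm (deriv φ)) := by
    intro φ hφ
    have hder : ∀ r ∈ Metric.ball s δ, HasDerivWithinAt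
        (fun r => (∫ x, F r x * φ x) - (r : ℂ) * pairing (P s) (Q s) φ (deriv φ))
        (pairing (P r) (Q r) φ (deriv φ) - pairing (P s) (Q s) φ (deriv φ))
        (Metric.ball s δ) r := by
      intro r hr
      have h1 := (hd φ hφ r (hball r hr).2.2.2).mono
        (fun y hy => (hball y hy).2.2.2 : Metric.ball s δ ⊆ I)
      have h2 : HasDerivWithinAt (fun r : ℝ => (r : ℂ) * pairing (P s) (Q s) φ (deriv φ))
          (1 * pairing (P s) (Q s) φ (deriv φ)) (Metric.ball s δ) r :=
        (HasDerivAt.ofReal_comp (hasDerivAt_id r)).hasDerivWithinAt.mul_const _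
      rw [one_mul] at h2
      exact h1.sub h2
    have hbd : ∀ r ∈ Metric.ball s δ,
        ‖pairing (P r) (Q r) φ (deriv φ) - pairing (P s) (Q s) φ (deriv φ)‖ ≤
          ε * (nrm φ + nrm (deriv φ)) := by
      intro r hr
      obtain ⟨h1, h2, h3, -⟩ := hball r hr
      rw [← pairing_sub_left hP.lim hQ.lim h2 h3 hφ.mem hφ.deriv.mem]
      refine (norm_pairing_le' (h2.sub' hP.lim) (h3.sub' hQ.lim) hφ.mem hφ.deriv.mem).trans ?_
      exact mul_le_mul_of_nonneg_right h1.le (add_nonneg nrm_nonneg nrm_nonneg)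
    have := (convex_ball s δ).norm_image_sub_le_of_norm_hasDerivWithin_le hder hbd hst ht
    rw [Real.norm_eq_abs] at this
    refine le_trans (le_of_eq ?_) (this.trans (le_of_eq (by ring)))
    congr 1
    simp only [sub_mul]
    rw [integral_sub (hFt.integrable_mul hφ.mem) (hFs.integrable_mul hφ.mem)]
    push_cast; ring
  -- extension to `H¹` by density; `K` is the constant by which an error `θ` in the
  -- approximation of `ψ` is multiplied
  intro ψ ψ' hψ
  set K := nrm (fun x => F t x - F s x) + |t - s| * (2 * (nrm (P s) + nrm (Q s)))
    + 2 * (ε * |t - s|) with hK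
  have hK0 : 0 ≤ K := by
    have := nrm_nonneg (f := fun x => F t x - F s x)
    have := nrm_nonneg (f := P s)
    have := nrm_nonneg (f := Q s)
    positivity
  refine le_of_forall_pos_le_add fun η hη => ?_
  obtain ⟨φ, hφ, n1, n2⟩ := hψ.exists_test (ε := η / (K + 1)) (by positivity)
  have k1 := key φ hφ
  set θ := η / (K + 1) with hθ
  have hd' := hψ.sub hφ.isH1
  have k2 := norm_integral_mul_le (hFt.sub' hFs) hd'.mem
  have k3 := norm_pairing_le' hP.lim hQ.lim hd'.mem hd'.mem'
  rw [pairing_sub hP.lim hQ.lim hψ.mem hψ.mem' hφ.mem hφ.deriv.mem] at k3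
  have e1 : ∫ x, (F t x - F s x) * (ψ x - φ x) =
      (∫ x, (F t x - F s x) * ψ x) - ∫ x, (F t x - F s x) * φ x := by
    rw [← integral_sub ((hFt.sub' hFs).integrable_mul hψ.mem)
      ((hFt.sub' hFs).integrable_mul hφ.mem)]
    congr 1; funext x; ring
  rw [e1] at k2
  have n3 : nrm φ ≤ nrm ψ + θ := by
    have := nrm_add_le (f := fun x => φ x - ψ x) (hφ.mem.sub' hψ.mem) hψ.mem
    rw [nrm_sub_comm] at this
    simp only [sub_add_cancel] at this
    linarith
  have n4 : nrm (deriv φ) ≤ nrm ψ' + θ := by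
    have := nrm_add_le (f := fun x => deriv φ x - ψ' x) (hφ.deriv.mem.sub' hψ.mem') hψ.mem'
    rw [nrm_sub_comm] at this
    simp only [sub_add_cancel] at this
    linarith
  have e2 : ∀ A B a b τ : ℂ, A - τ * B = (A - a) - τ * (B - b) + (a - τ * b) := by intros; ring
  rw [e2 _ _ (∫ x, (F t x - F s x) * φ x) (pairing (P s) (Q s) φ (deriv φ))]
  refine (norm_add_le _ _).trans ((add_le_add_left (norm_sub_le _ _) _).trans ?_)
  rw [norm_mul, Complex.norm_real, Real.norm_eq_abs]
  have q1 := mul_le_mul_of_nonneg_left n1 (nrm_nonneg (f := fun x => F t x - F s x))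
  have q2 := mul_le_mul_of_nonneg_left (k3.trans (mul_le_mul_of_nonneg_left (add_le_add n1 n2)
    (add_nonneg (nrm_nonneg (f := P s)) (nrm_nonneg (f := Q s))))) (abs_nonneg (t - s))
  have q3 := mul_le_mul_of_nonneg_left (add_le_add n3 n4)
    (show 0 ≤ ε * |t - s| by positivity)
  have q4 : K * θ ≤ η := by
    rw [hθ, mul_div_assoc', div_le_iff₀ (by positivity)]; nlinarith
  have q5 : K * θ = nrm (fun x => F t x - F s x) * θ +
    |t - s| * ((nrm (P s) + nrm (Q s)) * (θ + θ)) + ε * |t - s| * (2 * θ) := by rw [hK]; ring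
  linarith

lemma iteratedDeriv_test {f : L2} (hf : MemH 2 f) {ψ : ℝ → ℂ} (hψ : IsTest ψ) :
    (∫ x, f x * iteratedDeriv 2 ψ x) = ∫ x, (wderiv (wderiv f)) x * ψ x := by
  obtain ⟨h1, h2, -⟩ := hf.weakDerivs
  have e : iteratedDeriv 2 ψ = deriv (deriv ψ) := by
    rw [iteratedDeriv_succ, iteratedDeriv_one]
  rw [e, h1 _ hψ.deriv, h2 _ hψ, neg_neg]

/-- A solution defines a curve of functions in `H²`. -/
lemma IsSolution.exists_flow {a b c d e T : ℝ} {u₀ : L2} {u : ℝ → L2}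
    (h : IsSolution a b c d e T u₀ u) :
    ∃ U U₁ U₂ : ℝ → ℝ → ℂ, Flow a b c d e T U U₁ U₂ ∧ ∀ t ∈ Icc (-T) T,
      U t =ᵐ[volume] u t ∧ U₁ t =ᵐ[volume] wderiv (u t) ∧
      U₂ t =ᵐ[volume] wderiv (wderiv (u t)) := by
  have hrep : ∀ t : ℝ, ∃ V V₁ : ℝ → ℂ, t ∈ Icc (-T) T →
      IsH1 V V₁ ∧ IsH1 V₁ (wderiv (wderiv (u t))) ∧ V =ᵐ[volume] u t ∧
      V₁ =ᵐ[volume] wderiv (u t) := by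
    intro t
    by_cases ht : t ∈ Icc (-T) T
    · obtain ⟨V, V₁, hV⟩ := (h.mem t ht).exists_rep
      exact ⟨V, V₁, fun _ => hV⟩
    · exact ⟨0, 0, fun h => absurd h ht⟩
  choose U U₁ hU using hrep
  set U₂ : ℝ → ℝ → ℂ := fun t => wderiv (wderiv (u t)) with hU₂
  have hL : ∀ t₀ ∈ Icc (-T) T, ∀ {W : ℝ → ℝ → ℂ} {w : ℝ → L2},
      (∀ t ∈ Icc (-T) T, W t =ᵐ[volume] w t) →
      (∀ t ∈ Icc (-T) T, ‖w t - w t₀‖ ≤ sobolevNorm 2 (u t - u t₀)) →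
      L2T (𝓝[Icc (-T) T] t₀) W (W t₀) := by
    intro t₀ ht₀ W w hW hw
    have hmem : ∀ t ∈ Icc (-T) T, L2fun (W t) := fun t ht =>
      (Lp.memLp (w t)).ae_eq (hW t ht).symm
    refine L2T.of_le ?_ (hmem t₀ ht₀) (h.cont t₀ ht₀) ?_
    · filter_upwards [self_mem_nhdsWithin] with t ht using hmem t ht
    · filter_upwards [self_mem_nhdsWithin] with t ht
      refine le_trans (le_of_eq ?_) (hw t ht)
      rw [Lp.norm_def]
      refine nrm_congr_ae ?_
      filter_upwards [hW t ht, hW t₀ ht₀, Lp.coeFn_sub (w t) (w t₀)] with x h1 h2 h3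
      rw [h1, h2, h3, Pi.sub_apply]
  have hsub : ∀ t₀ ∈ Icc (-T) T, ∀ t ∈ Icc (-T) T,
      wderiv (u t - u t₀) = wderiv (u t) - wderiv (u t₀) ∧
      wderiv (wderiv (u t - u t₀)) = wderiv (wderiv (u t)) - wderiv (wderiv (u t₀)) := by
    intro t₀ ht₀ t ht
    obtain ⟨a1, a2, -⟩ := (h.mem t ht).weakDerivs
    obtain ⟨b1, b2, -⟩ := (h.mem t₀ ht₀).weakDerivs
    have e1 := wderiv_eq (a1.sub b1)
    exact ⟨e1, by rw [e1]; exact wderiv_eq (a2.sub b2)⟩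
  have hH2 : ∀ t ∈ Icc (-T) T, H2T (𝓝[Icc (-T) T] t) U U₁ U₂ (U t) (U₁ t) (U₂ t) := by
    intro t₀ ht₀
    have hb : ∀ t ∈ Icc (-T) T, _ := fun t ht =>
      ((h.mem t ht).sub (h.mem t₀ ht₀)).weakDerivs.2.2
    have l0 := hL t₀ ht₀ (W := U) (w := u) (fun t ht => (hU t ht).2.2.1) (fun t ht => (hb t ht).1)
    have l1 := hL t₀ ht₀ (W := U₁) (w := fun t => wderiv (u t)) (fun t ht => (hU t ht).2.2.2)
      (fun t ht => by rw [← (hsub t₀ ht₀ t ht).1]; exact (hb t ht).2.1)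
    have l2 := hL t₀ ht₀ (W := U₂) (w := fun t => wderiv (wderiv (u t)))
      (fun t ht => ae_eq_refl _)
      (fun t ht => by rw [← (hsub t₀ ht₀ t ht).2]; exact (hb t ht).2.2)
    refine ⟨⟨?_, (hU t₀ ht₀).1, l0, l1⟩, ⟨?_, (hU t₀ ht₀).2.1, l1, l2⟩⟩
    · filter_upwards [self_mem_nhdsWithin] with t ht using (hU t ht).1
    · filter_upwards [self_mem_nhdsWithin] with t ht using (hU t ht).2.1
  refine ⟨U, U₁, U₂, ⟨hH2, fun s hs => ?_⟩, fun t ht =>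
    ⟨(hU t ht).2.2.1, (hU t ht).2.2.2, ae_eq_refl _⟩⟩
  have hI : Icc (-T) T ∈ 𝓝 s := Icc_mem_nhds hs.1 hs.2
  have hs2 := hH2 s (Ioo_subset_Icc_self hs)
  rw [nhdsWithin_eq_nhds.2 hI] at hs2
  refine wd_of_test (P := fun t x => -(Complex.I * a * U₂ t x) - nl c d e (U t) (U₁ t) x)
    (Q := fun t x => -(b * U₂ t x)) hI (fun t ht => (hU t ht).1.mem) ?_ ?_ ?_
  · have := (hs2.snd.snd.const_mul (-(Complex.I * a))).sub (hs2.nl c d e).fst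
    simpa only [neg_mul] using this
  · have := hs2.snd.snd.const_mul (-(b : ℂ))
    simpa only [neg_mul] using this
  · intro ψ hψ t ht
    obtain ⟨g1, g2, g3, g4⟩ := hU t ht
    have hN := (hH2 t ht).nl c d e
    have key := h.eqn ψ hψ t ht
    have e2 := iteratedDeriv_test (h.mem t ht) hψ
    have e3 : ∫ x, u t x * iteratedDeriv 3 ψ x = ∫ x, U₂ t x * deriv ψ x := by
      rw [← iteratedDeriv_test (h.mem t ht) hψ.deriv, iteratedDeriv_succ']
    have e4 : ∫ x, nonlin c d e (u t) x * ψ x = ∫ x, nl c d e (U t) (U₁ t) x * ψ x := by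
      refine integral_congr_ae ?_
      filter_upwards [g3, g4] with x h1 h2
      rw [nonlin, nl, h1, h2, Complex.mul_conj, Complex.normSq_eq_norm_sq]
      ring
    have e5 : pairing (fun x => -(Complex.I * a * U₂ t x) - nl c d e (U t) (U₁ t) x)
        (fun x => -(b * U₂ t x)) ψ (deriv ψ) =
        -(Complex.I * a * (∫ x, u t x * iteratedDeriv 2 ψ x)
          - b * (∫ x, u t x * iteratedDeriv 3 ψ x) + ∫ x, nonlin c d e (u t) x * ψ x) := by
      rw [e2, e3, e4, pairing]
      have i1 := (g2.mem'.integrable_mul hψ.mem).const_mul (-(Complex.I * a))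
      have i2 := hN.lim.mem.integrable_mul hψ.mem
      have e6 : ∫ x, (-(Complex.I * a * U₂ t x) - nl c d e (U t) (U₁ t) x) * ψ x =
          -(Complex.I * a) * (∫ x, U₂ t x * ψ x) - ∫ x, nl c d e (U t) (U₁ t) x * ψ x := by
        rw [← integral_const_mul, ← integral_sub i1 i2]
        congr 1; funext x; simp only [hU₂]; ring
      have e7 : ∫ x, -(b * U₂ t x) * deriv ψ x = -b * ∫ x, U₂ t x * deriv ψ x := by
        rw [← integral_const_mul]
        congr 1; funext x; ring
      rw [e6, e7]; simp only [hU₂]; ring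
    rw [e5]
    refine key.congr_of_mem (fun r hr => ?_) ht
    refine integral_congr_ae ?_
    filter_upwards [(hU r hr).2.2.1] with x hx
    rw [hx]

end

section

/-! ### Integration by parts identities at a fixed time -/

/-- An integrable function with vanishing integral (in applications a total derivative). -/
structure IsTot (D : ℝ → ℂ) : Prop where
  integrable : Integrable D volume
  integral : ∫ x, D x = 0

lemma IsTot.add {D E : ℝ → ℂ} (hD : IsTot D) (hE : IsTot E) : IsTot (fun x => D x + E x) :=
  ⟨hD.1.add hE.1, by rw [integral_add hD.1 hE.1, hD.2, hE.2, add_zero]⟩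

lemma IsTot.const_mul {D : ℝ → ℂ} (c : ℂ) (hD : IsTot D) : IsTot (fun x => c * D x) :=
  ⟨hD.1.const_mul c, by rw [integral_const_mul, hD.2, mul_zero]⟩

lemma IsH1.tot {f f' g g' : ℝ → ℂ} (hf : IsH1 f f') (hg : IsH1 g g') :
    IsTot (fun x => f' x * g x + f x * g' x) :=
  ⟨(hf.mem'.integrable_mul hg.mem).add (hf.mem.integrable_mul hg.mem'), hf.integral_add hg⟩

lemma L2fun.neg' {f : ℝ → ℂ} (hf : L2fun f) : L2fun (fun x => -f x) := MemLp.neg hf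

lemma integrable_add {Φ Ψ : ℝ → ℂ} (hΦ : Integrable Φ volume) (hΨ : Integrable Ψ volume) :
    Integrable (fun x => Φ x + Ψ x) volume := hΦ.add hΨ

lemma integrable_sub {Φ Ψ : ℝ → ℂ} (hΦ : Integrable Φ volume) (hΨ : Integrable Ψ volume) :
    Integrable (fun x => Φ x - Ψ x) volume := hΦ.sub hΨ

lemma integrable_conj {Φ : ℝ → ℂ} (hΦ : Integrable Φ volume) :
    Integrable (fun x => conj (Φ x)) volume :=
  (RCLike.conjCLE (K := ℂ)).toContinuousLinearMap.integrable_comp hΦ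

/-- Two integrands have integrals with the same real part if their real parts agree up to a total
derivative. -/
lemma re_integral_eq {Φ Ψ D : ℝ → ℂ} (hΦ : Integrable Φ volume) (hΨ : Integrable Ψ volume)
    (hD : IsTot D) (h : ∀ x, Φ x + conj (Φ x) = Ψ x + conj (Ψ x) + (D x + conj (D x))) :
    (∫ x, Φ x).re = (∫ x, Ψ x).re := by
  have h1 : ∫ x, (Φ x + conj (Φ x)) = ∫ x, (Ψ x + conj (Ψ x) + (D x + conj (D x))) :=
    integral_congr_ae (ae_of_all _ h)
  rw [integral_add hΦ (integrable_conj hΦ),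
    integral_add (integrable_add hΨ (integrable_conj hΨ)) (integrable_add hD.1 (integrable_conj hD.1)),
    integral_add hΨ (integrable_conj hΨ), integral_add hD.1 (integrable_conj hD.1),
    integral_conj, integral_conj, integral_conj, hD.2, Complex.add_conj, Complex.add_conj,
    map_zero, add_zero, add_zero] at h1
  have := Complex.ofReal_injective h1
  linarith

/-- Two integrands have integrals with the same imaginary part if their imaginary parts agree up
to a total derivative. -/
lemma im_integral_eq {Φ Ψ D : ℝ → ℂ} (hΦ : Integrable Φ volume) (hΨ : Integrable Ψ volume)
    (hD : IsTot D) (h : ∀ x, Φ x - conj (Φ x) = Ψ x - conj (Ψ x) + (D x - conj (D x))) :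
    (∫ x, Φ x).im = (∫ x, Ψ x).im := by
  have h1 : ∫ x, (Φ x - conj (Φ x)) = ∫ x, (Ψ x - conj (Ψ x) + (D x - conj (D x))) :=
    integral_congr_ae (ae_of_all _ h)
  rw [integral_sub hΦ (integrable_conj hΦ),
    integral_add (integrable_sub hΨ (integrable_conj hΨ)) (integrable_sub hD.1 (integrable_conj hD.1)),
    integral_sub hΨ (integrable_conj hΨ), integral_sub hD.1 (integrable_conj hD.1),
    integral_conj, integral_conj, integral_conj, hD.2, Complex.sub_conj, Complex.sub_conj,
    map_zero, sub_zero, add_zero] at h1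
  have := congrArg Complex.im h1
  simp only [Complex.mul_im, Complex.ofReal_re, Complex.ofReal_im, Complex.I_re, Complex.I_im,
    mul_one, mul_zero, add_zero] at this
  linarith

lemma pairing_eq_integral {p q f f' : ℝ → ℂ} (hp : L2fun p) (hq : L2fun q) (hf : L2fun f)
    (hf' : L2fun f') : pairing p q f f' = ∫ x, (p x * f x - q x * f' x) := by
  rw [integral_sub (hp.integrable_mul hf) (hq.integrable_mul hf')]; rfl

lemma integrable_pairing {p q f f' : ℝ → ℂ} (hp : L2fun p) (hq : L2fun q) (hf : L2fun f)
    (hf' : L2fun f') : Integrable (fun x => p x * f x - q x * f' x) volume :=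
  (hp.integrable_mul hf).sub (hq.integrable_mul hf')

section

variable {u u₁ u₂ : ℝ → ℂ} {a b c d e : ℝ}

/-- The nonlinearity of an `H²` function is in `H¹`. -/
lemma isH1_nl (hu : IsH1 u u₁) (hu₁ : IsH1 u₁ u₂) (c d e : ℝ) :
    IsH1 (nl c d e u u₁) (nl₁ c d e u u₁ u₂) :=
  ((((hu.mul hu.star).mul hu).const_mul (Complex.I * c)).add
    (((hu.mul hu.star).mul hu₁).const_mul (d : ℂ))).add
    (((hu.mul hu).mul hu₁.star).const_mul (e : ℂ))

/-- The part `p` of the time derivative `p + ∂ₓ q` of a solution is square integrable. -/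
lemma memp (hv : L2fun u₂) {g : ℝ → ℂ} (hg : L2fun g) (a : ℝ) :
    L2fun (fun x => -(Complex.I * a * u₂ x) - g x) :=
  L2fun.sub' (L2fun.neg' (hv.cmul (Complex.I * a))) hg

/-- The flux `q` in the time derivative `p + ∂ₓ q` of a solution is square integrable. -/
lemma memq (hv : L2fun u₂) (b : ℝ) : L2fun (fun x => -(b * u₂ x)) := L2fun.neg' (hv.cmul (b : ℂ))

/-- The linear part of the equation does not contribute to the evolution of the `L²` norm. -/
lemma re_pairing_self {v v₁ v₂ g : ℝ → ℂ} (hv : IsH1 v v₁) (hv₁ : IsH1 v₁ v₂) (hg : L2fun g)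
    (a b : ℝ) :
    (pairing (fun x => -(Complex.I * a * v₂ x) - g x) (fun x => -(b * v₂ x))
      (fun x => conj (v x)) (fun x => conj (v₁ x))).re = -(∫ x, g x * conj (v x)).re := by
  have hp := memp hv₁.mem' hg a
  have hq := memq hv₁.mem' b
  rw [pairing_eq_integral hp hq hv.star.mem hv.star.mem', ← Complex.neg_re, ← integral_neg]
  refine re_integral_eq (integrable_pairing hp hq hv.star.mem hv.star.mem')
    (hg.integrable_mul hv.star.mem).neg
    (((hv₁.tot hv.star).const_mul (-(Complex.I * a))).add
      ((hv₁.tot hv₁.star).const_mul (b / 2 : ℂ))) fun x => ?_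
  simp only [map_add, map_sub, map_mul, map_neg, map_div₀, Complex.conj_conj, Complex.conj_I,
    Complex.conj_ofReal, map_ofNat]
  ring

lemma IsH1.weight {χ χ₁ : ℝ → ℝ} {M : ℝ} (h0 : ∀ x, HasDerivAt χ (χ₁ x) x) (hc : Continuous χ₁)
    (b0 : ∀ x, |χ x| ≤ M) (b1 : ∀ x, |χ₁ x| ≤ M) {f f' : ℝ → ℂ} (hf : IsH1 f f') :
    IsH1 (fun x => χ x * f x) (fun x => χ₁ x * f x + χ x * f' x) := by
  have hc0 : Continuous χ := continuous_iff_continuousAt.2 fun x => (h0 x).continuousAt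
  have m0 : ∀ {g : ℝ → ℂ}, L2fun g → L2fun (fun x => (χ x : ℂ) * g x) := fun hg =>
    hg.mul_bdd (Complex.continuous_ofReal.comp hc0).aestronglyMeasurable
      (fun x => by simpa using b0 x)
  have m1 : ∀ {g : ℝ → ℂ}, L2fun g → L2fun (fun x => (χ₁ x : ℂ) * g x) := fun hg =>
    hg.mul_bdd (Complex.continuous_ofReal.comp hc).aestronglyMeasurable
      (fun x => by simpa using b1 x)
  exact ⟨(IsAC.of_hasDerivAt (fun x => (h0 x).ofReal_comp)
    (Complex.continuous_ofReal.comp hc)).mul hf.ac, m0 hf.mem, (m1 hf.mem).add' (m0 hf.mem')⟩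

lemma L2fun.weight {χ : ℝ → ℝ} {M : ℝ} (hc : Continuous χ) (b0 : ∀ x, |χ x| ≤ M) {g : ℝ → ℂ}
    (hg : L2fun g) : L2fun (fun x => (χ x : ℂ) * g x) :=
  hg.mul_bdd (Complex.continuous_ofReal.comp hc).aestronglyMeasurable
      (fun x => by simpa using b0 x)

/-- Evolution of the weighted mass: the weight `χ` is a real function with derivatives `χ₁`, `χ₂`
and `χ₃`. -/
lemma re_pairing_weight {χ χ₁ χ₂ χ₃ : ℝ → ℝ} {M : ℝ}
    (h0 : ∀ x, HasDerivAt χ (χ₁ x) x) (h1 : ∀ x, HasDerivAt χ₁ (χ₂ x) x)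
    (h2 : ∀ x, HasDerivAt χ₂ (χ₃ x) x) (h3 : Continuous χ₃)
    (b0 : ∀ x, |χ x| ≤ M) (b1 : ∀ x, |χ₁ x| ≤ M) (b2 : ∀ x, |χ₂ x| ≤ M) (b3 : ∀ x, |χ₃ x| ≤ M)
    (hu : IsH1 u u₁) (hu₁ : IsH1 u₁ u₂) :
    (pairing (fun x => -(Complex.I * a * u₂ x) - nl c d e u u₁ x) (fun x => -(b * u₂ x))
      (fun x => χ x * conj (u x)) (fun x => χ₁ x * conj (u x) + χ x * conj (u₁ x))).re =
    (∫ x, (Complex.I * a * (χ₁ x * u₁ x * conj (u x)) + 3 * b / 2 *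
      (χ₁ x * u₂ x * conj (u x)) - b / 4 * (χ₃ x * u x * conj (u x)) +
      (d + e) / 4 * (χ₁ x * (u x * conj (u x)) * (u x * conj (u x))))).re := by
  have c1 : Continuous χ₁ := continuous_iff_continuousAt.2 fun x => (h1 x).continuousAt
  have c2 : Continuous χ₂ := continuous_iff_continuousAt.2 fun x => (h2 x).continuousAt
  have hF := isH1_nl hu hu₁ c d e
  have hp := memp hu₁.mem' hF.mem a
  have hq := memq hu₁.mem' b
  have w0 := hu.star.weight h0 c1 b0 b1
  have hρ := hu.mul hu.star
  rw [pairing_eq_integral hp hq w0.mem w0.mem']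
  refine re_integral_eq (integrable_pairing hp hq w0.mem w0.mem')
    (((((((hu₁.mem.weight c1 b1).integrable_mul hu.star.mem).const_mul (Complex.I * a))).add
      (((hu₁.mem'.weight c1 b1).integrable_mul hu.star.mem).const_mul (3 * b / 2 : ℂ))).sub
      (((hu.mem.weight h3 b3).integrable_mul hu.star.mem).const_mul (b / 4 : ℂ))).add
      (((hρ.mem.weight c1 b1).integrable_mul hρ.mem).const_mul ((d + e) / 4 : ℂ)))
    ((((((hu₁.tot w0).const_mul (-(Complex.I * a))).add
      ((((hu₁.weight h0 c1 b0 b1).tot hu₁.star).const_mul (b / 2 : ℂ)))).add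
      ((hu₁.tot (hu.star.weight h1 c2 b1 b2)).const_mul (-(b / 2) : ℂ))).add
      ((hu.tot (hu.star.weight h2 h3 b2 b3)).const_mul (b / 4 : ℂ))).add
      ((((hρ.weight h0 c1 b0 b1).tot hρ)).const_mul (-((d + e) / 4) : ℂ))) fun x => ?_
  simp only [nl, map_add, map_sub, map_mul, map_neg, map_div₀, Complex.conj_conj, Complex.conj_I,
    Complex.conj_ofReal, map_ofNat]
  ring

/-- The contribution of the nonlinearity to the evolution of `∫ |u₁|²`: the only terms left are the
two which are cancelled by the quartic correctors. -/
lemma re_integral_nl₁ (hu : IsH1 u u₁) (hu₁ : IsH1 u₁ u₂) :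
    (∫ x, nl₁ c d e u u₁ u₂ x * conj (u₁ x)).re =
      (d + e) / 2 * (∫ x, (u₁ x * conj (u x) + u x * conj (u₁ x)) * (u₁ x * conj (u₁ x))).re -
      c * (∫ x, u x * conj (u₁ x) * (u x * conj (u₁ x))).im := by
  have hF := isH1_nl hu hu₁ c d e
  have hρ := hu.mul hu.star
  have hσ := hu₁.mul hu₁.star
  have i1 := (hρ.mem'.integrable_mul hσ.mem)
  have hk := hu.mul_mem hu₁.star.mem
  have i2 := hk.integrable_mul hk
  have key := re_integral_eq (hF.mem'.integrable_mul hu₁.star.mem)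
    (integrable_add (i1.const_mul ((d + e) / 2 : ℂ)) (i2.const_mul (Complex.I * c)))
    (((hρ.tot hσ).const_mul (d / 2 : ℂ)).add
      (((hu.mul hu₁.star).tot (hu.mul hu₁.star)).const_mul (e / 2 : ℂ))) fun x => by
    simp only [nl₁, map_add, map_mul, map_div₀, Complex.conj_conj,
      Complex.conj_I, Complex.conj_ofReal, map_ofNat]
    ring
  rw [key, integral_add (i1.const_mul _) (i2.const_mul _), integral_const_mul, integral_const_mul]
  have : ((d + e) / 2 : ℂ) = (((d + e) / 2 : ℝ) : ℂ) := by push_cast; ring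
  rw [this]
  simp only [Complex.add_re, Complex.mul_re, Complex.I_re, Complex.I_im,
    Complex.ofReal_re, Complex.ofReal_im, Complex.mul_im]
  ring

/-- The spatial part `p` of the time derivative `p + ∂ₓ q` of `u²`. -/
noncomputable def sqP (a b c d e : ℝ) (u u₁ u₂ : ℝ → ℂ) (x : ℝ) : ℂ :=
  (u x * (-(Complex.I * a * u₂ x) - nl c d e u u₁ x) - u₁ x * -(b * u₂ x)) +
    (u x * (-(Complex.I * a * u₂ x) - nl c d e u u₁ x) - u₁ x * -(b * u₂ x))

/-- The flux `q` in the time derivative `p + ∂ₓ q` of `u²`. -/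
noncomputable def sqQ (b : ℝ) (u u₂ : ℝ → ℂ) (x : ℝ) : ℂ :=
  u x * -(b * u₂ x) + u x * -(b * u₂ x)

lemma mem_sqP (hu : IsH1 u u₁) (hu₁ : IsH1 u₁ u₂) : L2fun (sqP a b c d e u u₁ u₂) := by
  have h := L2fun.sub' (hu.mul_mem (memp hu₁.mem' (isH1_nl hu hu₁ c d e).mem a))
    (hu₁.mul_mem (memq hu₁.mem' b))
  exact h.add' h

lemma mem_sqQ (hu : IsH1 u u₁) (hu₁ : IsH1 u₁ u₂) : L2fun (sqQ b u u₂) :=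
  (hu.mul_mem (memq hu₁.mem' b)).add' (hu.mul_mem (memq hu₁.mem' b))

/-- Evolution of `∫ |u|⁴`. -/
lemma re_pairing_sq (hu : IsH1 u u₁) (hu₁ : IsH1 u₁ u₂) :
    (pairing (sqP a b c d e u u₁ u₂) (sqQ b u u₂) (fun x => conj (u x * u x))
      (fun x => conj (u₁ x * u x + u x * u₁ x))).re =
      -3 * b * (∫ x, (u₁ x * conj (u x) + u x * conj (u₁ x)) * (u₁ x * conj (u₁ x))).re +
      2 * a * (∫ x, u x * conj (u₁ x) * (u x * conj (u₁ x))).im := by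
  have hρ := hu.mul hu.star
  have hσ := hu₁.mul hu₁.star
  have i1 := (hρ.mem'.integrable_mul hσ.mem)
  have hk := hu.mul_mem hu₁.star.mem
  have i2 := hk.integrable_mul hk
  have hQ := (hu.mul hu).star
  rw [pairing_eq_integral (mem_sqP hu hu₁) (mem_sqQ hu hu₁) hQ.mem hQ.mem']
  have key := re_integral_eq
    (integrable_pairing (mem_sqP (a := a) (b := b) (c := c) (d := d) (e := e) hu hu₁)
      (mem_sqQ (b := b) hu hu₁) hQ.mem hQ.mem')
    (integrable_add (i1.const_mul (-3 * b : ℂ)) (i2.const_mul (-2 * (Complex.I * a))))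
    (((((hu.mul hu₁).tot hQ).const_mul (-2 * (Complex.I * a))).add
      (((hρ.mul hρ).tot hρ).const_mul (-((d + e) / 3) : ℂ))).add
      (((hρ.tot hσ).const_mul (2 * b : ℂ)).add
        (((hu.star.mul hu₁).tot (hu.star.mul hu₁)).const_mul (b : ℂ)))) fun x => by
    simp only [sqP, sqQ, nl, map_add, map_sub, map_mul, map_neg, map_div₀,
      Complex.conj_conj, Complex.conj_I, Complex.conj_ofReal, map_ofNat]
    ring
  rw [key, integral_add (i1.const_mul _) (i2.const_mul _), integral_const_mul, integral_const_mul]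
  simp

/-- The lower order part of the evolution of `Im ∫ γ ū²`, which contains no second derivative of `u`
and is at most quadratic in `u₁`. -/
noncomputable def resR (a b c d e : ℝ) (u u₁ γ g : ℝ → ℂ) (x : ℝ) : ℂ :=
  b * (-3 * (u₁ x * u₁ x * g x) - 2 * (u x * u₁ x * g x) + 3 * (conj (u₁ x) * conj (u₁ x) * γ x)
    - 2 * (conj (u x) * conj (u₁ x) * γ x)) +
  2 * (Complex.I * a) * (u₁ x * u₁ x * g x + u x * u₁ x * (g x - conj (u x * u x))
    - conj (u₁ x) * conj (u₁ x) * γ x - conj (u x) * conj (u₁ x) * (u x * u x - γ x)) -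
  2 * (u x * nl c d e u u₁ x * g x) - 2 * (conj (u x) * conj (nl c d e u u₁ x) * γ x)

lemma integrable_resR {γ γ' g g' : ℝ → ℂ} (hu : IsH1 u u₁) (hu₁ : IsH1 u₁ u₂) (hγ : IsH1 γ γ')
    (hg : IsH1 g g') : Integrable (resR a b c d e u u₁ γ g) volume := by
  have hF := isH1_nl hu hu₁ c d e
  have h1 := (hu₁.mul hu₁).mem.integrable_mul hg.mem
  have h2 := (hu.mul hu₁).mem.integrable_mul hg.mem
  have h3 := (hu₁.star.mul hu₁.star).mem.integrable_mul hγ.mem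
  have h4 := (hu.star.mul hu₁.star).mem.integrable_mul hγ.mem
  have h5 := (hu.mul hu₁).mem.integrable_mul (hg.sub (hu.mul hu).star).mem
  have h6 := (hu.star.mul hu₁.star).mem.integrable_mul ((hu.mul hu).sub hγ).mem
  have h7 := (hu.mul hF).mem.integrable_mul hg.mem
  have h8 := (hu.star.mul hF.star).mem.integrable_mul hγ.mem
  exact ((((((h1.const_mul (-3 : ℂ)).sub (h2.const_mul (2 : ℂ))).add (h3.const_mul (3 : ℂ))).sub
    (h4.const_mul (2 : ℂ))).const_mul (b : ℂ)).add
    ((((h1.add h5).sub h3).sub h6).const_mul (2 * (Complex.I * a)))).sub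
    (h7.const_mul (2 : ℂ)) |>.sub (h8.const_mul (2 : ℂ))

/-- Evolution of `Im ∫ γ ū²`, where `γ` and `g` are the images of `u²` and `ū²` by the resolvents
`(1 + ∂ₓ)⁻¹` and `(1 - ∂ₓ)⁻¹`. The two pairings are the derivatives of the factors `u²` and `ū²`; the
leading term comes from the dispersion of third order, and it is present as `b ≠ 0`. -/
lemma im_pairing_resolvent {γ g : ℝ → ℂ} (hu : IsH1 u u₁) (hu₁ : IsH1 u₁ u₂)
    (hγ : IsH1 γ (fun x => u x * u x - γ x)) (hg : IsH1 g (fun x => g x - conj (u x * u x))) :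
    (pairing (sqP a b c d e u u₁ u₂) (sqQ b u u₂) g (fun x => g x - conj (u x * u x)) +
      pairing (fun x => conj (sqP a b c d e u u₁ u₂ x)) (fun x => conj (sqQ b u u₂ x)) γ
        (fun x => u x * u x - γ x)).im =
      -6 * b * (∫ x, u x * conj (u₁ x) * (u x * conj (u₁ x))).im +
        (∫ x, resR a b c d e u u₁ γ g x).im := by
  have hk := hu.mul_mem hu₁.star.mem
  have i2 := hk.integrable_mul hk
  have hQ := (hu.mul hu)
  have hP := mem_sqP (a := a) (b := b) (c := c) (d := d) (e := e) hu hu₁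
  have hP' := mem_sqQ (b := b) hu hu₁
  have iR := integrable_resR (a := a) (b := b) (c := c) (d := d) (e := e) hu hu₁ hγ hg
  rw [pairing_eq_integral hP hP' hg.mem hg.mem', pairing_eq_integral hP.star hP'.star hγ.mem
    hγ.mem', ← integral_add (integrable_pairing hP hP' hg.mem hg.mem')
    (integrable_pairing hP.star hP'.star hγ.mem hγ.mem')]
  have key := im_integral_eq
    (integrable_add (integrable_pairing hP hP' hg.mem hg.mem')
      (integrable_pairing hP.star hP'.star hγ.mem hγ.mem'))
    (integrable_add (i2.const_mul (-6 * b : ℂ)) iR)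
    (((((((((hg.mul hu).tot hu₁).const_mul (-2 * (Complex.I * a))).add
      ((((hγ.mul hu.star).tot hu₁.star).const_mul (2 * (Complex.I * a))))).add
      ((((hg.mul hu).tot hu₁).const_mul (2 * b : ℂ)))).add
      ((((hg.mul hu₁).tot hu₁).const_mul (b : ℂ)))).add
      ((((hγ.mul hu.star).tot hu₁.star).const_mul (-2 * b : ℂ)))).add
      ((((hγ.mul hu₁.star).tot hu₁.star).const_mul (b : ℂ)))).add
      ((((hQ.mul hu.star).tot hu₁.star).const_mul (4 * b : ℂ)))) fun x => by
    simp only [sqP, sqQ, resR, nl, map_add, map_sub, map_mul, map_neg,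
      Complex.conj_conj, Complex.conj_I, Complex.conj_ofReal, map_ofNat]
    ring
  refine key.trans ?_
  rw [integral_add (i2.const_mul _) iR, integral_const_mul]
  simp

end

end

section

/-! ### Identities for the second order energy -/

section

variable {u u₁ u₂ w w₁ w₂ f : ℝ → ℂ} {a b c d e α β : ℝ}

/-- The function `K` such that `-2 Re ∫ K conj(u₂)` is the derivative of `∫ |u₂|²`. -/
noncomputable def leadK (c d e : ℝ) (u u₁ u₂ : ℝ → ℂ) (x : ℝ) : ℂ :=
  Complex.I * c * ((((u₂ x * conj (u x) + u₁ x * conj (u₁ x)) +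
      (u₁ x * conj (u₁ x) + u x * conj (u₂ x))) * u x +
      (u₁ x * conj (u x) + u x * conj (u₁ x)) * u₁ x) +
      ((u₁ x * conj (u x) + u x * conj (u₁ x)) * u₁ x + u x * conj (u x) * u₂ x)) +
    d * (((u₂ x * conj (u x) + u₁ x * conj (u₁ x)) +
      (u₁ x * conj (u₁ x) + u x * conj (u₂ x))) * u₁ x +
      2 * ((u₁ x * conj (u x) + u x * conj (u₁ x)) * u₂ x) -
      (1 / 2) * ((u₁ x * conj (u x) + u x * conj (u₁ x)) * u₂ x)) +
    e * (((u₂ x * u x + u₁ x * u₁ x) + (u₁ x * u₁ x + u x * u₂ x)) * conj (u₁ x) +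
      2 * ((u₁ x * u x + u x * u₁ x) * conj (u₂ x)) -
      (1 / 2) * ((u₁ x * u x + u x * u₁ x) * conj (u₂ x)))

/-- The analogue of `leadK` for second difference quotients in place of second derivatives. -/
noncomputable def dqK (c d e h : ℝ) (u u₁ : ℝ → ℂ) (x : ℝ) : ℂ :=
  Complex.I * c * dq h (dq h (fun x => u x * conj (u x) * u x)) x +
    d * (dq h (dq h (fun x => u x * conj (u x))) x * u₁ (x + h + h) +
      2 * (dq h (fun x => u x * conj (u x)) x * dq h u₁ (x + h)) -
      (1 / 2) * ((u₁ x * conj (u x) + u x * conj (u₁ x)) * dq h (dq h u) x)) +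
    e * (dq h (dq h (fun x => u x * u x)) x * conj (u₁ (x + h + h)) +
      2 * (dq h (fun x => u x * u x) x * conj (dq h u₁ (x + h))) -
      (1 / 2) * ((u₁ x * u x + u x * u₁ x) * conj (dq h (dq h u) x)))

/-- Leibniz formula for second difference quotients. -/
lemma dq_dq_mul (h : ℝ) (f g : ℝ → ℂ) (x : ℝ) :
    dq h (dq h (fun x => f x * g x)) x = dq h (dq h f) x * g (x + h + h) +
      2 * (dq h f x * dq h g (x + h)) + f x * dq h (dq h g) x := by
  simp only [dq]; ring

lemma L2fun.dqK (hu : IsH1 u u₁) (hu₁ : IsH1 u₁ u₂) (c d e h : ℝ) :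
    L2fun (dqK c d e h u u₁) := by
  have hρ := hu.mul hu.star
  have hQ := hu.mul hu
  have t1 := (hu₁.comp_add h).comp_add h
  have t2 := hu₁.star.comp_add h |>.comp_add h
  have k1 := ((hρ.mul hu).mem.dq h).dq h
  have k2 := t1.mem_mul ((hρ.mem.dq h).dq h)
  have k3 := (hρ.dq h).mul_mem ((hu₁.mem.dq h).comp_add h)
  have k4 := ((hu₁.mul hu.star).add (hu.mul hu₁.star)).mul_mem ((hu.mem.dq h).dq h)
  have k5 := t2.mem_mul ((hQ.mem.dq h).dq h)
  have k6 := (hQ.dq h).mul_mem ((hu₁.mem.dq h).comp_add h).star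
  have k7 := ((hu₁.mul hu).add (hu.mul hu₁)).mul_mem ((hu.mem.dq h).dq h).star
  exact ((k1.cmul (Complex.I * c)).add'
    (((k2.add' (k3.cmul 2)).sub' (k4.cmul (1 / 2))).cmul (d : ℂ))).add'
    (((k5.add' (k6.cmul 2)).sub' (k7.cmul (1 / 2))).cmul (e : ℂ))

/-- The terms of highest order in the second difference quotients of the nonlinearity are removed
by an integration by parts. -/
lemma re_integral_dq_dq_nl (hu : IsH1 u u₁) (hu₁ : IsH1 u₁ u₂) (c d e h : ℝ) :
    (∫ x, dq h (dq h (nl c d e u u₁)) x * conj (dq h (dq h u) x)).re =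
      (∫ x, dqK c d e h u u₁ x * conj (dq h (dq h u) x)).re := by
  have hρ := hu.mul hu.star
  have hQ := hu.mul hu
  have hF := isH1_nl hu hu₁ c d e
  have hz := (hu.dq h).dq h
  have hN : ∀ x, dq h (dq h (nl c d e u u₁)) x =
      Complex.I * c * dq h (dq h (fun x => u x * conj (u x) * u x)) x +
      d * dq h (dq h (fun x => u x * conj (u x) * u₁ x)) x +
      e * dq h (dq h (fun x => u x * u x * conj (u₁ x))) x := by
    intro x
    simp only [dq, nl]; ring
  refine re_integral_eq (((hF.mem.dq h).dq h).integrable_mul hz.star.mem)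
    ((L2fun.dqK hu hu₁ c d e h).integrable_mul hz.star.mem)
    ((((hρ.mul hz).tot hz.star).const_mul (d / 2 : ℂ)).add
      (((hQ.mul hz.star).tot hz.star).const_mul (e / 2 : ℂ))) fun x => ?_
  rw [hN, dq_dq_mul h (fun x => u x * conj (u x)) u₁,
    dq_dq_mul h (fun x => u x * u x) (fun x => conj (u₁ x))]
  have s1 : ∀ x, dq h (fun x => conj (u₁ x)) x = conj (dq h u₁ x) := dq_star h u₁
  have s2 : dq h (dq h (fun x => conj (u₁ x))) x = conj (dq h (dq h u₁) x) := by
    rw [← dq_star h (dq h u₁)]; congr 1; funext y; exact s1 y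
  rw [s1, s2, dqK]
  simp only [map_add, map_sub, map_mul, map_div₀, Complex.conj_conj, Complex.conj_I,
    Complex.conj_ofReal, map_ofNat, map_one]
  ring

/-- The factor `α u w̄ + β ū w`, which is the conjugate of the gradient of the corrector. -/
noncomputable def corrK (α β : ℝ) (u w : ℝ → ℂ) (x : ℝ) : ℂ :=
  α * (u x * conj (w x)) + β * (conj (u x) * w x)

/-- The derivative of `corrK`. -/
noncomputable def corrK₁ (α β : ℝ) (u u₁ w w₁ : ℝ → ℂ) (x : ℝ) : ℂ :=
  α * (u₁ x * conj (w x) + u x * conj (w₁ x)) + β * (conj (u₁ x) * w x + conj (u x) * w₁ x)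

lemma isH1_corrK (hu : IsH1 u u₁) (hw : IsH1 w w₁) (α β : ℝ) :
    IsH1 (corrK α β u w) (corrK₁ α β u u₁ w w₁) :=
  ((hu.mul hw.star).const_mul (α : ℂ)).add ((hu.star.mul hw).const_mul (β : ℂ))

/-- The factor of `w₁` in the evolution of the corrector. -/
noncomputable def corrX (a b α β : ℝ) (u u₁ u₂ w w₁ : ℝ → ℂ) (x : ℝ) : ℂ :=
  -(b / 2) * (α * ((u₁ x * conj (u x) + u x * conj (u₁ x)) * conj (w₁ x)) +
    β * ((conj (u₁ x) * conj (u x) + conj (u x) * conj (u₁ x)) * w₁ x)) -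
  b * (α * (((u₂ x * conj (u x) + u₁ x * conj (u₁ x)) +
      (u₁ x * conj (u₁ x) + u x * conj (u₂ x))) * conj (w x) +
      (u₁ x * conj (u x) + u x * conj (u₁ x)) * conj (w₁ x)) +
    β * (((conj (u₂ x) * conj (u x) + conj (u₁ x) * conj (u₁ x)) +
      (conj (u₁ x) * conj (u₁ x) + conj (u x) * conj (u₂ x))) * w x +
      (conj (u₁ x) * conj (u x) + conj (u x) * conj (u₁ x)) * w₁ x)) +
  Complex.I * a * (α * ((u₁ x * conj (u x) + u x * conj (u₁ x)) * conj (w x) +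
      u x * conj (u x) * conj (w₁ x)) +
    β * ((conj (u₁ x) * conj (u x) + conj (u x) * conj (u₁ x)) * w x +
      conj (u x) * conj (u x) * w₁ x))

/-- The factor of `conj u₂` in the evolution of the corrector. -/
noncomputable def corrY (a b α β : ℝ) (u u₁ w w₁ : ℝ → ℂ) (x : ℝ) : ℂ :=
  b * (w₁ x * corrK α β u w x + w x * corrK₁ α β u u₁ w w₁ x) +
    Complex.I * a * (w x * corrK α β u w x)

lemma L2fun.corrX (hu : IsH1 u u₁) (hu₁ : IsH1 u₁ u₂) (hw : IsH1 w w₁) (a b α β : ℝ) :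
    L2fun (corrX a b α β u u₁ u₂ w w₁) := by
  have hρ := hu.mul hu.star
  have hQ := hu.star.mul hu.star
  have hρ₁ := (hu₁.mul hu.star).add (hu.mul hu₁.star)
  have hQ₁ := (hu₁.star.mul hu.star).add (hu.star.mul hu₁.star)
  exact ((((((hρ₁.mul_mem hw.mem'.star).cmul (α : ℂ)).add' ((hQ₁.mul_mem hw.mem').cmul (β : ℂ))).cmul
    (-(b / 2 : ℂ)))).sub' ((((hρ₁.mul hw.star).mem'.cmul (α : ℂ)).add'
      ((hQ₁.mul hw).mem'.cmul (β : ℂ))).cmul (b : ℂ))).add'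
    ((((hρ.mul hw.star).mem'.cmul (α : ℂ)).add'
      ((hQ.mul hw).mem'.cmul (β : ℂ))).cmul (Complex.I * a))

lemma L2fun.corrY (hu : IsH1 u u₁) (hw : IsH1 w w₁) (a b α β : ℝ) :
    L2fun (corrY a b α β u u₁ w w₁) := by
  have hk := hw.mul (isH1_corrK hu hw α β)
  exact (hk.mem'.cmul (b : ℂ)).add' (hk.mem.cmul (Complex.I * a))

/-- The density whose integral has as real part half of the time derivative of the corrector
`Re ∫ (α |ū w|² + β (ū w)²)`. -/
noncomputable def corrPsi (a b c d e α β : ℝ) (u u₁ u₂ w w₁ f : ℝ → ℂ) (x : ℝ) : ℂ :=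
  w₁ x * corrX a b α β u u₁ u₂ w w₁ x + conj (u₂ x) * corrY a b α β u u₁ w w₁ x -
    (conj (u x) * f x + w x * conj (nl c d e u u₁ x)) * corrK α β u w x

lemma integrable_corrPsi (hu : IsH1 u u₁) (hu₁ : IsH1 u₁ u₂) (hw : IsH1 w w₁) (hf : L2fun f)
    (a b c d e α β : ℝ) : Integrable (corrPsi a b c d e α β u u₁ u₂ w w₁ f) volume := by
  exact integrable_sub (integrable_add (hw.mem'.integrable_mul (L2fun.corrX hu hu₁ hw a b α β))
    (hu₁.mem'.star.integrable_mul (L2fun.corrY hu hw a b α β)))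
    (((hu.star.mul_mem hf).add' (hw.mul_mem (isH1_nl hu hu₁ c d e).star.mem)).integrable_mul
      (isH1_corrK hu hw α β).mem)

/-- Evolution of the corrector; `w` stands for a difference quotient of `u`, and `f` for the
corresponding difference quotient of the nonlinearity. -/
lemma re_pairing_corr (hu : IsH1 u u₁) (hu₁ : IsH1 u₁ u₂) (hw : IsH1 w w₁) (hw₁ : IsH1 w₁ w₂)
    (hf : L2fun f) :
    (pairing (fun x => (conj (u x) * (-(Complex.I * a * w₂ x) - f x) - conj (u₁ x) * -(b * w₂ x)) +
        (w x * conj (-(Complex.I * a * u₂ x) - nl c d e u u₁ x) - w₁ x * conj (-(b * u₂ x))))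
      (fun x => conj (u x) * -(b * w₂ x) + w x * conj (-(b * u₂ x)))
      (corrK α β u w) (corrK₁ α β u u₁ w w₁)).re =
      (∫ x, corrPsi a b c d e α β u u₁ u₂ w w₁ f x).re := by
  have hk := isH1_corrK hu hw α β
  have hρ := hu.mul hu.star
  have hQ := hu.star.mul hu.star
  have hρ₁ := (hu₁.mul hu.star).add (hu.mul hu₁.star)
  have hQ₁ := (hu₁.star.mul hu.star).add (hu.star.mul hu₁.star)
  have hF := isH1_nl hu hu₁ c d e
  have hP := ((hu.star.mul_mem (memp hw₁.mem' hf a)).sub'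
    (hu₁.star.mul_mem (memq hw₁.mem' b))).add' ((hw.mul_mem (memp hu₁.mem' hF.mem a).star).sub'
    (hw₁.mul_mem (memq hu₁.mem' b).star))
  have hP' := (hu.star.mul_mem (memq hw₁.mem' b)).add' (hw.mul_mem (memq hu₁.mem' b).star)
  have hm := ((hρ.mul hw.star).const_mul (α : ℂ)).add ((hQ.mul hw).const_mul (β : ℂ))
  have hn := ((hρ₁.mul hw.star).const_mul (α : ℂ)).add ((hQ₁.mul hw).const_mul (β : ℂ))
  rw [pairing_eq_integral hP hP' hk.mem hk.mem']
  refine re_integral_eq (integrable_pairing hP hP' hk.mem hk.mem')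
    (integrable_corrPsi hu hu₁ hw hf a b c d e α β)
    (((((hρ.mul hw₁).tot hw₁.star).const_mul (b / 2 * α : ℂ)).add
      (((hQ.mul hw₁).tot hw₁).const_mul (b / 2 * β : ℂ))).add
      (((hw₁.tot hn).const_mul (b : ℂ)).add ((hw₁.tot hm).const_mul (-(Complex.I * a)))))
    fun x => ?_
  simp only [corrPsi, corrX, corrY, corrK, corrK₁, nl, map_add, map_sub, map_mul, map_neg,
    map_div₀, Complex.conj_conj, Complex.conj_I, Complex.conj_ofReal, map_ofNat]
  ring

/-- The terms of lower order in the evolution of the corrected second order energy. -/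
noncomputable def lowK (a c d e α β : ℝ) (u u₁ u₂ : ℝ → ℂ) (x : ℝ) : ℂ :=
  Complex.I * c * ((((u₂ x * conj (u x) + u₁ x * conj (u₁ x)) +
      (u₁ x * conj (u₁ x) + u x * conj (u₂ x))) * u x +
      (u₁ x * conj (u x) + u x * conj (u₁ x)) * u₁ x) +
      ((u₁ x * conj (u x) + u x * conj (u₁ x)) * u₁ x + u x * conj (u x) * u₂ x)) * conj (u₂ x) +
  Complex.I * a * u₂ x * (α * ((u₁ x * conj (u x) + u x * conj (u₁ x)) * conj (u₁ x) +
      u x * conj (u x) * conj (u₂ x)) +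
    β * (2 * (conj (u₁ x) * conj (u x)) * u₁ x + conj (u x) * conj (u x) * u₂ x)) +
  Complex.I * a * conj (u₂ x) * u₁ x * corrK α β u u₁ x -
  (conj (u x) * nl₁ c d e u u₁ u₂ x + u₁ x * conj (nl c d e u u₁ x)) * corrK α β u u₁ x

lemma L2fun.leadK (hu : IsH1 u u₁) (hu₁ : IsH1 u₁ u₂) (c d e : ℝ) :
    L2fun (leadK c d e u u₁ u₂) := by
  have hρ := hu.mul hu.star
  have hQ := hu.mul hu
  have hρ₁ := (hu₁.mul hu.star).add (hu.mul hu₁.star)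
  have hQ₁ := (hu₁.mul hu).add (hu.mul hu₁)
  have k1 := ((hρ₁.mul hu).add (hρ.mul hu₁)).mem'
  have k2 := hu₁.mem_mul hρ₁.mem'
  have k3 := hρ₁.mul_mem hu₁.mem'
  have k4 := hu₁.star.mem_mul hQ₁.mem'
  have k5 := hQ₁.mul_mem hu₁.mem'.star
  exact ((k1.cmul (Complex.I * c)).add'
    (((k2.add' (k3.cmul 2)).sub' (k3.cmul (1 / 2))).cmul (d : ℂ))).add'
    (((k4.add' (k5.cmul 2)).sub' (k5.cmul (1 / 2))).cmul (e : ℂ))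

lemma integrable_lowK (hu : IsH1 u u₁) (hu₁ : IsH1 u₁ u₂) (a c d e α β : ℝ) :
    Integrable (lowK a c d e α β u u₁ u₂) volume := by
  have hρ := hu.mul hu.star
  have hQ := hu.star.mul hu.star
  have hρ₁ := (hu₁.mul hu.star).add (hu.mul hu₁.star)
  have hk := isH1_corrK hu hu₁ α β
  have k1 := ((hρ₁.mul hu).add (hρ.mul hu₁)).mem'
  have k2 := ((hρ.mul hu₁.star).mem'.cmul (α : ℂ)).add'
    ((((((hu₁.star.mul hu.star).const_mul 2).mul_mem hu₁.mem)).add' (hQ.mul_mem hu₁.mem')).cmul (β : ℂ))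
  have hF := isH1_nl hu hu₁ c d e
  exact integrable_sub (integrable_add (integrable_add
    ((k1.cmul (Complex.I * c)).integrable_mul hu₁.mem'.star)
    ((hu₁.mem'.cmul (Complex.I * a)).integrable_mul k2))
    ((hu₁.mem_mul (hu₁.mem'.star.cmul (Complex.I * a))).integrable_mul hk.mem))
    (((hu.star.mul_mem hF.mem').add' (hu₁.mul_mem hF.star.mem)).integrable_mul hk.mem)

/-- For the right choice of the coefficients of the corrector, the terms quadratic in `u₂` with a
factor `u u₁` cancel, up to the total derivative of a multiple of `|u₁|⁴`. -/
lemma re_integral_leadK (hu : IsH1 u u₁) (hu₁ : IsH1 u₁ u₂) (hα : 3 * b * α = 4 * d + 2 * e)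
    (hβ : 3 * b * β = d + 3 * e) :
    (∫ x, leadK c d e u u₁ u₂ x * conj (u₂ x)).re +
      (∫ x, corrPsi a b c d e α β u u₁ u₂ u₁ u₂ (nl₁ c d e u u₁ u₂) x).re =
      (∫ x, lowK a c d e α β u u₁ u₂ x).re := by
  have hσ := hu₁.mul hu₁.star
  have hF := isH1_nl hu hu₁ c d e
  have i1 := (L2fun.leadK hu hu₁ c d e).integrable_mul hu₁.mem'.star
  have i2 := integrable_corrPsi hu hu₁ hu₁ hF.mem' a b c d e α β
  rw [← Complex.add_re, ← integral_add i1 i2]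
  refine re_integral_eq (integrable_add i1 i2) (integrable_lowK hu hu₁ a c d e α β)
    ((hσ.tot hσ).const_mul (b * (α + β) / 20 : ℂ)) fun x => ?_
  -- the identity is polynomial once `d` and `e` are expressed through `α` and `β`
  obtain rfl : e = (12 * b * β - 3 * b * α) / 10 := by linarith
  obtain rfl : d = 3 * b * β - 3 * ((12 * b * β - 3 * b * α) / 10) := by linarith
  simp only [leadK, corrPsi, corrX, corrY, corrK, corrK₁, lowK, nl, nl₁, Complex.ofReal_div,
    Complex.ofReal_sub, Complex.ofReal_mul, Complex.ofReal_ofNat, map_add, map_sub, map_mul,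
    map_neg, map_one, map_div₀, Complex.conj_conj, Complex.conj_I, Complex.conj_ofReal, map_ofNat]
  ring

lemma norm_nl_le {N p : ℝ} {x : ℝ} (h0 : ‖u x‖ ≤ N) (h1 : ‖u₁ x‖ ≤ p) :
    ‖nl c d e u u₁ x‖ ≤ |c| * N ^ 3 + (|d| + |e|) * (N ^ 2 * p) := by
  have h0' : ‖conj (u x)‖ ≤ N := by simpa using h0
  have h1' : ‖conj (u₁ x)‖ ≤ p := by simpa using h1
  have hc : ‖Complex.I * (c : ℂ)‖ ≤ |c| := by simp
  have hd : ‖(d : ℂ)‖ ≤ |d| := by simp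
  have he : ‖(e : ℂ)‖ ≤ |e| := by simp
  refine (norm_add_le_of_le (norm_add_le_of_le
    (norm_mul_le_of_le hc (norm_mul_le_of_le (norm_mul_le_of_le h0 h0') h0))
    (norm_mul_le_of_le hd (norm_mul_le_of_le (norm_mul_le_of_le h0 h0') h1)))
    (norm_mul_le_of_le he (norm_mul_le_of_le (norm_mul_le_of_le h0 h0) h1'))).trans
    (le_of_eq (by ring))

lemma norm_nl₁_le {N p q : ℝ} {x : ℝ} (h0 : ‖u x‖ ≤ N) (h1 : ‖u₁ x‖ ≤ p) (h2 : ‖u₂ x‖ ≤ q) :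
    ‖nl₁ c d e u u₁ u₂ x‖ ≤ |c| * (3 * N ^ 2 * p) + (|d| + |e|) * (2 * N * p ^ 2 + N ^ 2 * q) := by
  have h0' : ‖conj (u x)‖ ≤ N := by simpa using h0
  have h1' : ‖conj (u₁ x)‖ ≤ p := by simpa using h1
  have h2' : ‖conj (u₂ x)‖ ≤ q := by simpa using h2
  have hc : ‖Complex.I * (c : ℂ)‖ ≤ |c| := by simp
  have hd : ‖(d : ℂ)‖ ≤ |d| := by simp
  have he : ‖(e : ℂ)‖ ≤ |e| := by simp
  have hρ₁ := norm_add_le_of_le (norm_mul_le_of_le h1 h0') (norm_mul_le_of_le h0 h1')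
  have hQ₁ := norm_add_le_of_le (norm_mul_le_of_le h1 h0) (norm_mul_le_of_le h0 h1)
  refine (norm_add_le_of_le (norm_add_le_of_le
    (norm_mul_le_of_le hc (norm_add_le_of_le (norm_mul_le_of_le hρ₁ h0)
      (norm_mul_le_of_le (norm_mul_le_of_le h0 h0') h1)))
    (norm_mul_le_of_le hd (norm_add_le_of_le (norm_mul_le_of_le hρ₁ h1)
      (norm_mul_le_of_le (norm_mul_le_of_le h0 h0') h2))))
    (norm_mul_le_of_le he (norm_add_le_of_le (norm_mul_le_of_le hQ₁ h1')
      (norm_mul_le_of_le (norm_mul_le_of_le h0 h0) h2')))).trans (le_of_eq (by ring))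

lemma norm_corrK_le {N p : ℝ} {x : ℝ} (h0 : ‖u x‖ ≤ N) (h1 : ‖w x‖ ≤ p) :
    ‖corrK α β u w x‖ ≤ (|α| + |β|) * (N * p) := by
  have h0' : ‖conj (u x)‖ ≤ N := by simpa using h0
  have h1' : ‖conj (w x)‖ ≤ p := by simpa using h1
  have hd : ‖(α : ℂ)‖ ≤ |α| := by simp
  have he : ‖(β : ℂ)‖ ≤ |β| := by simp
  exact (norm_add_le_of_le (norm_mul_le_of_le hd (norm_mul_le_of_le h0 h1'))
    (norm_mul_le_of_le he (norm_mul_le_of_le h0' h1))).trans (le_of_eq (by ring))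

/-- The constant in the bound of the lower order terms `lowK`. -/
noncomputable def lowC (a c d e α β S : ℝ) : ℝ :=
  |c| * (3 * S ^ 2 + 3 * S) + |a| * (|α| + |β|) * (2 * S + S ^ 2) +
    (|α| + |β|) * (4 * |c| * S ^ 4 + (|d| + |e|) * (3 * S ^ 3 + S ^ 4))

/-- The lower order terms have at most two factors `u₂`, and those of degree one in `u₂` are
controlled by Young's inequality. -/
lemma norm_lowK_le {S : ℝ} {x : ℝ} (h0 : ‖u x‖ ≤ S) :
    ‖lowK a c d e α β u u₁ u₂ x‖ ≤
      lowC a c d e α β S * (‖u₂ x‖ ^ 2 + ‖u₁ x‖ ^ 2 + ‖u₁ x‖ ^ 4) := by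
  have hS : 0 ≤ S := (norm_nonneg _).trans h0
  set p := ‖u₁ x‖ with hp
  set q := ‖u₂ x‖ with hq
  have h1 : ‖u₁ x‖ ≤ p := le_rfl
  have h2 : ‖u₂ x‖ ≤ q := le_rfl
  have p0 : 0 ≤ p := norm_nonneg _
  have q0 : 0 ≤ q := norm_nonneg _
  have h0' : ‖conj (u x)‖ ≤ S := by simpa using h0
  have h1' : ‖conj (u₁ x)‖ ≤ p := by simpa using h1
  have h2' : ‖conj (u₂ x)‖ ≤ q := by simpa using h2
  have hc : ‖Complex.I * (c : ℂ)‖ ≤ |c| := by simp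
  have ha : ‖Complex.I * (a : ℂ)‖ ≤ |a| := by simp
  have hα : ‖(α : ℂ)‖ ≤ |α| := by simp
  have hβ : ‖(β : ℂ)‖ ≤ |β| := by simp
  have htwo : ‖(2 : ℂ)‖ ≤ 2 := by simp
  have hρ := norm_mul_le_of_le h0 h0'
  have hρ₁ := norm_add_le_of_le (norm_mul_le_of_le h1 h0') (norm_mul_le_of_le h0 h1')
  have hσ := norm_mul_le_of_le h1 h1'
  have hρ₂ := norm_add_le_of_le (norm_add_le_of_le (norm_mul_le_of_le h2 h0') hσ)
    (norm_add_le_of_le hσ (norm_mul_le_of_le h0 h2'))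
  have hk : ‖corrK α β u u₁ x‖ ≤ _ := norm_corrK_le h0 h1
  have hF : ‖conj (nl c d e u u₁ x)‖ ≤ |c| * S ^ 3 + (|d| + |e|) * (S ^ 2 * p) := by
    rw [Complex.norm_conj]; exact norm_nl_le h0 h1
  have hF₁ : ‖nl₁ c d e u u₁ u₂ x‖ ≤ _ := norm_nl₁_le h0 h1 h2
  have t1 := norm_mul_le_of_le (norm_mul_le_of_le hc (norm_add_le_of_le (norm_add_le_of_le
    (norm_mul_le_of_le hρ₂ h0) (norm_mul_le_of_le hρ₁ h1)) (norm_add_le_of_le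
    (norm_mul_le_of_le hρ₁ h1) (norm_mul_le_of_le hρ h2)))) h2'
  have t2 := norm_mul_le_of_le (norm_mul_le_of_le ha h2) (norm_add_le_of_le
    (norm_mul_le_of_le hα (norm_add_le_of_le (norm_mul_le_of_le hρ₁ h1')
      (norm_mul_le_of_le hρ h2')))
    (norm_mul_le_of_le hβ (norm_add_le_of_le (norm_mul_le_of_le (norm_mul_le_of_le htwo
      (norm_mul_le_of_le h1' h0')) h1) (norm_mul_le_of_le (norm_mul_le_of_le h0' h0') h2))))
  have t3 := norm_mul_le_of_le (norm_mul_le_of_le (norm_mul_le_of_le ha h2') h1) hk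
  have t4 := norm_mul_le_of_le (norm_add_le_of_le (norm_mul_le_of_le h0' hF₁)
    (norm_mul_le_of_le h1 hF)) hk
  refine (norm_sub_le_of_le (norm_add_le_of_le (norm_add_le_of_le t1 t2) t3) t4).trans ?_
  have p4 : 0 ≤ p ^ 4 := by positivity
  have e1 : 2 * (p ^ 2 * q) ≤ q ^ 2 + p ^ 2 + p ^ 4 := by
    linarith [sq_nonneg p, show (p ^ 2 - q) ^ 2 = p ^ 4 - 2 * (p ^ 2 * q) + q ^ 2 by ring,
      sq_nonneg (p ^ 2 - q)]
  have e2 : q ^ 2 ≤ q ^ 2 + p ^ 2 + p ^ 4 := by linarith [sq_nonneg p]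
  have e3 : p ^ 2 ≤ q ^ 2 + p ^ 2 + p ^ 4 := by linarith [sq_nonneg q]
  have e4 : p * q ≤ q ^ 2 + p ^ 2 + p ^ 4 := by
    linarith [sq_nonneg p, sq_nonneg q, two_mul_le_add_sq p q]
  have e5 : p ^ 3 ≤ q ^ 2 + p ^ 2 + p ^ 4 := by
    linarith [sq_nonneg p, sq_nonneg q, show (p ^ 2 - p) ^ 2 = p ^ 4 - 2 * p ^ 3 + p ^ 2 by ring,
      sq_nonneg (p ^ 2 - p)]
  have W0 : 0 ≤ q ^ 2 + p ^ 2 + p ^ 4 := by positivity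
  generalize q ^ 2 + p ^ 2 + p ^ 4 = W at *
  have A0 : 0 ≤ |α| + |β| := by positivity
  have B0 : 0 ≤ |d| + |e| := by positivity
  have f1 := mul_le_mul_of_nonneg_left e1
    (show 0 ≤ |c| * (3 * S) + |a| * (|α| + |β|) * (3 / 2 * S) by positivity)
  have f2 := mul_le_mul_of_nonneg_left e2
    (show 0 ≤ |c| * (3 * S ^ 2) + |a| * (|α| + |β|) * S ^ 2 by positivity)
  have f3 := mul_le_mul_of_nonneg_left e3
    (show 0 ≤ (|α| + |β|) * (4 * |c| * S ^ 4) by positivity)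
  have f4 := mul_le_mul_of_nonneg_left e4
    (show 0 ≤ (|α| + |β|) * ((|d| + |e|) * S ^ 4) by positivity)
  have f5 := mul_le_mul_of_nonneg_left e5
    (show 0 ≤ (|α| + |β|) * ((|d| + |e|) * (3 * S ^ 3)) by positivity)
  have f6 : 0 ≤ |a| * (|α| + |β|) * (S / 2) * W := by positivity
  refine sub_nonneg.1 ((add_nonneg (add_nonneg (add_nonneg (add_nonneg (add_nonneg
    (sub_nonneg.2 f1) (sub_nonneg.2 f2)) (sub_nonneg.2 f3)) (sub_nonneg.2 f4)) (sub_nonneg.2 f5))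
    f6).trans_eq ?_)
  rw [lowC]
  ring

/-- Pointwise bound of the lower order terms of the first energy. The nonlinearity contributes a
term of degree three in `u` and one in `u₁`, which is where `‖u‖ ^ 6` comes from. -/
lemma norm_resR_le {γ g : ℝ → ℂ} {G x : ℝ} (hγ : ‖γ x‖ ≤ G) (hg : ‖g x‖ ≤ G) :
    ‖resR a b c d e u u₁ γ g x‖ ≤
      (8 * |b| * G + 2 * |a| * (3 * G + 1) + 4 * G * (|c| + (|d| + |e|))) *
        (‖u₁ x‖ ^ 2 + ‖u x‖ ^ 2 + ‖u x‖ ^ 6) := by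
  have hG : 0 ≤ G := (norm_nonneg _).trans hγ
  set N := ‖u x‖ with hN
  set p := ‖u₁ x‖ with hp
  have N0 : 0 ≤ N := norm_nonneg _
  have p0 : 0 ≤ p := norm_nonneg _
  have h0 : ‖u x‖ ≤ N := le_rfl
  have h1 : ‖u₁ x‖ ≤ p := le_rfl
  have h0' : ‖conj (u x)‖ ≤ N := by simp [hN]
  have h1' : ‖conj (u₁ x)‖ ≤ p := by simp [hp]
  have hb : ‖(b : ℂ)‖ ≤ |b| := by simp
  have ha : ‖Complex.I * (a : ℂ)‖ ≤ |a| := by simp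
  have two : ‖(2 : ℂ)‖ ≤ 2 := by simp
  have three : ‖(3 : ℂ)‖ ≤ 3 := by simp
  have three' : ‖(-3 : ℂ)‖ ≤ 3 := by simp
  have hF : ‖nl c d e u u₁ x‖ ≤ _ := norm_nl_le h0 h1
  have hF' : ‖conj (nl c d e u u₁ x)‖ ≤ |c| * N ^ 3 + (|d| + |e|) * (N ^ 2 * p) := by
    rw [Complex.norm_conj]; exact hF
  have hQ := norm_mul_le_of_le h0 h0
  have hQ' : ‖conj (u x * u x)‖ ≤ N * N := by rw [Complex.norm_conj]; exact hQ
  have k1 := norm_mul_le_of_le (norm_mul_le_of_le h1 h1) hg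
  have k2 := norm_mul_le_of_le (norm_mul_le_of_le h0 h1) hg
  have k3 := norm_mul_le_of_le (norm_mul_le_of_le h1' h1') hγ
  have k4 := norm_mul_le_of_le (norm_mul_le_of_le h0' h1') hγ
  have t1 := norm_mul_le_of_le hb (norm_sub_le_of_le (norm_add_le_of_le (norm_sub_le_of_le
    (norm_mul_le_of_le three' k1) (norm_mul_le_of_le two k2)) (norm_mul_le_of_le three k3))
    (norm_mul_le_of_le two k4))
  have t2 := norm_mul_le_of_le (norm_mul_le_of_le two ha) (norm_sub_le_of_le (norm_sub_le_of_le
    (norm_add_le_of_le k1 (norm_mul_le_of_le (norm_mul_le_of_le h0 h1)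
      (norm_sub_le_of_le hg hQ'))) k3) (norm_mul_le_of_le (norm_mul_le_of_le h0' h1')
      (norm_sub_le_of_le hQ hγ)))
  have t3 := norm_mul_le_of_le two (norm_mul_le_of_le (norm_mul_le_of_le h0 hF) hg)
  have t4 := norm_mul_le_of_le two (norm_mul_le_of_le (norm_mul_le_of_le h0' hF') hγ)
  refine (norm_sub_le_of_le (norm_sub_le_of_le (norm_add_le_of_le t1 t2) t3) t4).trans ?_
  have N6 : 0 ≤ N ^ 6 := by positivity
  have e1 : p ^ 2 ≤ p ^ 2 + N ^ 2 + N ^ 6 := by linarith [sq_nonneg N]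
  have e2 : 2 * (N * p) ≤ p ^ 2 + N ^ 2 + N ^ 6 := by linarith [two_mul_le_add_sq N p]
  have e3 : 2 * (N ^ 3 * p) ≤ p ^ 2 + N ^ 2 + N ^ 6 := by
    linarith [show (N ^ 3 - p) ^ 2 = N ^ 6 - 2 * (N ^ 3 * p) + p ^ 2 by ring,
      sq_nonneg (N ^ 3 - p), sq_nonneg N]
  have e4 : N ^ 4 ≤ p ^ 2 + N ^ 2 + N ^ 6 := by
    linarith [show (N ^ 3 - N) ^ 2 = N ^ 6 - 2 * N ^ 4 + N ^ 2 by ring,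
      sq_nonneg (N ^ 3 - N), sq_nonneg N, sq_nonneg p]
  have W0 : 0 ≤ p ^ 2 + N ^ 2 + N ^ 6 := by positivity
  generalize p ^ 2 + N ^ 2 + N ^ 6 = W at *
  have f1 := mul_le_mul_of_nonneg_left e1 (show 0 ≤ 6 * |b| * G + 4 * |a| * G by positivity)
  have f2 := mul_le_mul_of_nonneg_left e2 (show 0 ≤ 2 * |b| * G + 2 * |a| * G by positivity)
  have f3 := mul_le_mul_of_nonneg_left e3 (show 0 ≤ 2 * |a| + 2 * G * (|d| + |e|) by positivity)
  have f4 := mul_le_mul_of_nonneg_left e4 (show 0 ≤ 4 * G * |c| by positivity)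
  have f5 : 0 ≤ 2 * G * (|d| + |e|) * W := by positivity
  refine sub_nonneg.1 ((add_nonneg (add_nonneg (add_nonneg (add_nonneg (sub_nonneg.2 f1)
    (sub_nonneg.2 f2)) (sub_nonneg.2 f3)) (sub_nonneg.2 f4)) f5).trans_eq ?_)
  ring

end

end

section

/-! ### The resolvents of the derivative -/

section

variable {q r G g : ℝ → ℂ}

lemma IsAC.add_const {f f' : ℝ → ℂ} (hf : IsAC f f') (c : ℂ) : IsAC (fun x => f x + c) f' :=
  ⟨hf.intg, fun a b => by rw [hf.ftc]; ring⟩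

lemma IsAC.congr {f f' g' : ℝ → ℂ} (hf : IsAC f f') (h : ∀ x, f' x = g' x) : IsAC f g' := by
  rwa [← (funext h : f' = g')]

lemma IsAC.comp_neg {f f' : ℝ → ℂ} (hf : IsAC f f') : IsAC (fun x => f (-x)) (fun x => -f' (-x)) := by
  refine ⟨LocallyIntegrable.neg fun x => ?_, fun a b => ?_⟩
  · obtain ⟨s, hs, hi⟩ := hf.intg (-x)
    refine ⟨Neg.neg ⁻¹' s, continuous_neg.continuousAt hs, ?_⟩
    exact ((Measure.measurePreserving_neg volume).integrableOn_comp_preimage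
      (MeasurableEquiv.neg ℝ).measurableEmbedding).2 hi
  · rw [intervalIntegral.integral_neg, intervalIntegral.integral_comp_neg, hf.ftc]; ring

lemma L2fun.comp_neg {f : ℝ → ℂ} (hf : L2fun f) : L2fun (fun x => f (-x)) :=
  hf.comp_measurePreserving (Measure.measurePreserving_neg volume)

/-- If `G' = q - G` then `‖G‖ ≤ ‖q‖` in `L²`. -/
lemma nrm_le_of_resolvent (hq : L2fun q) (hG : IsH1 G (fun x => q x - G x)) : nrm G ≤ nrm q := by
  have h := hG.integral_add hG.star
  have i1 := hq.integrable_mul hG.mem.star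
  have i2 := hG.mem.integrable_mul hq.star
  have i3 := hG.mem.integrable_mul hG.mem.star
  have e : ∫ x, ((q x - G x) * conj (G x) + G x * conj (q x - G x)) =
      (∫ x, q x * conj (G x)) + (∫ x, G x * conj (q x)) - 2 * ∫ x, G x * conj (G x) := by
    rw [← integral_const_mul, ← integral_add i1 i2, ← integral_sub (integrable_add i1 i2) (i3.const_mul 2)]
    congr 1; funext x; simp only [map_sub]; ring
  rw [e] at h
  have e2 : ∫ x, G x * conj (G x) = ((nrm G ^ 2 : ℝ) : ℂ) := by
    rw [nrm_sq hG.mem, ← integral_complex_ofReal]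
    congr 1; funext x; rw [Complex.mul_conj, Complex.normSq_eq_norm_sq]
  rw [e2] at h
  have h1 := norm_integral_mul_le hq hG.mem.star
  have h2 := norm_integral_mul_le hG.mem hq.star
  rw [nrm_conj] at h1 h2
  have h3 : ‖(2 : ℂ) * ((nrm G ^ 2 : ℝ) : ℂ)‖ ≤ 2 * (nrm q * nrm G) := by
    rw [← sub_eq_zero.1 h]
    refine (norm_add_le _ _).trans (by linarith)
  rw [norm_mul, Complex.norm_real, Real.norm_of_nonneg (sq_nonneg _), Complex.norm_ofNat] at h3
  by_contra! hlt
  nlinarith [nrm_nonneg (f := q), nrm_nonneg (f := G)]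

/-- The resolvents of `∂ₓ` and `-∂ₓ` are transposes of each other. -/
lemma integral_resolvent_mul (hq : L2fun q) (hr : L2fun r) (hG : IsH1 G (fun x => q x - G x))
    (hg : IsH1 g (fun x => g x - r x)) : ∫ x, G x * r x = ∫ x, q x * g x := by
  have h := hG.integral_add hg
  have e : ∫ x, ((q x - G x) * g x + G x * (g x - r x)) =
      (∫ x, q x * g x) - ∫ x, G x * r x := by
    rw [← integral_sub (hq.integrable_mul hg.mem) (hG.mem.integrable_mul hr)]
    congr 1; funext x; ring
  rw [e] at h
  exact (sub_eq_zero.1 h).symm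

/-- Existence of the resolvent `(1 + ∂ₓ)⁻¹ q`, given by `∫_{t ≤ x} exp (t - x) q(t) dt`. -/
lemma exists_resolvent (hq : L2fun q) (hi : Integrable q volume) :
    ∃ G, IsH1 G (fun x => q x - G x) ∧ ∀ x, ‖G x‖ ≤ ∫ t, ‖q t‖ := by
  have hE : Continuous fun t : ℝ => (Real.exp t : ℂ) :=
    Complex.continuous_ofReal.comp Real.continuous_exp
  have hl : LocallyIntegrable (fun t => (Real.exp t : ℂ) * q t) volume :=
    hq.locallyIntegrable.continuous_mul hE
  have hon : ∀ x, IntegrableOn (fun t => (Real.exp t : ℂ) * q t) (Iic x) volume := by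
    intro x
    refine Integrable.mono' ((hi.norm.const_mul (Real.exp x)).integrableOn)
      (hl.aestronglyMeasurable.restrict) ?_
    filter_upwards [ae_restrict_mem measurableSet_Iic] with t ht
    rw [norm_mul, Complex.norm_real, Real.norm_of_nonneg (Real.exp_pos t).le]
    exact mul_le_mul_of_nonneg_right (Real.exp_le_exp.2 ht) (norm_nonneg _)
  set G : ℝ → ℂ := fun x => (Real.exp (-x) : ℂ) * ∫ t in Iic x, (Real.exp t : ℂ) * q t with hG
  have hb : ∀ x, ‖G x‖ ≤ ∫ t, ‖q t‖ := by
    intro x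
    have h1 : ‖∫ t in Iic x, (Real.exp t : ℂ) * q t‖ ≤ Real.exp x * ∫ t, ‖q t‖ := by
      refine (norm_integral_le_integral_norm _).trans ?_
      calc ∫ t in Iic x, ‖(Real.exp t : ℂ) * q t‖ ≤ ∫ t in Iic x, Real.exp x * ‖q t‖ := by
            refine integral_mono_ae (hon x).norm (hi.norm.const_mul _).integrableOn ?_
            filter_upwards [ae_restrict_mem measurableSet_Iic] with t ht
            rw [norm_mul, Complex.norm_real, Real.norm_of_nonneg (Real.exp_pos t).le]
            exact mul_le_mul_of_nonneg_right (Real.exp_le_exp.2 ht) (norm_nonneg _)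
        _ = Real.exp x * ∫ t in Iic x, ‖q t‖ := integral_const_mul _ _
        _ ≤ _ := mul_le_mul_of_nonneg_left (setIntegral_le_integral hi.norm
            (ae_of_all _ fun _ => norm_nonneg _)) (Real.exp_pos x).le
    rw [hG, norm_mul, Complex.norm_real, Real.norm_of_nonneg (Real.exp_pos _).le]
    refine (mul_le_mul_of_nonneg_left h1 (Real.exp_pos _).le).trans (le_of_eq ?_)
    rw [← mul_assoc, ← Real.exp_add, neg_add_cancel, Real.exp_zero, one_mul]
  have hI : IsAC (fun x => ∫ t in Iic x, (Real.exp t : ℂ) * q t)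
      (fun t => (Real.exp t : ℂ) * q t) := by
    have := (IsAC.primitive hl 0).add_const (∫ t in Iic 0, (Real.exp t : ℂ) * q t)
    convert this using 2 with x
    rw [← intervalIntegral.integral_Iic_sub_Iic (hon 0) (hon x)]; ring
  have hAC : IsAC G (fun x => q x - G x) := by
    have h1 : IsAC (fun x : ℝ => (Real.exp (-x) : ℂ)) (fun x => -(Real.exp (-x) : ℂ)) := by
      refine IsAC.of_hasDerivAt (fun x => ?_) (by fun_prop)
      have := (((hasDerivAt_id x).neg).exp).ofReal_comp
      simpa using this
    refine (h1.mul hI).congr fun x => ?_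
    have : (Real.exp (-x) : ℂ) * ((Real.exp x : ℂ) * q x) = q x := by
      rw [← mul_assoc, ← Complex.ofReal_mul, ← Real.exp_add, neg_add_cancel, Real.exp_zero]; simp
    rw [this, hG]; ring
  set M := ∫ t, ‖q t‖
  have hM : 0 ≤ M := integral_nonneg fun _ => norm_nonneg _
  have hGi : Integrable (fun x => ‖G x‖ ^ 2) volume := by
    refine integrable_of_intervalIntegral_norm_bounded (a := fun n : ℕ => -(n : ℝ))
      (b := fun n : ℕ => (n : ℝ)) (l := atTop) ((∫ x, ‖q x‖ ^ 2) + M ^ 2) (fun n => ?_) ?_ ?_ ?_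
    · exact ((hAC.continuous.norm.pow 2).integrableOn_Icc).mono_set Ioc_subset_Icc_self
    · exact tendsto_neg_atTop_atBot.comp tendsto_natCast_atTop_atTop
    · exact tendsto_natCast_atTop_atTop
    · refine Eventually.of_forall fun n => ?_
      have hn : -(n : ℝ) ≤ n := by linarith [(Nat.cast_nonneg n : (0 : ℝ) ≤ n)]
      have h2 := (hAC.mul hAC.star).ftc (-n) n
      have hq2 : Integrable (fun x => ‖q x‖ ^ 2) volume := hq.integrable_norm_pow (by norm_num)
      have i1 := (hAC.mul hAC.star).intervalIntegrable (-n) n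
      have h3 := congrArg Complex.re h2
      have h4 : (∫ x in (-(n : ℝ))..n, ((q x - G x) * conj (G x) + G x * conj (q x - G x))).re =
          ∫ x in (-(n : ℝ))..n, ((q x - G x) * conj (G x) + G x * conj (q x - G x)).re := by
        have := Complex.reCLM.intervalIntegral_comp_comm i1
        simpa using this.symm
      rw [h4, Complex.mul_conj, Complex.mul_conj, ← Complex.ofReal_sub, Complex.ofReal_re,
        Complex.normSq_eq_norm_sq, Complex.normSq_eq_norm_sq] at h3
      have i2 : IntervalIntegrable (fun x => ‖q x‖ ^ 2) volume (-(n : ℝ)) n :=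
        hq2.intervalIntegrable
      have i3 : IntervalIntegrable (fun x => ‖G x‖ ^ 2) volume (-(n : ℝ)) n :=
        (hAC.continuous.norm.pow 2).intervalIntegrable _ _
      have h5 : ∫ x in (-(n : ℝ))..n, ((q x - G x) * conj (G x) + G x * conj (q x - G x)).re ≤
          ∫ x in (-(n : ℝ))..n, (‖q x‖ ^ 2 - ‖G x‖ ^ 2) := by
        refine intervalIntegral.integral_mono_on hn ?_ (i2.sub i3) fun x _ => ?_
        · exact ⟨Complex.reCLM.integrable_comp i1.1, Complex.reCLM.integrable_comp i1.2⟩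
        · have e1 := Complex.sq_norm (q x)
          have e2 := Complex.sq_norm (G x)
          rw [Complex.normSq_apply] at e1 e2
          rw [e1, e2]
          simp
          nlinarith [sq_nonneg ((q x).re - (G x).re), sq_nonneg ((q x).im - (G x).im)]
      rw [intervalIntegral.integral_sub i2 i3] at h5
      have h6 : ∫ x in (-(n : ℝ))..n, ‖q x‖ ^ 2 ≤ ∫ x, ‖q x‖ ^ 2 := by
        rw [intervalIntegral.integral_of_le hn]
        exact setIntegral_le_integral hq2 (ae_of_all _ fun _ => sq_nonneg _)
      have h7 : ‖G (-n)‖ ^ 2 ≤ M ^ 2 := by gcongr; exact hb _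
      have h8 : 0 ≤ ‖G n‖ ^ 2 := sq_nonneg _
      simp only [norm_pow, norm_norm]
      linarith
  have hGm : L2fun G :=
    (memLp_two_iff_integrable_sq_norm hAC.continuous.aestronglyMeasurable).2 hGi
  exact ⟨G, ⟨hAC, hGm, hq.sub' hGm⟩, hb⟩

/-- Existence of the resolvent `(1 - ∂ₓ)⁻¹ q`. -/
lemma exists_resolvent_neg (hq : L2fun q) (hi : Integrable q volume) :
    ∃ g, IsH1 g (fun x => g x - q x) ∧ ∀ x, ‖g x‖ ≤ ∫ t, ‖q t‖ := by
  obtain ⟨G, hG, hb⟩ := exists_resolvent hq.comp_neg hi.comp_neg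
  refine ⟨fun x => G (-x), ⟨hG.ac.comp_neg.congr fun x => ?_, hG.mem.comp_neg,
    hG.mem.comp_neg.sub' hq⟩, fun x => (hb _).trans_eq ?_⟩
  · rw [neg_neg]; ring
  · exact integral_neg_eq_self (fun t => ‖q t‖) volume

/-- If `g' = g - q` then `‖g‖ ≤ ‖q‖` in `L²`. -/
lemma nrm_le_of_resolvent_neg (hq : L2fun q) (hg : IsH1 g (fun x => g x - q x)) :
    nrm g ≤ nrm q := by
  have hn : ∀ {f : ℝ → ℂ}, L2fun f → nrm (fun x => f (-x)) = nrm f := fun hf => by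
    unfold nrm
    rw [← eLpNorm_comp_measurePreserving hf.aestronglyMeasurable
      (Measure.measurePreserving_neg (volume : Measure ℝ))]
    rfl
  have := nrm_le_of_resolvent (G := fun x => g (-x)) hq.comp_neg
    ⟨hg.ac.comp_neg.congr fun x => by ring, hg.mem.comp_neg, hq.comp_neg.sub' hg.mem.comp_neg⟩
  rwa [hn hq, hn hg.mem] at this

/-- The resolvent is continuous from `L²` to `H¹`. -/
lemma H1T.resolvent_neg {ι : Type*} {l : Filter ι} {Q H : ι → ℝ → ℂ} (hQ : L2T l Q q)
    (hH : ∀ᶠ i in l, IsH1 (H i) (fun x => H i x - Q i x)) (hg : IsH1 g (fun x => g x - q x)) :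
    H1T l H (fun i x => H i x - Q i x) g (fun x => g x - q x) := by
  have h : L2T l H g := by
    refine L2T.of_le (hH.mono fun i hi => hi.mem) hg.mem hQ.tendsto ?_
    filter_upwards [hQ.mem, hH] with i h1 h2
    refine nrm_le_of_resolvent_neg (h1.sub' hQ.lim) ?_
    have := h2.sub hg
    refine ⟨this.ac.congr fun x => by ring, this.mem, this.mem.sub' (h1.sub' hQ.lim)⟩
  exact ⟨hH, hg, h, h.sub hQ⟩

end

end

section

/-! ### Evolution of the energies -/

section

variable {ι κ : Type*} {l : Filter ι} {m : Filter κ} {φ : κ → ι}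

lemma L2T.comp {F : ι → ℝ → ℂ} {f : ℝ → ℂ} (hF : L2T l F f) (hφ : Tendsto φ m l) :
    L2T m (fun i => F (φ i)) f :=
  ⟨hφ.eventually hF.mem, hF.lim, hF.tendsto.comp hφ⟩

lemma H1T.comp {F F' : ι → ℝ → ℂ} {f f' : ℝ → ℂ} (hF : H1T l F F' f f') (hφ : Tendsto φ m l) :
    H1T m (fun i => F (φ i)) (fun i => F' (φ i)) f f' :=
  ⟨hφ.eventually hF.isH1, hF.lim, hF.fst.comp hφ, hF.snd.comp hφ⟩

lemma H2T.comp {F F₁ F₂ : ι → ℝ → ℂ} {f f₁ f₂ : ℝ → ℂ} (hF : H2T l F F₁ F₂ f f₁ f₂)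
    (hφ : Tendsto φ m l) :
    H2T m (fun i => F (φ i)) (fun i => F₁ (φ i)) (fun i => F₂ (φ i)) f f₁ f₂ :=
  ⟨hF.fst.comp hφ, hF.snd.comp hφ⟩

lemma H2T.const {f f₁ f₂ : ℝ → ℂ} (h : IsH1 f f₁) (h₁ : IsH1 f₁ f₂) :
    H2T l (fun _ => f) (fun _ => f₁) (fun _ => f₂) f f₁ f₂ :=
  ⟨H1T.const h, H1T.const h₁⟩

/-- Difference quotients of a family converging in `H²` converge in `H¹`. -/
lemma H2T.dq {F F₁ F₂ : ι → ℝ → ℂ} {f f₁ f₂ : ℝ → ℂ} (hF : H2T l F F₁ F₂ f f₁ f₂) {k : ι → ℝ}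
    (hk : Tendsto k l (𝓝[≠] 0)) :
    H1T l (fun i => dq (k i) (F i)) (fun i => dq (k i) (F₁ i)) f₁ f₂ :=
  ⟨hF.fst.isH1.mono fun _ hi => hi.dq _, hF.snd.lim, hF.fst.dq hk, hF.snd.dq hk⟩

lemma H1T.weight {χ χ₁ : ℝ → ℝ} {M : ℝ} (h0 : ∀ x, HasDerivAt χ (χ₁ x) x) (hc : Continuous χ₁)
    (b0 : ∀ x, |χ x| ≤ M) (b1 : ∀ x, |χ₁ x| ≤ M) {F F' : ι → ℝ → ℂ} {f f' : ℝ → ℂ}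
    (hF : H1T l F F' f f') :
    H1T l (fun i x => χ x * F i x) (fun i x => χ₁ x * F i x + χ x * F' i x)
      (fun x => χ x * f x) (fun x => χ₁ x * f x + χ x * f' x) := by
  have hc0 : Continuous χ := continuous_iff_continuousAt.2 fun x => (h0 x).continuousAt
  have u : ∀ {θ : ℝ → ℝ}, Continuous θ → (∀ x, |θ x| ≤ M) →
      UT l (fun _ x => (θ x : ℂ)) (fun x => (θ x : ℂ)) := fun hθ hb =>
    ⟨Eventually.of_forall fun _ => Complex.continuous_ofReal.comp hθ,
      Complex.continuous_ofReal.comp hθ, ⟨M, fun x => by simpa using hb x⟩,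
      Metric.tendstoUniformly_iff.2 fun ε hε => by simp [hε]⟩
  exact ⟨hF.isH1.mono fun _ hi => hi.weight h0 hc b0 b1, hF.lim.weight h0 hc b0 b1,
    (u hc0 b0).mul_L2 hF.fst, ((u hc b1).mul_L2 hF.fst).add ((u hc0 b0).mul_L2 hF.snd)⟩

end

lemma hasDerivAt_re {y : ℝ → ℂ} {y' : ℂ} {s : ℝ} (h : HasDerivAt y y' s) :
    HasDerivAt (fun t => (y t).re) y'.re s :=
  Complex.reCLM.hasFDerivAt.comp_hasDerivAt s h

lemma hasDerivAt_im {y : ℝ → ℂ} {y' : ℂ} {s : ℝ} (h : HasDerivAt y y' s) :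
    HasDerivAt (fun t => (y t).im) y'.im s :=
  Complex.imCLM.hasFDerivAt.comp_hasDerivAt s h

lemma re_integral_self {f : ℝ → ℂ} (hf : L2fun f) : (∫ x, f x * conj (f x)).re = nrm f ^ 2 := by
  have : ∫ x, f x * conj (f x) = ((nrm f ^ 2 : ℝ) : ℂ) := by
    rw [nrm_sq hf, ← integral_complex_ofReal]
    congr 1; funext x; rw [Complex.mul_conj, Complex.normSq_eq_norm_sq]
  rw [this, Complex.ofReal_re]

/-- Differentiability of a limit of functions whose derivatives converge jointly in the parameter
and in time. This passes from difference quotients in space to derivatives. -/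
lemma hasDerivAt_of_tendsto_joint {l : Filter ℝ} [l.NeBot] {f f' : ℝ → ℝ → ℝ} {F : ℝ → ℝ} {y s : ℝ}
    (hd : ∀ᶠ t in 𝓝 s, ∀ h, HasDerivAt (f h) (f' h t) t)
    (hf' : Tendsto (fun p : ℝ × ℝ => f' p.1 p.2) (l ×ˢ 𝓝 s) (𝓝 y))
    (hf : ∀ᶠ t in 𝓝 s, Tendsto (fun h => f h t) l (𝓝 (F t))) : HasDerivAt F y s := by
  refine hasDerivAt_of_tendstoUniformlyOnFilter (l := l) (f := f) (f' := f') (g' := fun _ => y)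
    ?_ ?_ hf
  · intro v hv
    filter_upwards [hf'.eventually (UniformSpace.ball_mem_nhds y hv)] with p hp using hp
  · filter_upwards [hd.prod_inr l] with p hp using hp p.1

section

variable {a b c d e T s h : ℝ}

/-- The equation is preserved by taking difference quotients in space. -/
lemma WD.dq_eqn {v : ℝ → ℝ → ℂ} {v₂ g : ℝ → ℂ}
    (hv : WD v (fun x => -(Complex.I * a * v₂ x) - g x) (fun x => -(b * v₂ x)) s)
    (hm : ∀ᶠ t in 𝓝 s, L2fun (v t)) (h : ℝ) :
    WD (fun t => AirySchrodinger.dq h (v t))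
      (fun x => -(Complex.I * a * AirySchrodinger.dq h v₂ x) - AirySchrodinger.dq h g x)
      (fun x => -(b * AirySchrodinger.dq h v₂ x)) s := by
  convert hv.dq h hm using 2 <;> simp only [AirySchrodinger.dq] <;> ring

/-- Evolution of the `L²` norm for the linear equation with a forcing term. -/
lemma hasDerivAt_nrm_sq {v v₁ : ℝ → ℝ → ℂ} {v₂ g : ℝ → ℂ}
    (hv : WD v (fun x => -(Complex.I * a * v₂ x) - g x) (fun x => -(b * v₂ x)) s)
    (cv : H1T (𝓝 s) v v₁ (v s) (v₁ s)) (hv₁ : IsH1 (v₁ s) v₂) (hg : L2fun g) :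
    HasDerivAt (fun t => nrm (v t) ^ 2) (-2 * (∫ x, g x * conj (v s x)).re) s := by
  have h1 := hasDerivAt_re (hv.hasDerivAt_integral hv.star cv cv.star)
  have h2 : ∀ᶠ t in 𝓝 s, nrm (v t) ^ 2 = (∫ x, v t x * conj (v t x)).re := by
    filter_upwards [cv.fst.mem] with t ht using (re_integral_self ht).symm
  refine (h1.congr_of_eventuallyEq h2).congr_deriv ?_
  rw [pairing_star, Complex.add_re, Complex.conj_re, re_pairing_self cv.lim hv₁ hg]
  ring

variable {u u₁ u₂ : ℝ → ℝ → ℂ}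

lemma Flow.h2' (hu : Flow a b c d e T u u₁ u₂) (hs : s ∈ Ioo (-T) T) :
    H2T (𝓝 s) u u₁ u₂ (u s) (u₁ s) (u₂ s) := by
  have := hu.h2 s (Ioo_subset_Icc_self hs)
  rwa [nhdsWithin_eq_nhds.2 (Icc_mem_nhds hs.1 hs.2)] at this

lemma Flow.joint (hu : Flow a b c d e T u u₁ u₂) (hs : s ∈ Ioo (-T) T) :
    H2T (𝓝[≠] (0 : ℝ) ×ˢ 𝓝 s) (fun p => u p.2) (fun p => u₁ p.2) (fun p => u₂ p.2)
      (u s) (u₁ s) (u₂ s) :=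
  (hu.h2' hs).comp tendsto_snd

/-- Evolution of the weighted mass. -/
lemma Flow.hasDerivAt_weight (hu : Flow a b c d e T u u₁ u₂) (hs : s ∈ Ioo (-T) T)
    {χ χ₁ χ₂ χ₃ : ℝ → ℝ} {M : ℝ}
    (h0 : ∀ x, HasDerivAt χ (χ₁ x) x) (h1 : ∀ x, HasDerivAt χ₁ (χ₂ x) x)
    (h2 : ∀ x, HasDerivAt χ₂ (χ₃ x) x) (h3 : Continuous χ₃)
    (b0 : ∀ x, |χ x| ≤ M) (b1 : ∀ x, |χ₁ x| ≤ M) (b2 : ∀ x, |χ₂ x| ≤ M) (b3 : ∀ x, |χ₃ x| ≤ M) :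
    HasDerivAt (fun t => (∫ x, u t x * (χ x * conj (u t x))).re)
      (2 * (∫ x, (Complex.I * a * (χ₁ x * u₁ s x * conj (u s x)) + 3 * b / 2 *
      (χ₁ x * u₂ s x * conj (u s x)) - b / 4 * (χ₃ x * u s x * conj (u s x)) +
      (d + e) / 4 * (χ₁ x * (u s x * conj (u s x)) * (u s x * conj (u s x))))).re) s := by
  have c1 : Continuous χ₁ := continuous_iff_continuousAt.2 fun x => (h1 x).continuousAt
  have hc := hu.h2' hs
  have cX := hc.fst.star.weight h0 c1 b0 b1
  have hd := hasDerivAt_re ((hu.wd s hs).hasDerivAt_of_eq (hu.wd s hs).star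
    (y := fun t => ∫ x, u t x * (χ x * conj (u t x))) cX (hc.fst.lim.weight h0 c1 b0 b1) (by
      filter_upwards [hc.fst.isH1, cX.isH1] with t h4 h5
      have k1 := h4.mem.integrable_mul h5.mem
      have k2 := hc.fst.lim.mem.integrable_mul cX.lim.mem
      have k3 := (h4.mem.sub' hc.fst.lim.mem).integrable_mul h5.mem
      have k4 := (h4.star.mem.sub' hc.fst.lim.star.mem).integrable_mul
        (hc.fst.lim.weight h0 c1 b0 b1).mem
      rw [← integral_sub k1 k2, ← integral_add k3 k4]
      congr 1; funext x; ring))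
  refine hd.congr_deriv ?_
  rw [pairing_star, Complex.add_re, Complex.conj_re]
  simp only [map_add, map_mul, Complex.conj_ofReal]
  rw [re_pairing_weight h0 h1 h2 h3 b0 b1 b2 b3 hc.fst.lim hc.snd.lim]
  ring

/-- Conservation of mass. -/
lemma Flow.hasDerivAt_mass (hu : Flow a b c d e T u u₁ u₂) (hs : s ∈ Ioo (-T) T) :
    HasDerivAt (fun t => nrm (u t) ^ 2) 0 s := by
  have h := hu.hasDerivAt_weight hs (χ := fun _ => 1) (χ₁ := fun _ => 0) (χ₂ := fun _ => 0)
    (χ₃ := fun _ => 0) (M := 1) (fun x => hasDerivAt_const x 1) (fun x => hasDerivAt_const x 0)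
    (fun x => hasDerivAt_const x 0) continuous_const (by simp) (by simp) (by simp) (by simp)
  refine (h.congr_of_eventuallyEq ?_).congr_deriv (by simp)
  filter_upwards [(hu.h2' hs).fst.fst.mem] with t ht
  simpa using (re_integral_self ht).symm

/-- Evolution of `∫ |u₁|²`. -/
lemma Flow.hasDerivAt_nrm_fst (hu : Flow a b c d e T u u₁ u₂) (hs : s ∈ Ioo (-T) T) :
    HasDerivAt (fun t => nrm (u₁ t) ^ 2)
      (-2 * (∫ x, nl₁ c d e (u s) (u₁ s) (u₂ s) x * conj (u₁ s x)).re) s := by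
  have hIoo := Ioo_mem_nhds hs.1 hs.2
  refine hasDerivAt_of_tendsto_joint (l := 𝓝[≠] 0) (f := fun h t => nrm (dq h (u t)) ^ 2)
    (f' := fun h t => -2 * (∫ x, dq h (nl c d e (u t) (u₁ t)) x * conj (dq h (u t) x)).re) ?_ ?_ ?_
  · filter_upwards [hIoo] with t ht h
    have hc := hu.h2' ht
    exact hasDerivAt_nrm_sq ((hu.wd t ht).dq_eqn hc.fst.fst.mem h) (hc.fst.dq_const h)
      (hc.snd.lim.dq h) ((isH1_nl hc.fst.lim hc.snd.lim c d e).mem.dq h)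
  · have hj := hu.joint hs
    have k1 := (hj.nl c d e).dq tendsto_fst
    have k2 := (hj.fst.dq tendsto_fst).star
    exact ((Complex.continuous_re.tendsto _).comp (k1.integral_mul k2)).const_mul (-2)
  · filter_upwards [hIoo] with t ht
    have hc := hu.h2' ht
    exact (((H1T.const hc.fst.lim).dq tendsto_id).tendsto_nrm).pow 2

lemma tendsto_dqK {ι : Type*} {l : Filter ι} {F F₁ F₂ : ι → ℝ → ℂ} {f f₁ f₂ : ℝ → ℂ}
    (hF : H2T l F F₁ F₂ f f₁ f₂) {k : ι → ℝ} (hk : Tendsto k l (𝓝[≠] 0)) (c d e : ℝ) :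
    L2T l (fun i => dqK c d e (k i) (F i) (F₁ i)) (leadK c d e f f₁ f₂) := by
  have hk0 : Tendsto k l (𝓝 0) := hk.mono_right nhdsWithin_le_nhds
  have hρ := hF.mul hF.star
  have hQ := hF.mul hF
  have t1 := ((hF.snd.translate hk0).translate hk0).ut
  have t2 := (hF.snd.dq hk).translate hk0
  have t3 := (hF.dq hk).dq hk
  have k1 := ((hρ.mul hF).dq hk).dq hk
  have k2 := ((hρ.dq hk).dq hk).mul_U t1
  have k3 := (hρ.dq hk).ut.mul_L2 t2
  have k4 := hρ.snd.ut.mul_L2 t3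
  have k5 := ((hQ.dq hk).dq hk).mul_U t1.star
  have k6 := (hQ.dq hk).ut.mul_L2 t2.star
  have k7 := hQ.snd.ut.mul_L2 t3.star
  exact ((k1.const_mul (Complex.I * c)).add
    (((k2.add (k3.const_mul 2)).sub (k4.const_mul (1 / 2))).const_mul (d : ℂ))).add
    (((k5.add (k6.const_mul 2)).sub (k7.const_mul (1 / 2))).const_mul (e : ℂ))

/-- Evolution of `∫ |u₂|²`. The nonlinear term of highest order is integrated by parts before the
limit in the difference quotients, since it would involve a third derivative. -/
lemma Flow.hasDerivAt_nrm_snd (hu : Flow a b c d e T u u₁ u₂) (hs : s ∈ Ioo (-T) T) :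
    HasDerivAt (fun t => nrm (u₂ t) ^ 2)
      (-2 * (∫ x, leadK c d e (u s) (u₁ s) (u₂ s) x * conj (u₂ s x)).re) s := by
  have hIoo := Ioo_mem_nhds hs.1 hs.2
  refine hasDerivAt_of_tendsto_joint (l := 𝓝[≠] 0) (f := fun h t => nrm (dq h (dq h (u t))) ^ 2)
    (f' := fun h t => -2 * (∫ x, dqK c d e h (u t) (u₁ t) x * conj (dq h (dq h (u t)) x)).re)
    ?_ ?_ ?_
  · filter_upwards [hIoo] with t ht h
    have hc := hu.h2' ht
    have hF := isH1_nl hc.fst.lim hc.snd.lim c d e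
    rw [← re_integral_dq_dq_nl hc.fst.lim hc.snd.lim]
    exact hasDerivAt_nrm_sq (((hu.wd t ht).dq_eqn hc.fst.fst.mem h).dq_eqn
      (hc.fst.fst.mem.mono fun _ hi => hi.dq h) h) ((hc.fst.dq_const h).dq_const h)
      ((hc.snd.lim.dq h).dq h) ((hF.mem.dq h).dq h)
  · have hj := hu.joint hs
    have k1 := tendsto_dqK hj tendsto_fst c d e
    have k2 := ((hj.dq tendsto_fst).dq tendsto_fst).star
    exact ((Complex.continuous_re.tendsto _).comp (k1.integral_mul k2)).const_mul (-2)
  · filter_upwards [hIoo] with t ht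
    have hc := hu.h2' ht
    exact ((((H2T.const hc.fst.lim hc.snd.lim).dq tendsto_id).dq tendsto_id).tendsto_nrm).pow 2

/-- The corrector `Re ∫ (α |ū w|² + β (ū w)²)`. -/
noncomputable def corr (α β : ℝ) (u w : ℝ → ℂ) : ℝ :=
  α * (∫ x, conj (u x) * w x * conj (conj (u x) * w x)).re +
    β * (∫ x, conj (u x) * w x * (conj (u x) * w x)).re

lemma pairing_comb {p q f f' g g' : ℝ → ℂ} (hp : L2fun p) (hq : L2fun q) (hf : L2fun f)
    (hf' : L2fun f') (hg : L2fun g) (hg' : L2fun g') (α β : ℂ) :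
    pairing p q (fun x => α * f x + β * g x) (fun x => α * f' x + β * g' x) =
      α * pairing p q f f' + β * pairing p q g g' := by
  unfold pairing
  have e1 : ∫ x, p x * (α * f x + β * g x) = α * (∫ x, p x * f x) + β * ∫ x, p x * g x := by
    rw [← integral_const_mul, ← integral_const_mul,
      ← integral_add ((hp.integrable_mul hf).const_mul α) ((hp.integrable_mul hg).const_mul β)]
    congr 1; funext x; ring
  have e2 : ∫ x, q x * (α * f' x + β * g' x) = α * (∫ x, q x * f' x) + β * ∫ x, q x * g' x := by
    rw [← integral_const_mul, ← integral_const_mul,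
      ← integral_add ((hq.integrable_mul hf').const_mul α) ((hq.integrable_mul hg').const_mul β)]
    congr 1; funext x; ring
  rw [e1, e2]; ring

/-- Evolution of the corrector. The product rule is applied to `ū w` where `w` is a difference
quotient of `u`, which is in `H²`, and `w` tends to `u₁`. -/
lemma Flow.hasDerivAt_corr (hu : Flow a b c d e T u u₁ u₂) (hs : s ∈ Ioo (-T) T) (α β : ℝ) :
    HasDerivAt (fun t => corr α β (u t) (u₁ t))
      (2 * (∫ x, corrPsi a b c d e α β (u s) (u₁ s) (u₂ s) (u₁ s) (u₂ s)
        (nl₁ c d e (u s) (u₁ s) (u₂ s)) x).re) s := by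
  have hIoo := Ioo_mem_nhds hs.1 hs.2
  refine hasDerivAt_of_tendsto_joint (l := 𝓝[≠] 0) (f := fun h t => corr α β (u t) (dq h (u t)))
    (f' := fun h t => 2 * (∫ x, corrPsi a b c d e α β (u t) (u₁ t) (u₂ t) (dq h (u t))
      (dq h (u₁ t)) (dq h (nl c d e (u t) (u₁ t))) x).re) ?_ ?_ ?_
  · filter_upwards [hIoo] with t ht h
    have hc := hu.h2' ht
    have hw := hc.dq_const h
    have hF := isH1_nl hc.fst.lim hc.snd.lim c d e
    have hg := (hu.wd t ht).star.mul ((hu.wd t ht).dq_eqn hc.fst.fst.mem h) hc.star hw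
    have cg := hc.fst.star.mul hw.fst
    have d1 := hasDerivAt_re (hg.hasDerivAt_integral hg.star cg cg.star)
    have d2 := hasDerivAt_re (hg.hasDerivAt_integral hg cg cg)
    refine ((d1.const_mul α).add (d2.const_mul β)).congr_deriv ?_
    rw [← re_pairing_corr hc.fst.lim hc.snd.lim hw.fst.lim hw.snd.lim (hF.mem.dq h), pairing_star]
    have hk := pairing_comb hg.memp hg.memq cg.star.lim.mem cg.star.lim.mem' cg.lim.mem cg.lim.mem'
      α β
    have e1 : corrK α β (u t) (dq h (u t)) = fun x =>
        (α : ℂ) * conj (conj (u t x) * dq h (u t) x) + β * (conj (u t x) * dq h (u t) x) := by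
      funext x; simp [corrK]
    have e2 : corrK₁ α β (u t) (u₁ t) (dq h (u t)) (dq h (u₁ t)) = fun x =>
        (α : ℂ) * conj (conj (u₁ t x) * dq h (u t) x + conj (u t x) * dq h (u₁ t) x) +
        β * (conj (u₁ t x) * dq h (u t) x + conj (u t x) * dq h (u₁ t) x) := by
      funext x; simp [corrK₁]
    rw [e1, e2, hk]
    simp only [Complex.add_re, Complex.conj_re, Complex.re_ofReal_mul]
    ring
  · have hj := hu.joint hs
    have hw := hj.dq tendsto_fst
    have hF := (hj.nl c d e)
    have hf := hF.dq tendsto_fst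
    have hρ := hj.mul hj.star
    have hQ := hj.star.mul hj.star
    have hk := (hj.fst.mul hw.star).const_mul (α : ℂ) |>.add ((hj.fst.star.mul hw).const_mul (β : ℂ))
    have x1 := ((hρ.snd.ut.mul_L2 hw.snd.star).const_mul (α : ℂ)).add
      ((hQ.snd.ut.mul_L2 hw.snd).const_mul (β : ℂ))
    have x2 := ((hρ.snd.mul hw.star).snd.const_mul (α : ℂ)).add
      ((hQ.snd.mul hw).snd.const_mul (β : ℂ))
    have x3 := ((hρ.fst.mul hw.star).snd.const_mul (α : ℂ)).add
      ((hQ.fst.mul hw).snd.const_mul (β : ℂ))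
    have X := ((x1.const_mul (-(b / 2 : ℂ))).sub (x2.const_mul (b : ℂ))).add
      (x3.const_mul (Complex.I * a))
    have hy := hw.mul hk
    have Y := (hy.snd.const_mul (b : ℂ)).add (hy.fst.const_mul (Complex.I * a))
    have Z := (hj.star.fst.ut.mul_L2 hf).add (hw.ut.mul_L2 hF.star.fst)
    have hT := ((hw.snd.integral_mul X).add (hj.star.snd.snd.integral_mul Y)).sub
      (Z.integral_mul hk.fst)
    have hlim : ∫ x, corrPsi a b c d e α β (u s) (u₁ s) (u₂ s) (u₁ s) (u₂ s)
        (nl₁ c d e (u s) (u₁ s) (u₂ s)) x = _ :=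
      (integral_sub (integrable_add (hw.snd.lim.integrable_mul X.lim)
        (hj.star.snd.snd.lim.integrable_mul Y.lim)) (Z.lim.integrable_mul hk.fst.lim)).trans
        (congrArg (· - _) (integral_add (hw.snd.lim.integrable_mul X.lim)
        (hj.star.snd.snd.lim.integrable_mul Y.lim)))
    rw [hlim]
    refine ((Complex.continuous_re.tendsto _).comp (hT.congr' ?_)).const_mul 2
    filter_upwards [hw.snd.mem, X.mem, hj.star.snd.snd.mem, Y.mem, Z.mem, hk.fst.mem]
      with p h1 h2 h3 h4 h5 h6
    exact ((integral_sub (integrable_add (h1.integrable_mul h2) (h3.integrable_mul h4))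
      (h5.integrable_mul h6)).trans
      (congrArg (· - _) (integral_add (h1.integrable_mul h2) (h3.integrable_mul h4)))).symm
  · filter_upwards [hIoo] with t ht
    have hc := hu.h2' ht
    have hw := (H1T.const (l := 𝓝[≠] (0 : ℝ)) hc.fst.lim).dq tendsto_id
    have hg := (H1T.const (l := 𝓝[≠] (0 : ℝ)) hc.fst.lim).star.ut.mul_L2 hw
    exact (((Complex.continuous_re.tendsto _).comp (hg.integral_mul hg.star)).const_mul α).add
      (((Complex.continuous_re.tendsto _).comp (hg.integral_mul hg)).const_mul β)

/-- Evolution of the corrected second order energy. -/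
lemma Flow.hasDerivAt_energy₂ (hu : Flow a b c d e T u u₁ u₂) (hs : s ∈ Ioo (-T) T) {α β : ℝ}
    (hα : 3 * b * α = 4 * d + 2 * e) (hβ : 3 * b * β = d + 3 * e) :
    HasDerivAt (fun t => nrm (u₂ t) ^ 2 - corr α β (u t) (u₁ t))
      (-2 * (∫ x, lowK a c d e α β (u s) (u₁ s) (u₂ s) x).re) s := by
  have hc := hu.h2' hs
  refine ((hu.hasDerivAt_nrm_snd hs).sub (hu.hasDerivAt_corr hs α β)).congr_deriv ?_
  rw [← re_integral_leadK hc.fst.lim hc.snd.lim hα hβ]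
  ring

lemma Flow.wd_sq (hu : Flow a b c d e T u u₁ u₂) (hs : s ∈ Ioo (-T) T) :
    WD (fun t x => u t x * u t x) (sqP a b c d e (u s) (u₁ s) (u₂ s)) (sqQ b (u s) (u₂ s)) s :=
  (hu.wd s hs).mul (hu.wd s hs) (hu.h2' hs) (hu.h2' hs)

/-- Evolution of the corrected first order energy. The coefficient of `∫ |u|⁴` is the one which
cancels `∫ (|u|²)ₓ |u₁|²`; as the derivative of `∫ |u|⁴` also contains `a` times `Im ∫ u² ū₁²`, this
choice enters the coefficient of the second corrector. -/
lemma Flow.hasDerivAt_energy₁ (hb : b ≠ 0) (hu : Flow a b c d e T u u₁ u₂) {γ g : ℝ → ℝ → ℂ}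
    (hγ : ∀ t ∈ Icc (-T) T, IsH1 (γ t) (fun x => u t x * u t x - γ t x))
    (hg : ∀ t ∈ Icc (-T) T, IsH1 (g t) (fun x => g t x - conj (u t x * u t x)))
    (hs : s ∈ Ioo (-T) T) :
    HasDerivAt (fun t => nrm (u₁ t) ^ 2 - (d + e) / (6 * b) * nrm (fun x => u t x * u t x) ^ 2 +
      (2 * c - 2 * a * (d + e) / (3 * b)) / (6 * b) * (∫ x, γ t x * conj (u t x * u t x)).im)
      ((2 * c - 2 * a * (d + e) / (3 * b)) / (6 * b) *
        (∫ x, resR a b c d e (u s) (u₁ s) (γ s) (g s) x).im) s := by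
  have hc := hu.h2' hs
  have hQ := hc.fst.mul hc.fst
  have hwd := hu.wd_sq hs
  have hI : ∀ᶠ t in 𝓝 s, t ∈ Icc (-T) T := Icc_mem_nhds hs.1 hs.2
  have hsI := Ioo_subset_Icc_self hs
  have d1 := hu.hasDerivAt_nrm_fst hs
  have d2 : HasDerivAt (fun t => nrm (fun x => u t x * u t x) ^ 2) _ s :=
    (hasDerivAt_re (hwd.hasDerivAt_integral hwd.star hQ hQ.star)).congr_of_eventuallyEq
      (by filter_upwards [hQ.fst.mem] with t ht using (re_integral_self ht).symm)
  have d3 := hasDerivAt_im (hwd.hasDerivAt_of_eq hwd.star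
    (y := fun t => ∫ x, γ t x * conj (u t x * u t x))
    (H1T.resolvent_neg hQ.star.fst (hI.mono hg) (hg s hsI)) (hγ s hsI) (by
      filter_upwards [hI, hQ.isH1] with t ht hQt
      have hQs := hQ.lim
      have h1 := (hγ t ht).sub (hγ s hsI)
      have h2 := integral_resolvent_mul (hQt.mem.sub' hQs.mem) hQt.star.mem
        ⟨h1.ac.congr fun x => by ring, h1.mem, (hQt.mem.sub' hQs.mem).sub' h1.mem⟩ (hg t ht)
      rw [← h2, ← integral_sub ((hγ t ht).mem.integrable_mul hQt.star.mem)
        ((hγ s hsI).mem.integrable_mul hQs.star.mem),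
        ← integral_add (h1.mem.integrable_mul hQt.star.mem)
          ((hQt.star.mem.sub' hQs.star.mem).integrable_mul (hγ s hsI).mem)]
      congr 1; funext x; ring))
  refine ((d1.sub (d2.const_mul _)).add (d3.const_mul _)).congr_deriv ?_
  rw [re_integral_nl₁ hc.fst.lim hc.snd.lim,
    im_pairing_resolvent hc.fst.lim hc.snd.lim (hγ s hsI) (hg s hsI), pairing_star, Complex.add_re,
    Complex.conj_re]
  rw [re_pairing_sq hc.fst.lim hc.snd.lim]
  field_simp
  ring

end

end

section

/-! ### A priori bounds -/

lemma gronwall_forward {f f' : ℝ → ℝ} {K T : ℝ} (hK : 0 ≤ K) (hf : ContinuousOn f (Icc 0 T))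
    (hd : ∀ s ∈ Ico 0 T, HasDerivAt f (f' s) s) (h0 : ∀ s ∈ Icc 0 T, 0 ≤ f s)
    (hb : ∀ s ∈ Ico 0 T, |f' s| ≤ K * f s) {t : ℝ} (ht : t ∈ Icc 0 T) :
    f t ≤ f 0 * Real.exp (K * T) := by
  have hT : 0 ≤ T := ht.1.trans ht.2
  have h00 := h0 0 ⟨le_rfl, hT⟩
  have h := norm_le_gronwallBound_of_norm_deriv_right_le (δ := f 0) (K := K) (ε := 0) hf
    (fun s hs => (hd s hs).hasDerivWithinAt) (by rw [Real.norm_of_nonneg h00])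
    (fun s hs => by
      rw [add_zero, Real.norm_eq_abs, Real.norm_of_nonneg (h0 s (Ico_subset_Icc_self hs))]
      exact hb s hs) t ht
  rw [gronwallBound_ε0, sub_zero, Real.norm_of_nonneg (h0 t ht)] at h
  refine h.trans (mul_le_mul_of_nonneg_left (Real.exp_le_exp.2 ?_) h00)
  exact mul_le_mul_of_nonneg_left ht.2 hK

/-- Grönwall's inequality, forward and backward in time. -/
lemma gronwall_two_sided {f f' : ℝ → ℝ} {K T : ℝ} (hT : 0 < T) (hK : 0 ≤ K)
    (hf : ContinuousOn f (Icc (-T) T)) (hd : ∀ s ∈ Ioo (-T) T, HasDerivAt f (f' s) s)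
    (h0 : ∀ s ∈ Icc (-T) T, 0 ≤ f s) (hb : ∀ s ∈ Ioo (-T) T, |f' s| ≤ K * f s) {t : ℝ}
    (ht : t ∈ Icc (-T) T) : f t ≤ f 0 * Real.exp (K * T) := by
  rcases le_total 0 t with h | h
  · refine gronwall_forward (f' := f') hK (hf.mono ?_) ?_ ?_ ?_ ⟨h, ht.2⟩
    · exact Icc_subset_Icc_left (by linarith)
    · exact fun s hs => hd s ⟨by linarith [hs.1], hs.2⟩
    · exact fun s hs => h0 s ⟨by linarith [hs.1], hs.2⟩
    · exact fun s hs => hb s ⟨by linarith [hs.1], hs.2⟩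
  · have := gronwall_forward (f := fun s => f (-s)) (f' := fun s => -f' (-s)) (K := K) (T := T)
      (t := -t) hK (hf.comp continuous_neg.continuousOn fun s hs =>
        ⟨by linarith [hs.2], by linarith [hs.1]⟩) ?_ ?_ ?_ ⟨by linarith, by linarith [ht.1]⟩
    · simpa using this
    · intro s hs
      have := (hd (-s) ⟨by linarith [hs.2], by linarith [hs.1]⟩).comp s (hasDerivAt_neg s)
      simpa [Function.comp_def] using this
    · exact fun s hs => h0 _ ⟨by linarith [hs.2], by linarith [hs.1]⟩
    · intro s hs
      rw [abs_neg]
      exact hb _ ⟨by linarith [hs.2], by linarith [hs.1]⟩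

lemma integral_pow_le {f : ℝ → ℂ} {B : ℝ} (hf : L2fun f) (hB : ∀ x, ‖f x‖ ^ 2 ≤ B) (k : ℕ) :
    Integrable (fun x => ‖f x‖ ^ (2 * k + 2)) volume ∧
      ∫ x, ‖f x‖ ^ (2 * k + 2) ≤ B ^ k * nrm f ^ 2 := by
  have h2 : Integrable (fun x => ‖f x‖ ^ 2) volume := hf.integrable_norm_pow (by norm_num)
  have hle : ∀ x, ‖f x‖ ^ (2 * k + 2) ≤ B ^ k * ‖f x‖ ^ 2 := fun x => by
    rw [pow_add, pow_mul]
    gcongr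
    exact hB x
  have hi : Integrable (fun x => ‖f x‖ ^ (2 * k + 2)) volume := by
    refine (h2.const_mul (B ^ k)).mono' (hf.aestronglyMeasurable.norm.pow _)
      (ae_of_all _ fun x => ?_)
    rw [Real.norm_of_nonneg (by positivity)]
    exact hle x
  refine ⟨hi, ?_⟩
  rw [nrm_sq hf, ← integral_const_mul]
  exact integral_mono hi (h2.const_mul _) hle

section

variable {a b c d e T m p r : ℝ} {u u₁ u₂ : ℝ → ℝ → ℂ}

/-- The exponential rate of growth of the corrected first order energy, in terms of the mass. -/
noncomputable def rate₁ (a b c d e m : ℝ) : ℝ :=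
  2 * |(2 * c - 2 * a * (d + e) / (3 * b)) / (6 * b)| *
    ((8 * |b| * m ^ 2 + 2 * |a| * (3 * m ^ 2 + 1) + 4 * m ^ 2 * (|c| + (|d| + |e|))) *
      (1 + 4 * m ^ 4))

/-- A bound for the square of the `H¹` norm of a solution, in terms of the `L²` norms `m` of the
initial datum and `p` of its derivative. -/
noncomputable def bound₁ (a b c d e T m p : ℝ) : ℝ :=
  (2 * (p ^ 2 + |(d + e) / (6 * b)| * (2 * m ^ 3 * p) +
      |(2 * c - 2 * a * (d + e) / (3 * b)) / (6 * b)| * m ^ 4) +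
    (4 * ((d + e) / (6 * b)) ^ 2 * m ^ 6 +
      2 * |(2 * c - 2 * a * (d + e) / (3 * b)) / (6 * b)| * m ^ 4 + m ^ 2)) *
    Real.exp (rate₁ a b c d e m * T)

lemma Flow.continuousOn_nrm (hu : Flow a b c d e T u u₁ u₂) :
    ContinuousOn (fun t => nrm (u t)) (Icc (-T) T) ∧
    ContinuousOn (fun t => nrm (u₁ t)) (Icc (-T) T) ∧
    ContinuousOn (fun t => nrm (u₂ t)) (Icc (-T) T) :=
  ⟨fun t ht => (hu.h2 t ht).fst.fst.tendsto_nrm, fun t ht => (hu.h2 t ht).fst.snd.tendsto_nrm,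
    fun t ht => (hu.h2 t ht).snd.snd.tendsto_nrm⟩

lemma Flow.nrm_le (hT : 0 < T) (hu : Flow a b c d e T u u₁ u₂) {t : ℝ} (ht : t ∈ Icc (-T) T) :
    nrm (u t) ≤ nrm (u 0) := by
  have := gronwall_two_sided (K := 0) hT le_rfl (hu.continuousOn_nrm.1.pow 2)
    (fun s hs => hu.hasDerivAt_mass hs) (fun s _ => sq_nonneg _) (by simp) ht
  simp only [zero_mul, Real.exp_zero, mul_one] at this
  exact le_of_sq_le_sq this nrm_nonneg

lemma nrm_mul_self_sq_le {f f' : ℝ → ℂ} (hf : IsH1 f f') :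
    nrm (fun x => f x * f x) ^ 2 ≤ 2 * nrm f ^ 3 * nrm f' := by
  have h := (integral_pow_le hf.mem hf.sq_norm_le 1).2
  rw [nrm_sq (hf.mul hf).mem]
  refine le_trans (le_of_eq ?_) (h.trans (le_of_eq (by ring)))
  congr 1; funext x; rw [norm_mul]; ring

lemma integral_norm_mul_self {f : ℝ → ℂ} (hf : L2fun f) : ∫ x, ‖f x * f x‖ = nrm f ^ 2 := by
  rw [nrm_sq hf]; congr 1; funext x; rw [norm_mul]; ring

/-- Bound of the `H¹` norm, by Grönwall's inequality for `2 E + C`, where `E` is the corrected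
energy. -/
lemma Flow.bound₁ (hT : 0 < T) (hb : b ≠ 0) (hu : Flow a b c d e T u u₁ u₂) {t : ℝ}
    (ht : t ∈ Icc (-T) T) :
    nrm (u₁ t) ^ 2 + nrm (u 0) ^ 2 ≤ bound₁ a b c d e T (nrm (u 0)) (nrm (u₁ 0)) := by
  have hex : ∀ t, ∃ γ g : ℝ → ℂ, t ∈ Icc (-T) T → IsH1 γ (fun x => u t x * u t x - γ x) ∧
      IsH1 g (fun x => g x - conj (u t x * u t x)) ∧
      (∀ x, ‖γ x‖ ≤ nrm (u t) ^ 2) ∧ ∀ x, ‖g x‖ ≤ nrm (u t) ^ 2 := by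
    intro t
    by_cases ht : t ∈ Icc (-T) T
    · have h := (hu.h2 t ht).fst.lim
      obtain ⟨γ, h1, h2⟩ := exists_resolvent (h.mul h).mem (h.mem.integrable_mul h.mem)
      obtain ⟨g, h3, h4⟩ := exists_resolvent_neg (h.mul h).star.mem
        (integrable_conj (h.mem.integrable_mul h.mem))
      simp only [Complex.norm_conj] at h4
      rw [integral_norm_mul_self h.mem] at h2 h4
      exact ⟨γ, g, fun _ => ⟨h1, h3, h2, h4⟩⟩
    · exact ⟨0, 0, fun h => absurd h ht⟩
  choose γ g hγg using hex
  set m := nrm (u 0) with hm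
  have m0 : 0 ≤ m := nrm_nonneg
  set A := (d + e) / (6 * b) with hA
  set B := (2 * c - 2 * a * (d + e) / (3 * b)) / (6 * b) with hB
  set E : ℝ → ℝ := fun t => nrm (u₁ t) ^ 2 - A * nrm (fun x => u t x * u t x) ^ 2 +
    B * (∫ x, γ t x * conj (u t x * u t x)).im with hE
  -- with this constant, `‖u₁‖² + m² ≤ 2 E + C`: the first corrector is at most `2 |A| m³ ‖u₁‖`, which
  -- is absorbed in `‖u₁‖²` by completing the square
  set C := 4 * A ^ 2 * m ^ 6 + 2 * |B| * m ^ 4 + m ^ 2 with hC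
  have hd : ∀ s ∈ Ioo (-T) T, HasDerivAt (fun t => 2 * E t + C)
      (2 * (B * (∫ x, resR a b c d e (u s) (u₁ s) (γ s) (g s) x).im)) s := fun s hs =>
    ((hu.hasDerivAt_energy₁ hb (fun t ht => (hγg t ht).1) (fun t ht => (hγg t ht).2.1) hs).const_mul
      2).add_const _
  have hcont : ContinuousOn (fun t => 2 * E t + C) (Icc (-T) T) := by
    have h1 : ContinuousOn (fun t => (∫ x, γ t x * conj (u t x * u t x)).im) (Icc (-T) T) := by
      have h2 : ContinuousOn (fun t => (∫ x, u t x * u t x * g t x).im) (Icc (-T) T) := by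
        intro t ht
        have hQ := (hu.h2 t ht).fst.mul (hu.h2 t ht).fst
        have hg := H1T.resolvent_neg hQ.star.fst
          (eventually_mem_nhdsWithin.mono fun r hr => (hγg r hr).2.1) (hγg t ht).2.1
        exact (Complex.continuous_im.tendsto _).comp (hQ.fst.integral_mul hg.fst)
      refine h2.congr fun t ht => ?_
      have hQ := ((hu.h2 t ht).fst.mul (hu.h2 t ht).fst).lim
      simp only
      rw [integral_resolvent_mul hQ.mem hQ.star.mem (hγg t ht).1 (hγg t ht).2.1]
    have h2 : ContinuousOn (fun t => nrm (fun x => u t x * u t x)) (Icc (-T) T) := fun t ht =>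
      ((hu.h2 t ht).fst.mul (hu.h2 t ht).fst).fst.tendsto_nrm
    exact ((((hu.continuousOn_nrm.2.1.pow 2).sub (continuousOn_const.mul (h2.pow 2))).add
      (continuousOn_const.mul h1)).const_smul (2 : ℝ)).add continuousOn_const
  have hest : ∀ s ∈ Icc (-T) T, nrm (fun x => u s x * u s x) ^ 2 ≤ 2 * m ^ 3 * nrm (u₁ s) ∧
      |(∫ x, γ s x * conj (u s x * u s x)).im| ≤ m ^ 4 := by
    intro s hs
    have h := (hu.h2 s hs).fst.lim
    have hms := hu.nrm_le hT hs
    constructor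
    · refine (nrm_mul_self_sq_le h).trans ?_
      have := nrm_nonneg (f := u s)
      have := nrm_nonneg (f := u₁ s)
      gcongr
    · refine (Complex.abs_im_le_norm _).trans ((norm_integral_le_integral_norm _).trans ?_)
      have h1 : ∫ x, ‖γ s x * conj (u s x * u s x)‖ ≤ ∫ x, nrm (u s) ^ 2 * ‖u s x * u s x‖ := by
        refine integral_mono ((hγg s hs).1.mem.integrable_mul (h.mul h).star.mem).norm
          ((h.mem.integrable_mul h.mem).norm.const_mul _) fun x => ?_
        simp only
        rw [norm_mul, Complex.norm_conj]
        exact mul_le_mul_of_nonneg_right ((hγg s hs).2.2.1 x) (norm_nonneg _)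
      rw [integral_const_mul, integral_norm_mul_self h.mem] at h1
      refine h1.trans ?_
      calc nrm (u s) ^ 2 * nrm (u s) ^ 2 = nrm (u s) ^ 4 := by ring
        _ ≤ m ^ 4 := by gcongr; exact nrm_nonneg
  have hlow : ∀ s ∈ Icc (-T) T, nrm (u₁ s) ^ 2 + m ^ 2 ≤ 2 * E s + C := by
    intro s hs
    obtain ⟨h1, h2⟩ := hest s hs
    set y := nrm (u₁ s)
    have k1 : A * nrm (fun x => u s x * u s x) ^ 2 ≤ |A| * (2 * m ^ 3 * y) :=
      (mul_le_mul_of_nonneg_right (le_abs_self A) (sq_nonneg _)).trans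
        (mul_le_mul_of_nonneg_left h1 (abs_nonneg _))
    have k2 : -(|B| * m ^ 4) ≤ B * (∫ x, γ s x * conj (u s x * u s x)).im := by
      refine (neg_le_neg ?_).trans (neg_abs_le _)
      rw [abs_mul]; gcongr
    have k3 : 2 * (|A| * (2 * m ^ 3 * y)) ≤ y ^ 2 + 4 * A ^ 2 * m ^ 6 := by
      rw [← sq_abs A]
      linarith [sq_nonneg (y - 2 * |A| * m ^ 3),
        show (y - 2 * |A| * m ^ 3) ^ 2 = y ^ 2 - 2 * (|A| * (2 * m ^ 3 * y)) +
          4 * |A| ^ 2 * m ^ 6 by ring]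
    simp only [hE, hC]
    linarith
  have hrate : 0 ≤ rate₁ a b c d e m := by rw [rate₁]; positivity
  have key := gronwall_two_sided hT hrate hcont hd
    (fun s hs => (by positivity : 0 ≤ nrm (u₁ s) ^ 2 + m ^ 2).trans (hlow s hs)) (fun s hs => by
      have hs' := Ioo_subset_Icc_self hs
      have hc := hu.h2 s hs'
      have h := hc.fst.lim
      have hms := hu.nrm_le hT hs'
      have n0 := nrm_nonneg (f := u s)
      have y0 := nrm_nonneg (f := u₁ s)
      set y := nrm (u₁ s)
      obtain ⟨h1, h2, h3, h4⟩ := hγg s hs'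
      set M := 8 * |b| * m ^ 2 + 2 * |a| * (3 * m ^ 2 + 1) + 4 * m ^ 2 * (|c| + (|d| + |e|))
      have hM : 0 ≤ M := by positivity
      have hG : nrm (u s) ^ 2 ≤ m ^ 2 := by gcongr
      have hR : ∀ x, ‖resR a b c d e (u s) (u₁ s) (γ s) (g s) x‖ ≤
          M * (‖u₁ s x‖ ^ 2 + ‖u s x‖ ^ 2 + ‖u s x‖ ^ 6) := fun x =>
        norm_resR_le ((h3 x).trans hG) ((h4 x).trans hG)
      obtain ⟨i6, e6⟩ := integral_pow_le h.mem h.sq_norm_le 2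
      have i2 : Integrable (fun x => ‖u s x‖ ^ 2) volume := h.mem.integrable_norm_pow (by norm_num)
      have i1 : Integrable (fun x => ‖u₁ s x‖ ^ 2) volume := h.mem'.integrable_norm_pow (by norm_num)
      have hI : ‖∫ x, resR a b c d e (u s) (u₁ s) (γ s) (g s) x‖ ≤
          M * (y ^ 2 + nrm (u s) ^ 2 + (2 * (nrm (u s) * y)) ^ 2 * nrm (u s) ^ 2) := by
        refine (norm_integral_le_integral_norm _).trans ((integral_mono
          (integrable_resR h hc.snd.lim h1 h2).norm (((i1.add i2).add i6).const_mul M) hR).trans ?_)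
        rw [integral_const_mul]
        refine mul_le_mul_of_nonneg_left ?_ hM
        have : ∫ x, ((fun x => ‖u₁ s x‖ ^ 2) + (fun x => ‖u s x‖ ^ 2) +
            fun x => ‖u s x‖ ^ (2 * 2 + 2)) x = (∫ x, ‖u₁ s x‖ ^ 2) + (∫ x, ‖u s x‖ ^ 2) +
            ∫ x, ‖u s x‖ ^ (2 * 2 + 2) := by
          rw [integral_add' (i1.add i2) i6, integral_add' i1 i2]
        rw [this, ← nrm_sq h.mem, ← nrm_sq h.mem']
        linarith
      have hfin : y ^ 2 + nrm (u s) ^ 2 + (2 * (nrm (u s) * y)) ^ 2 * nrm (u s) ^ 2 ≤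
          (1 + 4 * m ^ 4) * (y ^ 2 + m ^ 2) := by
        have k1 : (2 * (nrm (u s) * y)) ^ 2 * nrm (u s) ^ 2 ≤ 4 * m ^ 4 * y ^ 2 := by
          calc _ = 4 * nrm (u s) ^ 4 * y ^ 2 := by ring
            _ ≤ _ := by gcongr
        have k2 : 0 ≤ 4 * m ^ 4 * m ^ 2 := by positivity
        linarith
      rw [abs_mul, abs_mul, abs_two]
      have k3 := (Complex.abs_im_le_norm _).trans (hI.trans (mul_le_mul_of_nonneg_left
        (hfin.trans (mul_le_mul_of_nonneg_left (hlow s hs') (by positivity))) hM))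
      calc 2 * (|B| * |(∫ x, resR a b c d e (u s) (u₁ s) (γ s) (g s) x).im|) ≤
          2 * (|B| * (M * ((1 + 4 * m ^ 4) * (2 * E s + C)))) := by gcongr
        _ = _ := by rw [rate₁]; ring) ht
  refine (hlow t ht).trans (key.trans ?_)
  rw [AirySchrodinger.bound₁]
  refine mul_le_mul_of_nonneg_right (add_le_add_left (mul_le_mul_of_nonneg_left ?_ two_pos.le) _)
    (Real.exp_pos _).le
  obtain ⟨h1, h2⟩ := hest 0 ⟨by linarith, hT.le⟩
  have k1 : -(A * nrm (fun x => u 0 x * u 0 x) ^ 2) ≤ |A| * (2 * m ^ 3 * nrm (u₁ 0)) := by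
    rw [← neg_mul]
    exact (mul_le_mul_of_nonneg_right (neg_le_abs A) (sq_nonneg _)).trans
      (mul_le_mul_of_nonneg_left h1 (abs_nonneg _))
  have k2 : B * (∫ x, γ 0 x * conj (u 0 x * u 0 x)).im ≤ |B| * m ^ 4 := by
    refine (le_abs_self _).trans ?_
    rw [abs_mul]; gcongr
  simp only [hE]
  linarith

end

end

section

section

variable {a b c d e T m p r : ℝ} {u u₁ u₂ : ℝ → ℝ → ℂ}

/-- The coefficient `α` of the corrector for which the second order energy is controlled. -/
noncomputable def coefα (b d e : ℝ) : ℝ := (4 * d + 2 * e) / (3 * b)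

/-- The coefficient `β` of the corrector for which the second order energy is controlled. -/
noncomputable def coefβ (b d e : ℝ) : ℝ := (d + 3 * e) / (3 * b)

/-- The exponential rate of growth of the corrected second order energy, in terms of a bound `Y`
of the square of the `H¹` norm. -/
noncomputable def rate₂ (a b c d e Y : ℝ) : ℝ :=
  2 * lowC a c d e (coefα b d e) (coefβ b d e) (√Y) * (1 + Y)

/-- A bound for `∫ |u₂|²`, in terms of a bound `Y` of the square of the `H¹` norm and of the `L²`
norm `r` of the second derivative of the initial datum. -/
noncomputable def bound₂ (a b c d e T Y r : ℝ) : ℝ :=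
  (r ^ 2 + 2 * ((|coefα b d e| + |coefβ b d e|) * Y ^ 2) + Y) * Real.exp (rate₂ a b c d e Y * T)

/-- Bound of the second derivative, by Grönwall's inequality for `E + A + Y`, where `E` is the
corrected energy and `A` bounds the corrector. -/
lemma Flow.bound₂ (hT : 0 < T) (hb : b ≠ 0) (hu : Flow a b c d e T u u₁ u₂) {Y : ℝ}
    (hY : ∀ t ∈ Icc (-T) T, nrm (u₁ t) ^ 2 + nrm (u t) ^ 2 ≤ Y) {t : ℝ} (ht : t ∈ Icc (-T) T) :
    nrm (u₂ t) ^ 2 ≤ bound₂ a b c d e T Y (nrm (u₂ 0)) := by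
  have h00 : (0 : ℝ) ∈ Icc (-T) T := ⟨by linarith, hT.le⟩
  have hY0 : 0 ≤ Y := (by positivity : 0 ≤ nrm (u₁ 0) ^ 2 + nrm (u 0) ^ 2).trans (hY 0 h00)
  have hα : 3 * b * coefα b d e = 4 * d + 2 * e := by rw [coefα]; field_simp
  have hβ : 3 * b * coefβ b d e = d + 3 * e := by rw [coefβ]; field_simp
  set α := coefα b d e
  set β := coefβ b d e
  set A := (|α| + |β|) * Y ^ 2 with hA
  set E : ℝ → ℝ := fun t => nrm (u₂ t) ^ 2 - corr α β (u t) (u₁ t) with hE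
  have hS2 : √Y ^ 2 = Y := Real.sq_sqrt hY0
  have hsup2 : ∀ s ∈ Icc (-T) T, ∀ x, ‖u s x‖ ^ 2 ≤ Y := fun s hs x => by
    refine ((hu.h2 s hs).fst.lim.sq_norm_le x).trans (le_trans ?_ (hY s hs))
    linarith [two_mul_le_add_sq (nrm (u s)) (nrm (u₁ s))]
  have hsup : ∀ s ∈ Icc (-T) T, ∀ x, ‖u s x‖ ≤ √Y := fun s hs x =>
    Real.le_sqrt_of_sq_le (hsup2 s hs x)
  have hcorr : ∀ s ∈ Icc (-T) T, |corr α β (u s) (u₁ s)| ≤ A := by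
    intro s hs
    have h := (hu.h2 s hs)
    have hg := h.fst.lim.star.mul_mem h.fst.lim.mem'
    have hn : nrm (fun x => conj (u s x) * u₁ s x) ≤ √Y * nrm (u₁ s) :=
      nrm_mul_le (Real.sqrt_nonneg _) h.fst.lim.mem' (fun x => by simpa using hsup s hs x)
    have hn2 : nrm (fun x => conj (u s x) * u₁ s x) * nrm (fun x => conj (u s x) * u₁ s x) ≤
        Y ^ 2 := by
      have h1 : nrm (u₁ s) ^ 2 ≤ Y := by linarith [hY s hs, sq_nonneg (nrm (u s))]
      calc _ ≤ (√Y * nrm (u₁ s)) * (√Y * nrm (u₁ s)) :=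
            mul_le_mul hn hn nrm_nonneg (mul_nonneg (Real.sqrt_nonneg _) nrm_nonneg)
        _ = √Y ^ 2 * nrm (u₁ s) ^ 2 := by ring
        _ ≤ Y * Y := by rw [hS2]; gcongr
        _ = _ := by ring
    have k1 := (Complex.abs_re_le_norm _).trans ((norm_integral_mul_le hg hg.star).trans
      (le_of_eq_of_le (by rw [nrm_conj]) hn2))
    have k2 := (Complex.abs_re_le_norm _).trans ((norm_integral_mul_le hg hg).trans hn2)
    rw [corr]
    refine (abs_add_le _ _).trans ?_
    rw [abs_mul, abs_mul, hA, add_mul]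
    exact add_le_add (mul_le_mul_of_nonneg_left k1 (abs_nonneg _))
      (mul_le_mul_of_nonneg_left k2 (abs_nonneg _))
  have hlow : ∀ s ∈ Icc (-T) T, nrm (u₂ s) ^ 2 + Y ≤ E s + (A + Y) := fun s hs => by
    have := (abs_le.1 (hcorr s hs)).2
    simp only [hE]; linarith
  have hd : ∀ s ∈ Ioo (-T) T, HasDerivAt (fun t => E t + (A + Y))
      (-2 * (∫ x, lowK a c d e α β (u s) (u₁ s) (u₂ s) x).re) s := fun s hs =>
    (hu.hasDerivAt_energy₂ hs hα hβ).add_const _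
  have hcont : ContinuousOn (fun t => E t + (A + Y)) (Icc (-T) T) := by
    refine ((hu.continuousOn_nrm.2.2.pow 2).sub fun t ht => ?_).add continuousOn_const
    have h := (hu.h2 t ht).fst
    have hg := h.star.ut.mul_L2 h.snd
    exact (((Complex.continuous_re.tendsto _).comp (hg.integral_mul hg.star)).const_mul α).add
      (((Complex.continuous_re.tendsto _).comp (hg.integral_mul hg)).const_mul β)
  have hC : 0 ≤ lowC a c d e α β (√Y) := by
    have := Real.sqrt_nonneg Y
    rw [lowC]; positivity
  have hrate : 0 ≤ rate₂ a b c d e Y := by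
    rw [rate₂]
    exact mul_nonneg (mul_nonneg two_pos.le hC) (by positivity)
  have key := gronwall_two_sided hT hrate hcont hd
    (fun s hs => (by positivity : 0 ≤ nrm (u₂ s) ^ 2 + Y).trans (hlow s hs)) (fun s hs => by
      have hs' := Ioo_subset_Icc_self hs
      have h := (hu.h2 s hs')
      obtain ⟨i4, e4⟩ := integral_pow_le h.snd.lim.mem h.snd.lim.sq_norm_le 1
      have i1 : Integrable (fun x => ‖u₁ s x‖ ^ 2) volume :=
        h.snd.lim.mem.integrable_norm_pow (by norm_num)
      have i2 : Integrable (fun x => ‖u₂ s x‖ ^ 2) volume :=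
        h.snd.lim.mem'.integrable_norm_pow (by norm_num)
      set y := nrm (u₁ s)
      set z := nrm (u₂ s)
      have hI : ‖∫ x, lowK a c d e α β (u s) (u₁ s) (u₂ s) x‖ ≤
          lowC a c d e α β (√Y) * (z ^ 2 + y ^ 2 + (2 * (y * z)) ^ 1 * y ^ 2) := by
        refine (norm_integral_le_integral_norm _).trans ((integral_mono
          (integrable_lowK h.fst.lim h.snd.lim a c d e α β).norm
          (((i2.add i1).add i4).const_mul _) fun x => norm_lowK_le (hsup s hs' x)).trans ?_)
        rw [integral_const_mul]
        refine mul_le_mul_of_nonneg_left ?_ hC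
        have : ∫ x, ((fun x => ‖u₂ s x‖ ^ 2) + (fun x => ‖u₁ s x‖ ^ 2) +
            fun x => ‖u₁ s x‖ ^ (2 * 1 + 2)) x = (∫ x, ‖u₂ s x‖ ^ 2) + (∫ x, ‖u₁ s x‖ ^ 2) +
            ∫ x, ‖u₁ s x‖ ^ (2 * 1 + 2) := by
          rw [integral_add' (i2.add i1) i4, integral_add' i2 i1]
        rw [this, ← nrm_sq h.snd.lim.mem, ← nrm_sq h.snd.lim.mem']
        linarith
      have hy : y ^ 2 ≤ Y := by linarith [hY s hs', sq_nonneg (nrm (u s))]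
      have hfin : z ^ 2 + y ^ 2 + (2 * (y * z)) ^ 1 * y ^ 2 ≤ (1 + Y) * (z ^ 2 + Y) := by
        have k1 : (2 * (y * z)) ^ 1 * y ^ 2 ≤ (Y + z ^ 2) * Y := by
          refine mul_le_mul ?_ hy (sq_nonneg _) (by positivity)
          linarith [two_mul_le_add_sq y z]
        linarith
      have k3 := (Complex.abs_re_le_norm _).trans (hI.trans (mul_le_mul_of_nonneg_left
        (hfin.trans (mul_le_mul_of_nonneg_left (hlow s hs') (by positivity))) hC))
      rw [abs_mul, abs_neg, abs_two]
      calc _ ≤ 2 * (lowC a c d e α β (√Y) * ((1 + Y) * (E s + (A + Y)))) := by gcongr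
        _ = _ := by rw [rate₂]; ring) ht
  refine (le_trans (by linarith) (hlow t ht)).trans (key.trans ?_)
  rw [AirySchrodinger.bound₂]
  refine mul_le_mul_of_nonneg_right ?_ (Real.exp_pos _).le
  have := (abs_le.1 (hcorr 0 h00)).1
  simp only [hE]
  linarith

/-! ### The weighted estimate -/

/-- The estimate for the bounded weight `R² sin² (x / R)` in place of `x²`, with constants which do
not depend on `R`. -/
lemma Flow.weighted_le (hT : 0 < T) (hu : Flow a b c d e T u u₁ u₂) {Y Z : ℝ}
    (hY : ∀ t ∈ Icc (-T) T, nrm (u₁ t) ^ 2 + nrm (u t) ^ 2 ≤ Y)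
    (hZ : ∀ t ∈ Icc (-T) T, nrm (u₂ t) ^ 2 ≤ Z) {R : ℝ} (hR : 1 ≤ R) {t : ℝ}
    (ht : t ∈ Icc (-T) T) :
    ∫ x, (R * Real.sin (x / R)) ^ 2 * ‖u t x‖ ^ 2 ≤
      Real.exp ((2 * |a| + 3 * |b| + |d + e| / 2) * T) *
        ((∫ x, (R * Real.sin (x / R)) ^ 2 * ‖u 0 x‖ ^ 2) +
          (2 * |a| + 3 * |b| + |d + e| / 2) * (Y + Z + Y ^ 3) * T) := by
  have hR0 : R ≠ 0 := by positivity
  have h00 : (0 : ℝ) ∈ Icc (-T) T := ⟨by linarith, hT.le⟩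
  have hY0 : 0 ≤ Y := (by positivity : 0 ≤ nrm (u₁ 0) ^ 2 + nrm (u 0) ^ 2).trans (hY 0 h00)
  have hZ0 : 0 ≤ Z := (sq_nonneg _).trans (hZ 0 h00)
  set a₀ := 2 * |a| + 3 * |b| + |d + e| / 2 with ha₀
  have ha₀0 : 0 ≤ a₀ := by positivity
  set K := Y + Z + Y ^ 3 with hK
  have hK0 : 0 ≤ K := by positivity
  set S : ℝ → ℝ := fun x => Real.sin (x / R) with hS
  set Cs : ℝ → ℝ := fun x => Real.cos (x / R) with hCs
  have dS : ∀ x, HasDerivAt S (Cs x / R) x := fun x => by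
    simpa [hS, hCs, div_eq_mul_inv] using ((hasDerivAt_id x).div_const R).sin
  have dC : ∀ x, HasDerivAt Cs (-S x / R) x := fun x => by
    simpa [hS, hCs, div_eq_mul_inv] using ((hasDerivAt_id x).div_const R).cos
  have bS : ∀ x, |S x| ≤ 1 := fun x => Real.abs_sin_le_one _
  have bC : ∀ x, |Cs x| ≤ 1 := fun x => Real.abs_cos_le_one _
  have bSC : ∀ x, |S x * Cs x| ≤ 1 / 2 := fun x => by
    have := Real.sin_sq_add_cos_sq (x / R)
    rw [abs_le]
    constructor <;> nlinarith [sq_nonneg (S x + Cs x), sq_nonneg (S x - Cs x)]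
  have cS : Continuous S := continuous_iff_continuousAt.2 fun x => (dS x).continuousAt
  have cC : Continuous Cs := continuous_iff_continuousAt.2 fun x => (dC x).continuousAt
  set χ : ℝ → ℝ := fun x => (R * S x) ^ 2 with hχ
  set χ₁ : ℝ → ℝ := fun x => 2 * R * (S x * Cs x) with hχ₁
  set χ₂ : ℝ → ℝ := fun x => 2 * (Cs x ^ 2 - S x ^ 2) with hχ₂
  set χ₃ : ℝ → ℝ := fun x => -(8 / R) * (S x * Cs x) with hχ₃
  have d0 : ∀ x, HasDerivAt χ (χ₁ x) x := fun x => by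
    refine (((dS x).const_mul R).pow 2).congr_deriv ?_
    simp only [hχ₁]; field_simp; ring
  have d1 : ∀ x, HasDerivAt χ₁ (χ₂ x) x := fun x => by
    refine (((dS x).mul (dC x)).const_mul (2 * R)).congr_deriv ?_
    simp only [hχ₂]; field_simp; ring
  have d2 : ∀ x, HasDerivAt χ₂ (χ₃ x) x := fun x => by
    refine ((((dC x).pow 2).sub ((dS x).pow 2)).const_mul 2).congr_deriv ?_
    simp only [hχ₃]; field_simp; ring
  have c3 : Continuous χ₃ := continuous_const.mul (cS.mul cC)
  have c0 : Continuous χ := (continuous_const.mul cS).pow 2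
  have c1 : Continuous χ₁ := continuous_const.mul (cS.mul cC)
  set M := R ^ 2 + 2 * R + 8 with hM
  have s2 : ∀ x, S x ^ 2 ≤ 1 := fun x => (sq_le_one_iff_abs_le_one _).2 (bS x)
  have b0 : ∀ x, |χ x| ≤ M := fun x => by
    rw [abs_of_nonneg (sq_nonneg (R * S x))]
    rw [mul_pow]
    nlinarith [s2 x, sq_nonneg R]
  have b1 : ∀ x, |χ₁ x| ≤ M := fun x => by
    simp only [hχ₁, abs_mul, abs_two, abs_of_nonneg (by linarith : 0 ≤ R)]
    have := bSC x
    rw [abs_mul] at this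
    nlinarith [sq_nonneg R]
  have b2 : ∀ x, |χ₂ x| ≤ M := fun x => by
    have h1 := s2 x
    have h2 : Cs x ^ 2 ≤ 1 := (sq_le_one_iff_abs_le_one _).2 (bC x)
    simp only [hχ₂]
    rw [abs_le]
    constructor <;> nlinarith [sq_nonneg R, sq_nonneg (S x), sq_nonneg (Cs x)]
  have b3' : ∀ x, |χ₃ x| ≤ 4 := fun x => by
    simp only [hχ₃]
    rw [abs_mul, abs_neg, abs_of_nonneg (by positivity : 0 ≤ 8 / R)]
    have h8 : 8 / R ≤ 8 := div_le_self (by norm_num) hR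
    calc _ ≤ 8 * (1 / 2) := mul_le_mul h8 (bSC x) (abs_nonneg _) (by norm_num)
      _ = 4 := by norm_num
  have b3 : ∀ x, |χ₃ x| ≤ M := fun x => (b3' x).trans (by nlinarith)
  -- the weight satisfies `|χ₁| ≤ 2 √χ`, so that a factor `χ₁` costs half of the weight
  have hχχ₁ : ∀ x (n k : ℝ), 0 ≤ n → 0 ≤ k → |χ₁ x| * n * k ≤ χ x * k ^ 2 + n ^ 2 := by
    intro x n k hn hk
    have h1 : |χ₁ x| ≤ 2 * (R * |S x|) := by
      simp only [hχ₁, abs_mul, abs_two, abs_of_nonneg (by linarith : 0 ≤ R)]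
      have : |S x| * |Cs x| ≤ |S x| * 1 := mul_le_mul_of_nonneg_left (bC x) (abs_nonneg _)
      nlinarith
    have h2 : χ x = (R * |S x|) ^ 2 := by simp only [hχ, mul_pow, sq_abs]
    rw [h2]
    have := mul_le_mul_of_nonneg_right (mul_le_mul_of_nonneg_right h1 hn) hk
    linarith [sq_nonneg (R * |S x| * k - n),
      show (R * |S x| * k - n) ^ 2 = (R * |S x|) ^ 2 * k ^ 2 - 2 * (R * |S x|) * n * k + n ^ 2 by
        ring]
  set W : ℝ → ℝ := fun t => (∫ x, u t x * (χ x * conj (u t x))).re with hW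
  have iχ : ∀ s ∈ Icc (-T) T, Integrable (fun x => χ x * ‖u s x‖ ^ 2) volume := fun s hs => by
    refine (((hu.h2 s hs).fst.lim.mem.integrable_norm_pow (p := 2) (by norm_num)).const_mul M).mono'
      (c0.aestronglyMeasurable.mul
        ((hu.h2 s hs).fst.lim.mem.aestronglyMeasurable.norm.pow 2)) (ae_of_all _ fun x => ?_)
    rw [norm_mul, Real.norm_eq_abs, Real.norm_of_nonneg (sq_nonneg _)]
    exact mul_le_mul_of_nonneg_right (b0 x) (sq_nonneg _)
  have hWeq : ∀ s ∈ Icc (-T) T, W s = ∫ x, χ x * ‖u s x‖ ^ 2 := fun s hs => by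
    have : ∫ x, u s x * (χ x * conj (u s x)) = ((∫ x, χ x * ‖u s x‖ ^ 2 : ℝ) : ℂ) := by
      rw [← integral_complex_ofReal]
      congr 1; funext x
      rw [mul_left_comm, Complex.mul_conj, Complex.normSq_eq_norm_sq]; push_cast; ring
    simp only [hW, this, Complex.ofReal_re]
  have hW0 : ∀ s ∈ Icc (-T) T, 0 ≤ W s := fun s hs => by
    rw [hWeq s hs]; exact integral_nonneg fun x => mul_nonneg (sq_nonneg _) (sq_nonneg _)
  have hcont : ContinuousOn (fun t => W t + K) (Icc (-T) T) := by
    refine ContinuousOn.add (fun t ht => ?_) continuousOn_const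
    have h := (hu.h2 t ht).fst
    exact (Complex.continuous_re.tendsto _).comp (h.fst.integral_mul (h.star.weight d0 c1 b0 b1).fst)
  have key := gronwall_two_sided hT ha₀0 hcont
    (fun s hs => (hu.hasDerivAt_weight hs d0 d1 d2 c3 b0 b1 b2 b3).add_const K)
    (fun s hs => add_nonneg (hW0 s hs) hK0) (fun s hs => by
      have hs' := Ioo_subset_Icc_self hs
      have h := hu.h2 s hs'
      have hsup2 : ∀ x, ‖u s x‖ ^ 2 ≤ Y := fun x => by
        refine (h.fst.lim.sq_norm_le x).trans (le_trans ?_ (hY s hs'))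
        linarith [two_mul_le_add_sq (nrm (u s)) (nrm (u₁ s))]
      obtain ⟨i6, e6⟩ := integral_pow_le h.fst.lim.mem hsup2 2
      have i0 : Integrable (fun x => ‖u s x‖ ^ 2) volume :=
        h.fst.lim.mem.integrable_norm_pow (by norm_num)
      have i1 : Integrable (fun x => ‖u₁ s x‖ ^ 2) volume :=
        h.snd.lim.mem.integrable_norm_pow (by norm_num)
      have i2 : Integrable (fun x => ‖u₂ s x‖ ^ 2) volume :=
        h.snd.lim.mem'.integrable_norm_pow (by norm_num)
      have iw := iχ s hs'
      rw [abs_mul, abs_two]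
      have j1 := (iw.add i1).const_mul |a|
      have j2 := (iw.add i2).const_mul (3 * |b| / 2)
      have j3 := i0.const_mul |b|
      have j4 := (iw.add i6).const_mul (|d + e| / 4)
      have hI := norm_integral_le_of_norm_le (((j1.add j2).add j3).add j4) (f := fun x =>
        Complex.I * a * (χ₁ x * u₁ s x * conj (u s x)) + 3 * b / 2 *
        (χ₁ x * u₂ s x * conj (u s x)) - b / 4 * (χ₃ x * u s x * conj (u s x)) +
        (d + e) / 4 * (χ₁ x * (u s x * conj (u s x)) * (u s x * conj (u s x))))
        (ae_of_all _ fun x => by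
          have n0 := norm_nonneg (u s x)
          have n1 := norm_nonneg (u₁ s x)
          have n2 := norm_nonneg (u₂ s x)
          have t1 : ‖Complex.I * a * (χ₁ x * u₁ s x * conj (u s x))‖ ≤
              |a| * (χ x * ‖u s x‖ ^ 2 + ‖u₁ s x‖ ^ 2) := by
            simp only [norm_mul, Complex.norm_I, Complex.norm_real, Real.norm_eq_abs,
              Complex.norm_conj, one_mul]
            exact mul_le_mul_of_nonneg_left (hχχ₁ x _ _ n1 n0) (abs_nonneg _)
          have t2 : ‖3 * b / 2 * (χ₁ x * u₂ s x * conj (u s x))‖ ≤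
              3 * |b| / 2 * (χ x * ‖u s x‖ ^ 2 + ‖u₂ s x‖ ^ 2) := by
            simp only [norm_mul, norm_div, Complex.norm_real, Real.norm_eq_abs,
              Complex.norm_conj, Complex.norm_ofNat]
            exact mul_le_mul_of_nonneg_left (hχχ₁ x _ _ n2 n0) (by positivity)
          have t3 : ‖b / 4 * (χ₃ x * u s x * conj (u s x))‖ ≤ |b| * ‖u s x‖ ^ 2 := by
            simp only [norm_mul, norm_div, Complex.norm_real, Real.norm_eq_abs,
              Complex.norm_conj, Complex.norm_ofNat]
            have := mul_le_mul_of_nonneg_right (b3' x) (mul_nonneg n0 n0)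
            have := mul_le_mul_of_nonneg_left this (by positivity : 0 ≤ |b| / 4)
            calc _ = |b| / 4 * (|χ₃ x| * (‖u s x‖ * ‖u s x‖)) := by ring
              _ ≤ _ := this
              _ = _ := by ring
          have t4 : ‖(d + e) / 4 * (χ₁ x * (u s x * conj (u s x)) * (u s x * conj (u s x)))‖ ≤
              |d + e| / 4 * (χ x * ‖u s x‖ ^ 2 + ‖u s x‖ ^ (2 * 2 + 2)) := by
            rw [← Complex.ofReal_add]
            simp only [norm_mul, norm_div, Complex.norm_real, Real.norm_eq_abs,
              Complex.norm_conj, Complex.norm_ofNat]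
            have := mul_le_mul_of_nonneg_left (hχχ₁ x (‖u s x‖ ^ 3) _ (by positivity) n0)
              (by positivity : 0 ≤ |d + e| / 4)
            exact le_trans (le_of_eq (by ring)) (this.trans (le_of_eq (by ring)))
          exact norm_add_le_of_le (norm_sub_le_of_le (norm_add_le_of_le t1 t2) t3) t4)
      have hint : ∫ x, (((fun x => |a| * ((fun x => χ x * ‖u s x‖ ^ 2) +
          fun x => ‖u₁ s x‖ ^ 2) x) + (fun x => 3 * |b| / 2 * ((fun x => χ x * ‖u s x‖ ^ 2) +
          fun x => ‖u₂ s x‖ ^ 2) x)) + (fun x => |b| * ‖u s x‖ ^ 2) + (fun x => |d + e| / 4 *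
          ((fun x => χ x * ‖u s x‖ ^ 2) + fun x => ‖u s x‖ ^ (2 * 2 + 2)) x)) x =
          |a| * (W s + nrm (u₁ s) ^ 2) + 3 * |b| / 2 * (W s + nrm (u₂ s) ^ 2) +
          |b| * nrm (u s) ^ 2 + |d + e| / 4 * (W s + ∫ x, ‖u s x‖ ^ (2 * 2 + 2)) := by
        rw [integral_add' ((j1.add j2).add j3) j4, integral_add' (j1.add j2) j3,
          integral_add' j1 j2, integral_const_mul, integral_const_mul, integral_const_mul,
          integral_const_mul, integral_add' iw i1, integral_add' iw i2, integral_add' iw i6,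
          hWeq s hs', nrm_sq h.fst.lim.mem, nrm_sq h.snd.lim.mem, nrm_sq h.snd.lim.mem']
      have hI' := (Complex.abs_re_le_norm _).trans (hI.trans (le_of_eq hint))
      have hYs := hY s hs'
      have hZs := hZ s hs'
      have hw := hW0 s hs'
      have q0 := sq_nonneg (nrm (u s))
      have q1 := sq_nonneg (nrm (u₁ s))
      have e6' : ∫ x, ‖u s x‖ ^ (2 * 2 + 2) ≤ Y ^ 3 := by
        refine e6.trans ?_
        calc Y ^ 2 * nrm (u s) ^ 2 ≤ Y ^ 2 * Y := by gcongr; linarith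
          _ = _ := by ring
      have Y3 : 0 ≤ Y ^ 3 := by positivity
      have r1 : |a| * (W s + nrm (u₁ s) ^ 2) ≤ |a| * (W s + K) := by
        gcongr; linarith
      have r2 : 3 * |b| / 2 * (W s + nrm (u₂ s) ^ 2) + |b| * nrm (u s) ^ 2 ≤
          3 * |b| / 2 * (W s + K) := by
        have : |b| * nrm (u s) ^ 2 ≤ |b| * Y := by gcongr; linarith
        have : 3 * |b| / 2 * (W s + nrm (u₂ s) ^ 2) ≤ 3 * |b| / 2 * (W s + Z) := by gcongr
        have : 0 ≤ |b| * Y := by positivity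
        have : 0 ≤ |b| * Y ^ 3 := by positivity
        rw [hK]; linarith
      have r4 : |d + e| / 4 * (W s + ∫ x, ‖u s x‖ ^ (2 * 2 + 2)) ≤ |d + e| / 4 * (W s + K) := by
        gcongr; linarith
      calc _ ≤ 2 * (|a| * (W s + K) + 3 * |b| / 2 * (W s + K) + |d + e| / 4 * (W s + K)) :=
            mul_le_mul_of_nonneg_left (hI'.trans (by linarith)) two_pos.le
        _ = _ := by rw [ha₀]; ring) ht
  rw [← hWeq t ht, ← hWeq 0 h00]
  -- Grönwall gives `K (exp (a₀ T) - 1)` in place of `a₀ K T exp (a₀ T)`, which is larger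
  have hexp := Real.add_one_le_exp (-(a₀ * T))
  have hE := Real.exp_pos (a₀ * T)
  have h1 : Real.exp (a₀ * T) - 1 ≤ a₀ * T * Real.exp (a₀ * T) := by
    have h2 : Real.exp (a₀ * T) * Real.exp (-(a₀ * T)) = 1 := by
      rw [← Real.exp_add, add_neg_cancel, Real.exp_zero]
    have := mul_le_mul_of_nonneg_left hexp hE.le
    linarith
  have h3 := mul_le_mul_of_nonneg_left h1 hK0
  linarith

/-- The weighted norm is the limit of the norms with weights `R² sin² (x / R)`. -/
lemma tendsto_weight {f : ℝ → ℂ} (hf : Integrable (fun x => x ^ 2 * ‖f x‖ ^ 2) volume)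
    (hm : AEStronglyMeasurable f volume) :
    Tendsto (fun n : ℕ => ∫ x, (((n : ℝ) + 1) * Real.sin (x / (n + 1))) ^ 2 * ‖f x‖ ^ 2) atTop
      (𝓝 (∫ x, x ^ 2 * ‖f x‖ ^ 2)) := by
  have habs : ∀ (n : ℕ) (x : ℝ), (((n : ℝ) + 1) * Real.sin (x / (n + 1))) ^ 2 ≤ x ^ 2 := by
    intro n x
    have hn : (0 : ℝ) < n + 1 := by positivity
    rw [sq_le_sq, abs_mul, abs_of_pos hn]
    have h := mul_le_mul_of_nonneg_left (Real.abs_sin_le_abs (x := x / (n + 1))) hn.le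
    rwa [abs_div, abs_of_pos hn, mul_div_cancel₀ _ hn.ne'] at h
  refine tendsto_integral_of_dominated_convergence _ (fun n => ?_) hf (fun n => ?_) ?_
  · exact (Continuous.aestronglyMeasurable (by fun_prop)).mul (hm.norm.pow 2)
  · refine ae_of_all _ fun x => ?_
    rw [Real.norm_of_nonneg (by positivity)]
    exact mul_le_mul_of_nonneg_right (habs n x) (sq_nonneg _)
  · refine ae_of_all _ fun x => ?_
    refine Tendsto.mul_const _ (Tendsto.pow ?_ 2)
    rcases eq_or_ne x 0 with rfl | hx
    · simp
    have h1 : Tendsto (fun y : ℝ => Real.sin y / y) (𝓝[≠] 0) (𝓝 1) := by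
      have := hasDerivAt_iff_tendsto_slope.1 (Real.hasDerivAt_sin 0)
      simpa [slope_fun_def_field, Real.cos_zero] using this
    have h2 : Tendsto (fun n : ℕ => x / ((n : ℝ) + 1)) atTop (𝓝[≠] 0) := by
      refine tendsto_nhdsWithin_iff.2 ⟨?_, Eventually.of_forall fun n => ?_⟩
      · simpa using (tendsto_one_div_add_atTop_nhds_zero_nat (𝕜 := ℝ)).const_mul x |>.congr
          fun n => by ring
      · exact div_ne_zero hx (by positivity)
    have h3 := (h1.comp h2).const_mul x
    rw [mul_one] at h3
    refine h3.congr fun n => ?_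
    have hn : ((n : ℝ) + 1) ≠ 0 := by positivity
    simp only [Function.comp]
    field_simp

lemma continuous_bound₁ (a b c d e T : ℝ) :
    Continuous (fun q : ℝ × ℝ => bound₁ a b c d e T q.1 q.2) := by
  unfold bound₁ rate₁; fun_prop

lemma continuous_bound₂ (a b c d e T : ℝ) :
    Continuous (fun q : ℝ × ℝ => bound₂ a b c d e T q.1 q.2) := by
  unfold bound₂ rate₂ lowC; fun_prop

lemma MemX.integrable_sq_mul {s : ℝ} {f : L2} (h : MemX s 1 f) :
    Integrable (fun x => x ^ 2 * ‖f x‖ ^ 2) volume := by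
  refine h.2.mono' ((Continuous.aestronglyMeasurable (by fun_prop)).mul
    ((Lp.aestronglyMeasurable f).norm.pow 2)) (ae_of_all _ fun x => ?_)
  rw [Real.norm_of_nonneg (by positivity), Real.rpow_one, sq_abs]
  exact mul_le_mul_of_nonneg_right (by linarith) (sq_nonneg _)

end

end

end AirySchrodinger

theorem proposition3p2 (a b c d e T : ℝ) (hb : b ≠ 0) (hT : 0 < T) :
    ∃ h₀ : ℝ → ℝ → ℝ → ℝ,
      Continuous (fun p : ℝ × ℝ × ℝ => h₀ p.1 p.2.1 p.2.2) ∧ h₀ 0 0 0 = 0 ∧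
      ∀ s : ℝ, 3 ≤ s →
      ∀ (u₀ : AirySchrodinger.L2) (u : ℝ → AirySchrodinger.L2),
        AirySchrodinger.IsSolution a b c d e T u₀ u →
        (∀ t ∈ Set.Icc (-T) T, AirySchrodinger.MemX s 1 (u t)) →
        ∀ t ∈ Set.Icc (-T) T,
          AirySchrodinger.weightedNormSq (u t) ≤
            Real.exp ((2 * |a| + 3 * |b| + |d + e| / 2) * T) *
              (AirySchrodinger.weightedNormSq u₀ +
                (2 * |a| + 3 * |b| + |d + e| / 2) *
                  h₀ ‖u₀‖ ‖AirySchrodinger.wderiv u₀‖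
                    ‖AirySchrodinger.wderiv (AirySchrodinger.wderiv u₀)‖ * T) := by
  open AirySchrodinger MeasureTheory Set Filter Topology in
  refine ⟨fun m p r => bound₁ a b c d e T m p + bound₂ a b c d e T (bound₁ a b c d e T m p) r +
    bound₁ a b c d e T m p ^ 3, ?_, ?_, ?_⟩
  · have h1 : Continuous (fun q : ℝ × ℝ × ℝ => bound₁ a b c d e T q.1 q.2.1) :=
      (continuous_bound₁ a b c d e T).comp (continuous_fst.prodMk (continuous_fst.comp
        continuous_snd))
    have h2 : Continuous (fun q : ℝ × ℝ × ℝ =>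
        bound₂ a b c d e T (bound₁ a b c d e T q.1 q.2.1) q.2.2) :=
      (continuous_bound₂ a b c d e T).comp (h1.prodMk (continuous_snd.comp continuous_snd))
    exact (h1.add h2).add (h1.pow 3)
  · simp [bound₁, bound₂]
  · intro s _ u₀ u hu hX t ht
    have h00 : (0 : ℝ) ∈ Icc (-T) T := ⟨by linarith, hT.le⟩
    obtain ⟨U, U₁, U₂, hF, hU⟩ := hu.exists_flow
    obtain ⟨g0, g1, g2⟩ := hU 0 h00
    have n0 : nrm (U 0) = ‖u₀‖ := by rw [nrm_congr_ae g0, hu.init, Lp.norm_def]; rfl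
    have n1 : nrm (U₁ 0) = ‖wderiv u₀‖ := by rw [nrm_congr_ae g1, hu.init, Lp.norm_def]; rfl
    have n2 : nrm (U₂ 0) = ‖wderiv (wderiv u₀)‖ := by
      rw [nrm_congr_ae g2, hu.init, Lp.norm_def]; rfl
    rw [← n0, ← n1, ← n2]
    have hY : ∀ t ∈ Icc (-T) T, nrm (U₁ t) ^ 2 + nrm (U t) ^ 2 ≤
        bound₁ a b c d e T (nrm (U 0)) (nrm (U₁ 0)) := fun t ht => by
      have := hF.nrm_le hT ht
      have h2 : nrm (U t) ^ 2 ≤ nrm (U 0) ^ 2 := by gcongr; exact nrm_nonneg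
      linarith [hF.bound₁ hT hb ht]
    have hZ := fun t ht => hF.bound₂ hT hb hY (t := t) ht
    have hw : ∀ r ∈ Icc (-T) T, Tendsto (fun n : ℕ =>
        ∫ x, (((n : ℝ) + 1) * Real.sin (x / (n + 1))) ^ 2 * ‖U r x‖ ^ 2) atTop
        (𝓝 (weightedNormSq (u r))) := fun r hr => by
      have h := tendsto_weight (hX r hr).integrable_sq_mul (Lp.aestronglyMeasurable (u r))
      have e1 : weightedNormSq (u r) = ∫ x, x ^ 2 * ‖u r x‖ ^ 2 := by
        simp only [weightedNormSq, sq_abs]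
      rw [e1]
      refine h.congr fun n => integral_congr_ae ?_
      filter_upwards [(hU r hr).1] with x hx
      rw [hx]
    have h0 := hw 0 h00
    rw [hu.init] at h0
    exact le_of_tendsto_of_tendsto' (hw t ht) ((h0.add_const _).const_mul _) fun n =>
      hF.weighted_le hT hY hZ (R := (n : ℝ) + 1) (by linarith [n.cast_nonneg (α := ℝ)]) ht
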